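/- **Setting.** Let $q>2$, let $v\in\mathbb R^d\setminus\{0\}$, and let $\sigma_\xi,\sigma_0,\eta,\varepsilon>0$. The training set $D=\{(x_i,y_i)\}_{i=1}^n$ consists of i.i.d. points $x_i=[y_iv,\xi_i]\in(\mathbb R^d)^2$, where $y_i\in\{\pm1\}$ is Rademacher and, independently, $\xi_i\sim\mathcal N(0,\sigma_\xi^2(I-vv^\top/\|v\|^2))$. The network is $f(W,x)=F_{+1}(W_{+1},x)-F_{-1}(W_{-1},x)$ with $$F_j(W_j,x)=\tfrac1m\sum_{r=1}^m\big[\sigma(\langle w_{j,r},x_1\rangle)+\sigma(\langle w_{j,r},x_2\rangle)\big],\qquad \sigma(a)=\max\{0,a\}^q ,$$ and the empirical risk is $L_D(W)=\frac1n\sum_i\log(1+e^{-y_if(W,x_i)})$. Noisy gradient descent starts from i.i.d. $\mathcal N(0,\sigma_0^2)$ weights and iterates $$w_{j,r}^{(t+1)}=w_{j,r}^{(t)}-\eta\big(\nabla_{w_{j,r}}L_D(W^{(t)})+z_{t+1}\big),$$ with i.i.d. $z_t\sim\mathcal N(0,\sigma_z^2I_d)$ (the same $z_{t+1}$ for all filters);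 data, initialization and private noise are independent. Write $\|\xi\|:=\sigma_\xi\sqrt d$, $\mathrm{SNR}:=\|v\|/\|\xi\|$, $\mu:=\max\{1,\|v\|,\|\xi\|\}$, $\|W\|_F^2:=\sum_{j,r}\|w_{j,r}\|^2$. The signal and noise coefficients $\Gamma_{j,r}^{(t)}\ge0$, $\Phi_{j,r,i}^{(t)}$ are those of the decomposition $$w_{j,r}^{(t)}=w_{j,r}^{(0)}+j\,\Gamma_{j,r}^{(t)}\frac{v}{\|v\|^2}+\sum_{i=1}^n\Phi_{j,r,i}^{(t)}\frac{\xi_i}{\|\xi_i\|^2}-\eta\sum_{s=1}^tz_s .$$ **Conditions.** For $k\in\mathbb N$ put $\mathrm{pl}_k:=k(1+\log d)^k$. The signal-learning regime with polylogarithmic factor $\Lambda$ means - $d\ge\Lambda\,m^{\max\{2,4/(q-2)\}}\,n^{\max\{4,(2q-2)/(q-2)\}}$, $n\ge\Lambda$, $m\ge\Lambda$, and $\eta\le\Lambda^{-1}\min\{\|v\|^{-2},\|\xi\|^{-2}\}$; - $\Lambda(n\varepsilon)^{-1/q}\|v\|^{-1}\le\sigma_0\le\Lambda^{-1}\min\{\varepsilon^{-1/q}\|\xi\|^{-1},\,n^{-1/(2q)}\|v\|^{-1},\,(n\varepsilon)^{-(q+1)/q}\|\xi\|^{-1}\}$;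 - $\min\{\mathrm{SNR}\cdot n\varepsilon,\ \mathrm{SNR}^q\cdot n\}\ge\Lambda$. The end of the first stage is $$T_1=\left\lceil\frac{\log(16/(\sigma_0\|v\|))\,4^{q-1}m}{C_1\,\eta\,q\,\sigma_0^{q-2}\|v\|^q}\right\rceil$$ for a constant $C_1>0$. The number of iterations $T\ge T_1$ satisfies $$T\le T_p^*=\min\Big\{T^*,\ \frac{C\,mn\varepsilon\sigma_0}{\eta\,\mu\,(\|v\|+\|\xi\|)}\Big\},\qquad C=4\log T^*,$$ for a real number $T^*$ with $C\le\mathrm{pl}_A$. The private noise is calibrated as $\sigma_z=C_z\sqrt T\,(\|v\|+\|\xi\|)/(mn\varepsilon)$ with $0\le C_z\le\mathrm{pl}_A$. **Claim.** For all $q>2$, $\kappa>0$, $C_1>0$ and $A\in\mathbb N$ there is $K\in\mathbb N$, depending on these alone, such that the following holds for all $d,n,m,T,v,\sigma_\xi,\sigma_0,\eta,\varepsilon,T^*,C_z$ as above in the signal-learning regime with factor $\Lambda=\mathrm{pl}_K$. There is an event of probability at least $1-1/d$ on which the coefficients $\Gamma,\Phi$ exist and are unique, and 1. $T_1$ ends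 the first stage: $\max_r\Gamma_{j,r}^{(T_1)}\ge2$ for $j=\pm1$, and $|\Phi_{j,r,i}^{(t)}|\le\frac12\sigma_0\sigma_\xi\sqrt d$ for all $j,r,i$ and $0\le t\le T_1$. 2. If $(n\varepsilon)^{q+1}\ge m$, then $|\Phi_{j,r,i}^{(t)}|\le\sigma_0\sigma_\xi\sqrt d$ for all $j,r,i$ and all $t\in[T_1,T]$. 3. With $w_{j,r}^*=w_{j,r}^{(0)}+2qm\log(2q/\kappa)\cdot j\cdot v/\|v\|^2$, for every $t\in[T_1,T]$, $$\sum_{s=T_1}^tL_D(W^{(s)})\le\frac{\|W^{(T_1)}-W^*\|_F^2}{(2q-1)\eta}+\frac{(t-T_1+1)\kappa}{2q-1}+(t-T_1+1)\,\frac{\eta d\sigma_z^2+\mathrm{pl}_K\,\sigma_zm^{3/2}\|v\|^{-1}}{2q-1}.$$ -/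

import Mathlib

open MeasureTheory ProbabilityTheory

noncomputable section

namespace NoisyGD

/-- `ℝ^d` with the Euclidean norm. -/
abbrev Vec (d : ℕ) := EuclideanSpace ℝ (Fin d)

/-- The collection `W = (w_{j,r})` of convolution filters, `j ∈ {+1, -1}`, `r ∈ [m]`.
The two signs are encoded by `Bool`: `true` stands for `+1`, `false` for `-1`. -/
abbrev Filters (m d : ℕ) := Bool → Fin m → Vec d

/-- The real number `+1` or `-1` encoded by a Boolean. -/
def sgn (b : Bool) : ℝ := if b then 1 else -1

/-! ### Polylogarithmic factors -/

/-- The polylogarithmic factor `k (1 + log d)^k` in the dimension. It makes the notations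
`Õ` and `Ω̃` quantitative. -/
def polylog (k d : ℕ) : ℝ := k * (1 + Real.log d) ^ k

/-! ### The learner model -/

/-- Polynomial ReLU `σ(z) = (max {0, z})^q`. -/
def act (q z : ℝ) : ℝ := (max 0 z) ^ q

/-- Logistic loss `ℓ(z) = log (1 + exp (-z))`. -/
def logisticLoss (z : ℝ) : ℝ := Real.log (1 + Real.exp (-z))

/-- A labelled data point `(x, y)`, `x = [x₁, x₂]`. -/
structure DataPoint (d : ℕ) where
  patch₁ : Vec d
  patch₂ : Vec d
  label : Bool

/-- `F_j(W_j, x) = (1/m) ∑_r [σ(⟨w_{j,r}, x₁⟩) + σ(⟨w_{j,r}, x₂⟩)]`. -/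
def branch {m d : ℕ} (q : ℝ) (Wj : Fin m → Vec d) (x : DataPoint d) : ℝ :=
  (1 / (m : ℝ)) * ∑ r, (act q (inner ℝ (Wj r) x.patch₁) + act q (inner ℝ (Wj r) x.patch₂))

/-- The two-layer network `f(W, x) = F_{+1}(W_{+1}, x) - F_{-1}(W_{-1}, x)`. -/
def network {m d : ℕ} (q : ℝ) (W : Filters m d) (x : DataPoint d) : ℝ :=
  branch q (W true) x - branch q (W false) x

/-- Empirical risk `L_D(W) = (1/n) ∑_i ℓ(y_i f(W, x_i))`. -/
def empiricalRisk {n m d : ℕ} (q : ℝ) (D : Fin n → DataPoint d) (W : Filters m d) : ℝ :=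
  (1 / (n : ℝ)) * ∑ i, logisticLoss (sgn (D i).label * network q W (D i))

/-- The partial gradient `∇_{w_{j,r}} L_D(W)`. -/
def partialGradient {n m d : ℕ} (q : ℝ) (D : Fin n → DataPoint d) (W : Filters m d)
    (j : Bool) (r : Fin m) : Vec d :=
  gradient (fun u : Vec d =>
    empiricalRisk q D (Function.update W j (Function.update (W j) r u))) (W j r)

/-- Noisy gradient descent with initialization `W₀`: the step from `t` to `t + 1` is
`w_{j,r} ↦ w_{j,r} - η (∇_{w_{j,r}} L_D(W) + z_{t+1})`. -/
def iterate {n m d : ℕ} (q η : ℝ) (D : Fin n → DataPoint d) (W₀ : Filters m d)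
    (z : ℕ → Vec d) : ℕ → Filters m d
  | 0 => W₀
  | t + 1 => fun j r =>
      iterate q η D W₀ z t j r
        - η • (partialGradient q D (iterate q η D W₀ z t) j r + z (t + 1))

/-- `‖W‖_F = sqrt (‖W_{+1}‖_F² + ‖W_{-1}‖_F²)`. -/
def frobNorm {m d : ℕ} (W : Filters m d) : ℝ :=
  Real.sqrt ((∑ r, ‖W true r‖ ^ 2) + ∑ r, ‖W false r‖ ^ 2)

/-- The reference filters `w*_{j,r} = w_{j,r}^{(0)} + 2 q m log(2q/κ) j v / ‖v‖²`. -/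
def reference {m d : ℕ} (q κ : ℝ) (v : Vec d) (W₀ : Filters m d) : Filters m d :=
  fun j r => W₀ j r + (2 * q * m * Real.log (2 * q / κ) * sgn j * (‖v‖ ^ 2)⁻¹) • v

/-- `Γ` and `Φ` are coefficients of a signal-noise decomposition of the trajectory `W`:
`Γ_{j,r}^{(t)} ≥ 0` and
`w_{j,r}^{(t)} = w_{j,r}^{(0)} + j Γ_{j,r}^{(t)} v/‖v‖² + ∑_i Φ_{j,r,i}^{(t)} ξ_i/‖ξ_i‖²
  - η ∑_{s=1}^t z_s`. -/
def IsDecomposition {n m d : ℕ} (η : ℝ) (v : Vec d) (ξ : Fin n → Vec d) (z : ℕ → Vec d)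
    (W : ℕ → Filters m d) (Γ : ℕ → Bool → Fin m → ℝ) (Φ : ℕ → Bool → Fin m → Fin n → ℝ) :
    Prop :=
  ∀ t j r, 0 ≤ Γ t j r ∧
    W t j r = W 0 j r + (sgn j * Γ t j r * (‖v‖ ^ 2)⁻¹) • v
      + ∑ i, (Φ t j r i * (‖ξ i‖ ^ 2)⁻¹) • ξ i
      - η • ∑ s ∈ Finset.Icc 1 t, z s

/-! ### The probability space -/

/-- `H = I - v vᵀ / ‖v‖²`. -/
def projMatrix {d : ℕ} (v : Vec d) : Matrix (Fin d) (Fin d) ℝ :=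
  1 - (‖v‖ ^ 2)⁻¹ • Matrix.vecMulVec (fun i => v i) (fun i => v i)

theorem projMatrix_posSemidef {d : ℕ} (v : Vec d) : (projMatrix v).PosSemidef := by
  have hvv : (fun i => v i) ⬝ᵥ (fun i => v i) = ‖v‖ ^ 2 := by
    rw [EuclideanSpace.real_norm_sq_eq]; simp [dotProduct, sq]
  have hH : (projMatrix v).IsHermitian := by
    ext i j
    simp [projMatrix, Matrix.vecMulVec_apply, Matrix.one_apply, eq_comm, mul_comm]
  have hid : projMatrix v = (projMatrix v).conjTranspose * projMatrix v := by
    rw [hH.eq]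
    by_cases hv : ‖v‖ = 0
    · simp [projMatrix, hv]
    · simp only [projMatrix, sub_mul, mul_sub, one_mul, mul_one, Matrix.smul_mul, Matrix.mul_smul,
        Matrix.vecMulVec_mul_vecMulVec, hvv, smul_smul, Matrix.vecMulVec_smul]
      have h1 : (‖v‖ ^ 2)⁻¹ * ((‖v‖ ^ 2)⁻¹ * ‖v‖ ^ 2) = (‖v‖ ^ 2)⁻¹ := by field_simp
      simp [h1]
  rw [hid]
  exact Matrix.posSemidef_conjTranspose_mul_self _

/-- The Gaussian `N(0, σ² I_d)`. -/
def isotropicGaussian (d : ℕ) (σ : ℝ) : Measure (Vec d) :=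
  multivariateGaussian 0 ((σ ^ 2) • (1 : Matrix (Fin d) (Fin d) ℝ))

instance (d : ℕ) (σ : ℝ) : IsProbabilityMeasure (isotropicGaussian d σ) := by
  unfold isotropicGaussian; infer_instance

/-- The law of the label and of the noise patch of one data point: the label is Rademacher, the
noise is `N(0, σ_ξ² H)`, and they are independent. -/
def labelNoiseLaw {d : ℕ} (v : Vec d) (σξ : ℝ) : Measure (Bool × Vec d) :=
  ((PMF.uniformOfFintype Bool).toMeasure).prod
    (multivariateGaussian 0 ((σξ ^ 2) • projMatrix v))

/-- An outcome: labels and noise patches of the `n` training points, the initial filters, and the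
private noise vectors `z_1, z_2, …`. -/
abbrev Outcome (n m d : ℕ) := (Fin n → Bool × Vec d) × Filters m d × (ℕ → Vec d)

/-- The joint law of everything random, on the product space: i.i.d. training points, i.i.d.
`N(0, σ₀²)` initial weights and i.i.d. `N(0, σ_z² I_d)` private noise vectors, the three families
being independent of each other. -/
def outcomeLaw (n m : ℕ) {d : ℕ} (v : Vec d) (σξ σ₀ σz : ℝ) :
    Measure (Outcome n m d) :=
  (Measure.pi fun _ : Fin n => labelNoiseLaw v σξ).prod
    ((Measure.pi fun _ : Bool => Measure.pi fun _ : Fin m => isotropicGaussian d σ₀).prod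
      (Measure.infinitePi fun _ : ℕ => isotropicGaussian d σz))

/-- The noise patches `ξ_i`. -/
def noisePatches {n m d : ℕ} (ω : Outcome n m d) (i : Fin n) : Vec d := (ω.1 i).2

/-- The initial filters `W^{(0)}`. -/
def initFilters {n m d : ℕ} (ω : Outcome n m d) : Filters m d := ω.2.1

/-- The private noise vectors `z_t`; step `t` to `t + 1` of the algorithm uses `z_{t+1}`. -/
def privateNoise {n m d : ℕ} (ω : Outcome n m d) : ℕ → Vec d := ω.2.2

/-- The training set: `x_i = [y_i v, ξ_i]` with label `y_i`. -/
def trainingSet {n m d : ℕ} (v : Vec d) (ω : Outcome n m d) (i : Fin n) : DataPoint d :=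
  ⟨sgn (ω.1 i).1 • v, noisePatches ω i, (ω.1 i).1⟩

/-- The trajectory `W^{(0)}, W^{(1)}, …` of noisy gradient descent. -/
def trajectory {n m d : ℕ} (q η : ℝ) (v : Vec d) (ω : Outcome n m d) : ℕ → Filters m d :=
  iterate q η (trainingSet v ω) (initFilters ω) (privateNoise ω)

/-! ### The signal-learning regime -/

/-- The scale `‖ξ‖ = σ_ξ √d` of the norm of the data noise. -/
def noiseNorm (d : ℕ) (σξ : ℝ) : ℝ := σξ * Real.sqrt d

/-- Signal-to-noise ratio `‖v‖ / ‖ξ‖`. -/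
def SNR {d : ℕ} (v : Vec d) (σξ : ℝ) : ℝ := ‖v‖ / noiseNorm d σξ

/-- The conditions of signal learning, with hidden polylogarithmic factors equal to `L`. -/
structure SignalLearning (q L : ℝ) (n m : ℕ) {d : ℕ} (v : Vec d) (σξ σ₀ η ε : ℝ) : Prop where
  dim : L * (m : ℝ) ^ max 2 (4 / (q - 2)) * (n : ℝ) ^ max 4 ((2 * q - 2) / (q - 2)) ≤ d
  samples : L ≤ n
  width : L ≤ m
  step : L * η ≤ min (‖v‖ ^ (-2 : ℝ)) (noiseNorm d σξ ^ (-2 : ℝ))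
  init_lower : L * ((n * ε) ^ (-(1 / q)) * ‖v‖⁻¹) ≤ σ₀
  init_upper : L * σ₀ ≤
    min (ε ^ (-(1 / q)) * (noiseNorm d σξ)⁻¹)
      (min ((n : ℝ) ^ (-(1 / (2 * q))) * ‖v‖⁻¹)
        ((n * ε) ^ ((-q - 1) / q) * (noiseNorm d σξ)⁻¹))
  snr : L ≤ min (SNR v σξ * (n * ε)) (SNR v σξ ^ q * n)

/-- `μ = max {1, ‖v‖, ‖ξ‖}`. -/
def muMax {d : ℕ} (v : Vec d) (σξ : ℝ) : ℝ := max 1 (max ‖v‖ (noiseNorm d σξ))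

/-- The maximal number of private iterations
`T_p* = min {T*, η⁻¹ C m n ε σ₀ μ⁻¹ (‖v‖ + ‖ξ‖)⁻¹}` with `C = 4 log T*`. -/
def maxPrivateIterations (n m : ℕ) {d : ℕ} (v : Vec d) (σξ σ₀ η ε Tstar : ℝ) : ℝ :=
  min Tstar (η⁻¹ * (4 * Real.log Tstar * m * n * ε * σ₀ * (muMax v σξ)⁻¹
    * (‖v‖ + noiseNorm d σξ)⁻¹))

/-- The end of the first stage,
`T₁ = log(16/(σ₀‖v‖)) 4^{q-1} m / (C₁ η q σ₀^{q-2} ‖v‖^q)`, rounded up to an integer. -/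
def stageOneEnd (q C₁ : ℝ) (m : ℕ) {d : ℕ} (v : Vec d) (σ₀ η : ℝ) : ℕ :=
  ⌈Real.log (16 / (σ₀ * ‖v‖)) * (4 : ℝ) ^ (q - 1) * m
    / (C₁ * η * q * σ₀ ^ (q - 2) * ‖v‖ ^ q)⌉₊

/-- The standard deviation of the private noise, calibrated to the sensitivity
`(‖v‖ + ‖ξ‖)/(n m)` of the gradient, `T` iterations and privacy budget `ε`:
`σ_z = C √T (‖v‖ + ‖ξ‖) / (m n ε)`. -/
def privateNoiseStd (C : ℝ) (n m T : ℕ) {d : ℕ} (v : Vec d) (σξ ε : ℝ) : ℝ :=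
  C * Real.sqrt T * (‖v‖ + noiseNorm d σξ) / (m * n * ε)

end NoisyGD

end

/-!
The analysis is deterministic on a typical event, and on it everything reduces to the signal
coordinates `a_{j,r} = ⟨w_{j,r}, j v⟩`, which follow a gradient ascent of their own.

*Typical outcomes.* Fix a polylogarithmic level `u`. With probability at least `1 - 1/d`, each of
the random quantities that matter (initial correlations of the filters with `v` and `ξ_i`, the
norms `‖ξ_i‖`, the accumulated private noise in the directions `v` and `ξ_i`) is at most `u` times
its scale up to time `T`, both classes hold a quarter of the sample, some filter of
each sign starts with half a standard deviation of correlation with its own signal, and the `ξ_i`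
are orthogonal to `v` and linearly independent (`measure_not_typicalOutcome_le`). Sub-Gaussian tails
and a union bound suffice, because the condition on `T*` gives `T ≤ exp (u / 4)`. Orthogonality and
independence make the decomposition unique; its coefficients are the accumulated gradients.

*Noise coefficients.* As long as `∑_i |Φ_{j,r,i}| / ‖ξ_i‖ ≤ σ₀`, the filters have correlation
`Õ(σ₀ ‖ξ_i‖)` with `ξ_i`: by Cauchy-Schwarz for the part spanned by the noise patches, and since
`T` is limited by `η T (‖v‖ + ‖ξ‖) ≤ u m n ε σ₀` for the private noise. Hence one step increases the
sum by `Õ(η m⁻¹ (σ₀ ‖ξ‖)^{q-1} ‖ξ‖)`. The upper bound on `σ₀` makes `T` such steps smaller than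
`σ₀ / (2 u)`, so the induction closes (`TypicalOutcome.sum_noiseCoeff_le`). This covers both stages
at once. The margins then differ from their signal parts by at most `1/8`, and the signal
coordinates form a `SignalProcess`.

*First stage.* While all signal coefficients of a class are below `2`, its loss slopes are bounded
below, and the coefficient of a well initialized filter satisfies
`Γ' ≥ Γ + β (s/4 + Γ)^{q-1}` with `s = σ₀ ‖v‖`. The potential `(s/4 + Γ)^{-(q-2)}` decreases by a
fixed amount in each step and is exhausted before `T₁` (`SignalProcess.exists_two_le_coeff`). This
needs the private noise to stay below `s/4` only up to `T₁`, which is much shorter than the limit on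
`T`. The constant `C₁` is harmless: the factor `log (16 / s)` in `T₁` exceeds any constant.

*Second stage.* The squared distance to the reference in the signal direction is a potential: by
convexity of the loss and homogeneity of the network, each gradient step decreases it by
`(2q-1) η ‖v‖² L_D - η ‖v‖² κ` at least (`SignalProcess.sum_meanLoss_le`). The private noise is the
same for all filters, so the signs `j` cancel the contribution of the reference to its linear term,
and only the signal coefficients remain. These never exceed `O(√(m u))`, because a larger
coefficient makes the slope of its class so small that it gains at most `exp (-u) ≤ 1 / T` per step
(`SignalProcess.coeff_le`); this is the source of the factor `m^{3/2}`.
-/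

noncomputable section

namespace NoisyGD

/-! ### The activation, the logistic loss and the gradient -/

theorem act_nonneg (q z : ℝ) : 0 ≤ act q z := Real.rpow_nonneg (le_max_left _ _) _

theorem act_of_nonpos {q z : ℝ} (hq : 0 < q) (hz : z ≤ 0) : act q z = 0 := by
  rw [act, max_eq_left hz, Real.zero_rpow hq.ne']

theorem act_of_nonneg {q z : ℝ} (hz : 0 ≤ z) : act q z = z ^ q := by
  rw [act, max_eq_right hz]

theorem act_mono {q z w : ℝ} (hq : 0 < q) (h : z ≤ w) : act q z ≤ act q w :=
  Real.rpow_le_rpow (le_max_left _ _) (max_le_max le_rfl h) hq.le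

/-- Euler's identity for the positively homogeneous activation. -/
theorem mul_act_sub_one {q z : ℝ} (hq : 1 < q) : z * act (q - 1) z = act q z := by
  rcases le_or_gt z 0 with hz | hz
  · rw [act_of_nonpos (by linarith) hz, act_of_nonpos (by linarith) hz, mul_zero]
  · rw [act_of_nonneg hz.le, act_of_nonneg hz.le, Real.rpow_sub_one hz.ne']
    field_simp

theorem hasDerivAt_act {q : ℝ} (hq : 1 < q) (z : ℝ) :
    HasDerivAt (act q) (q * act (q - 1) z) z := by
  have hL : ∀ z ≤ (0 : ℝ), HasDerivWithinAt (act q) (q * act (q - 1) z) (Set.Iic 0) z := by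
    intro z hz
    rw [act_of_nonpos (by linarith) hz, mul_zero]
    exact (hasDerivWithinAt_const z (Set.Iic 0) (0 : ℝ)).congr
      (fun y hy => act_of_nonpos (by linarith) hy) (act_of_nonpos (by linarith) hz)
  have hR : ∀ z ≥ (0 : ℝ), HasDerivWithinAt (act q) (q * act (q - 1) z) (Set.Ici 0) z := by
    intro z hz
    rw [act_of_nonneg hz]
    exact (Real.hasDerivAt_rpow_const (Or.inr hq.le)).hasDerivWithinAt.congr
      (fun y hy => act_of_nonneg hy) (act_of_nonneg hz)
  rcases lt_trichotomy z 0 with hz | rfl | hz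
  · exact (hL z hz.le).hasDerivAt (Iic_mem_nhds hz)
  · have := (hL 0 le_rfl).union (hR 0 le_rfl)
    rwa [Set.Iic_union_Ici, hasDerivWithinAt_univ] at this
  · exact (hR z hz.le).hasDerivAt (Ici_mem_nhds hz)

/-- The negated derivative `1 / (1 + exp z)` of the logistic loss. -/
def lossSlope (z : ℝ) : ℝ := (1 + Real.exp z)⁻¹

theorem lossSlope_pos (z : ℝ) : 0 < lossSlope z := by unfold lossSlope; positivity

theorem lossSlope_le_one (z : ℝ) : lossSlope z ≤ 1 :=
  inv_le_one_of_one_le₀ (by linarith [Real.exp_pos z])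

theorem lossSlope_le_exp_neg (z : ℝ) : lossSlope z ≤ Real.exp (-z) := by
  rw [Real.exp_neg]
  exact inv_anti₀ (Real.exp_pos z) (by linarith)

theorem lossSlope_anti {z w : ℝ} (h : z ≤ w) : lossSlope w ≤ lossSlope z :=
  inv_anti₀ (by positivity) (by linarith [Real.exp_le_exp.2 h])

theorem hasDerivAt_logisticLoss (z : ℝ) : HasDerivAt logisticLoss (-lossSlope z) z := by
  have h1 : HasDerivAt (fun z => 1 + Real.exp (-z)) (Real.exp (-z) * -1) z :=
    ((hasDerivAt_neg z).exp).const_add 1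
  refine (h1.log (by positivity)).congr_deriv ?_
  rw [lossSlope, Real.exp_neg]
  have := Real.exp_pos z
  field_simp
  ring

theorem logisticLoss_nonneg (z : ℝ) : 0 ≤ logisticLoss z :=
  Real.log_nonneg (by linarith [Real.exp_pos (-z)])

theorem logisticLoss_le_exp_neg (z : ℝ) : logisticLoss z ≤ Real.exp (-z) := by
  have := Real.log_le_sub_one_of_pos (show 0 < 1 + Real.exp (-z) by positivity)
  unfold logisticLoss
  linarith

theorem logisticLoss_anti {z w : ℝ} (h : z ≤ w) : logisticLoss w ≤ logisticLoss z := by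
  have := Real.exp_le_exp.2 (neg_le_neg h)
  exact Real.log_le_log (by positivity) (by linarith)

/-- `|ℓ'| ≤ ℓ`. -/
theorem lossSlope_le_logisticLoss (z : ℝ) : lossSlope z ≤ logisticLoss z := by
  have h := Real.one_sub_inv_le_log_of_pos (show 0 < 1 + Real.exp (-z) by positivity)
  have : lossSlope z = 1 - (1 + Real.exp (-z))⁻¹ := by
    rw [lossSlope, Real.exp_neg]
    have := Real.exp_pos z
    field_simp
    ring
  unfold logisticLoss
  linarith

/-- The tangent inequality of the convex function `ℓ`, in the form used by the potential
argument. -/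
theorem lossSlope_mul_sub_le (p θ : ℝ) :
    lossSlope p * (p - θ) ≤ logisticLoss θ - logisticLoss p := by
  -- `ℓ(θ) - ℓ(p) = log ((1 + e^{-θ}) / (1 + e^{-p}))`, and weighted AM-GM bounds the quotient.
  have hp := Real.exp_pos p
  set l := lossSlope p with hl
  have hl0 : 0 ≤ l := (lossSlope_pos p).le
  have hl1 : l ≤ 1 := lossSlope_le_one p
  have hle : l * Real.exp p = 1 - l := by
    rw [hl, lossSlope]; field_simp; ring
  have hconv := convexOn_exp.2 (Set.mem_univ 0) (Set.mem_univ (p - θ))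
    (show 0 ≤ 1 - l by linarith) hl0 (by ring)
  simp only [smul_eq_mul, mul_zero, zero_add, Real.exp_zero, mul_one] at hconv
  have h1 : (1 - l + l * Real.exp (p - θ)) * (1 + Real.exp (-p)) = 1 + Real.exp (-θ) := by
    have e1 : Real.exp (p - θ) = Real.exp p * Real.exp (-θ) := by rw [← Real.exp_add]; ring_nf
    have e2 : Real.exp p * Real.exp (-p) = 1 := by rw [← Real.exp_add]; simp
    have e3 : 1 - l = l * Real.exp p := hle.symm
    have e4 : l * (1 + Real.exp p) = 1 := by linarith
    rw [e1, e3]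
    linear_combination (l + l * Real.exp (-θ)) * e2 + (1 + Real.exp (-θ)) * e4
  have h2 : Real.exp (l * (p - θ)) * (1 + Real.exp (-p)) ≤ 1 + Real.exp (-θ) := by
    rw [← h1]; gcongr
  have h3 := Real.log_le_log (by positivity) h2
  rw [Real.log_mul (by positivity) (by positivity), Real.log_exp] at h3
  unfold logisticLoss
  linarith

/-- A branch as a function of one of its filters. -/
theorem branch_update {m d : ℕ} (q : ℝ) (w : Fin m → Vec d) (r : Fin m) (u : Vec d)
    (x : DataPoint d) :
    branch q (Function.update w r u) x =
      (1 / (m : ℝ)) * (act q (inner ℝ u x.patch₁) + act q (inner ℝ u x.patch₂))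
      + (1 / (m : ℝ)) * ∑ s ∈ Finset.univ.erase r,
          (act q (inner ℝ (w s) x.patch₁) + act q (inner ℝ (w s) x.patch₂)) := by
  rw [branch, ← Finset.add_sum_erase _ _ (Finset.mem_univ r), mul_add]
  congr 2
  · simp
  · refine Finset.sum_congr rfl fun s hs => ?_
    rw [Function.update_of_ne (Finset.ne_of_mem_erase hs)]

theorem hasFDerivAt_act_inner {d : ℕ} {q : ℝ} (hq : 1 < q) (x u : Vec d) :
    HasFDerivAt (fun u : Vec d => act q (inner ℝ u x))
      ((q * act (q - 1) (inner ℝ u x)) • innerSL ℝ x) u := by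
  have h : HasFDerivAt (fun u : Vec d => inner ℝ u x) (innerSL ℝ x) u := by
    have := (innerSL ℝ x).hasFDerivAt (x := u)
    refine this.congr_of_eventuallyEq (Filter.Eventually.of_forall fun y => ?_)
    exact real_inner_comm _ _
  exact (hasDerivAt_act hq _).comp_hasFDerivAt u h

theorem hasFDerivAt_network_update {m d : ℕ} {q : ℝ} (hq : 1 < q) (W : Filters m d) (j : Bool)
    (r : Fin m) (x : DataPoint d) :
    HasFDerivAt
      (fun u : Vec d => network q (Function.update W j (Function.update (W j) r u)) x)
      ((sgn j * (q / m)) • (act (q - 1) (inner ℝ (W j r) x.patch₁) • innerSL ℝ x.patch₁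
        + act (q - 1) (inner ℝ (W j r) x.patch₂) • innerSL ℝ x.patch₂)) (W j r) := by
  have hb : HasFDerivAt (fun u : Vec d => branch q (Function.update (W j) r u) x)
      ((q / (m : ℝ)) • (act (q - 1) (inner ℝ (W j r) x.patch₁) • innerSL ℝ x.patch₁
        + act (q - 1) (inner ℝ (W j r) x.patch₂) • innerSL ℝ x.patch₂)) (W j r) := by
    simp_rw [branch_update]
    refine ((((hasFDerivAt_act_inner hq x.patch₁ (W j r)).add
      (hasFDerivAt_act_inner hq x.patch₂ (W j r))).const_mul (1 / (m : ℝ))).add_const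
        _).congr_fderiv ?_
    ext u
    simp
    ring
  cases j
  · have h : (fun u : Vec d =>
        network q (Function.update W false (Function.update (W false) r u)) x) =
        fun u => branch q (W true) x - branch q (Function.update (W false) r u) x := by
      ext u; simp [network]
    rw [h]
    refine (hb.const_sub _).congr_fderiv ?_
    ext u
    simp [sgn, add_comm]
  · have h : (fun u : Vec d =>
        network q (Function.update W true (Function.update (W true) r u)) x) =
        fun u => branch q (Function.update (W true) r u) x - branch q (W false) x := by
      ext u; simp [network]
    rw [h]
    refine (hb.sub_const _).congr_fderiv ?_
    ext u
    simp [sgn]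

/-- The margin `y_i f(W, x_i)` of a labelled point. -/
def margin {m d : ℕ} (q : ℝ) (W : Filters m d) (x : DataPoint d) : ℝ :=
  sgn x.label * network q W x

theorem partialGradient_eq {n m d : ℕ} {q : ℝ} (hq : 1 < q) (D : Fin n → DataPoint d)
    (W : Filters m d) (j : Bool) (r : Fin m) :
    partialGradient q D W j r = -∑ i, (sgn j * sgn (D i).label * (q / (m * n)
      * lossSlope (margin q W (D i)))) • (act (q - 1) (inner ℝ (W j r) (D i).patch₁) • (D i).patch₁
        + act (q - 1) (inner ℝ (W j r) (D i).patch₂) • (D i).patch₂) := by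
  apply HasGradientAt.gradient
  rw [hasGradientAt_iff_hasFDerivAt]
  have h1 : ∀ i, HasFDerivAt (fun u : Vec d => logisticLoss (sgn (D i).label *
      network q (Function.update W j (Function.update (W j) r u)) (D i))) _ (W j r) := fun i =>
    (hasDerivAt_logisticLoss _).comp_hasFDerivAt (W j r)
      ((hasFDerivAt_network_update hq W j r (D i)).const_mul (sgn (D i).label))
  have h2 := (HasFDerivAt.fun_sum (u := Finset.univ) fun i _ => h1 i).const_mul (1 / (n : ℝ))
  refine h2.congr_fderiv ?_
  ext u
  simp only [Function.update_eq_self, smul_apply, sum_apply, add_apply,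
    innerSL_apply_apply,
    InnerProductSpace.toDual_apply_apply, inner_neg_left, sum_inner, inner_smul_left,
    inner_add_left, smul_eq_mul, Finset.mul_sum, ← Finset.sum_neg_distrib, margin]
  refine Finset.sum_congr rfl fun i _ => ?_
  simp
  ring

/-! ### One step of the signal coordinates -/

section Step

variable {n m : ℕ}

/-- The sum of `-ℓ'` at the margins `p` over the points of class `j`, divided by the size `n` of the
whole sample. -/
def classSlope (y : Fin n → Bool) (p : Fin n → ℝ) (j : Bool) : ℝ :=
  (1 / (n : ℝ)) * ∑ i, if y i = j then lossSlope (p i) else 0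

/-- The average logistic loss of the margins `p`. -/
def meanLoss (p : Fin n → ℝ) : ℝ := (1 / (n : ℝ)) * ∑ i, logisticLoss (p i)

/-- With `a j r = ⟨w_{j,r}, j v⟩`, this is the value `F_j` on the patch `j v`. -/
def posOut (q : ℝ) (a : Bool → Fin m → ℝ) (j : Bool) : ℝ := (1 / (m : ℝ)) * ∑ r, act q (a j r)

/-- With `a j r = ⟨w_{j,r}, j v⟩`, this is the value `F_{-j}` on the patch `j v`. -/
def negOut (q : ℝ) (a : Bool → Fin m → ℝ) (j : Bool) : ℝ :=
  (1 / (m : ℝ)) * ∑ r, act q (-(a (!j) r))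

/-- The increment of the signal coefficient `Γ_{j,r}` in one gradient step, where
`B = η ‖v‖²`, `p` are the margins and `a j r = ⟨w_{j,r}, j v⟩`. -/
def signalInc (B q : ℝ) (y : Fin n → Bool) (p : Fin n → ℝ) (a : Bool → Fin m → ℝ)
    (j : Bool) (r : Fin m) : ℝ :=
  B * q / m * (classSlope y p j * act (q - 1) (a j r)
    + classSlope y p (!j) * act (q - 1) (-(a j r)))

variable {q B : ℝ} {y : Fin n → Bool} {p : Fin n → ℝ} {a : Bool → Fin m → ℝ}

theorem mean_le {k : ℕ} {f : Fin k → ℝ} {c : ℝ} (hc : 0 ≤ c) (h : ∀ i, f i ≤ c) :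
    (1 / (k : ℝ)) * ∑ i, f i ≤ c := by
  rcases Nat.eq_zero_or_pos k with rfl | hk
  · simpa using hc
  · have hk' : (0 : ℝ) < k := by exact_mod_cast hk
    have : ∑ i, f i ≤ k * c := by
      simpa using Finset.sum_le_card_nsmul Finset.univ f c (fun i _ => h i)
    rw [one_div, inv_mul_le_iff₀ hk']
    exact this

theorem classSlope_nonneg (y : Fin n → Bool) (p : Fin n → ℝ) (j : Bool) :
    0 ≤ classSlope y p j := by
  refine mul_nonneg (by positivity) (Finset.sum_nonneg fun i _ => ?_)
  split_ifs
  exacts [(lossSlope_pos _).le, le_rfl]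

theorem classSlope_le {c : ℝ} (hc : 0 ≤ c) {j : Bool} (h : ∀ i, y i = j → lossSlope (p i) ≤ c) :
    classSlope y p j ≤ c := by
  refine mean_le hc fun i => ?_
  split_ifs with hi
  exacts [h i hi, hc]

theorem classSlope_le_one (y : Fin n → Bool) (p : Fin n → ℝ) (j : Bool) :
    classSlope y p j ≤ 1 := classSlope_le zero_le_one fun _ _ => lossSlope_le_one _

theorem classSlope_mul_add (y : Fin n → Bool) (p : Fin n → ℝ) (c : Bool → ℝ) :
    classSlope y p true * c true + classSlope y p false * c false
      = (1 / (n : ℝ)) * ∑ i, lossSlope (p i) * c (y i) := by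
  unfold classSlope
  rw [mul_assoc, mul_assoc, ← mul_add, Finset.sum_mul, Finset.sum_mul, ← Finset.sum_add_distrib]
  congr 1
  refine Finset.sum_congr rfl fun i _ => ?_
  cases y i <;> simp

theorem meanLoss_nonneg (p : Fin n → ℝ) : 0 ≤ meanLoss p :=
  mul_nonneg (by positivity) (Finset.sum_nonneg fun _ _ => logisticLoss_nonneg _)

theorem classSlope_add_le (y : Fin n → Bool) (p : Fin n → ℝ) :
    classSlope y p true + classSlope y p false ≤ meanLoss p := by
  have := classSlope_mul_add y p fun _ => 1
  simp only [mul_one] at this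
  rw [this]
  unfold meanLoss
  gcongr
  exact lossSlope_le_logisticLoss _

theorem posOut_nonneg (q : ℝ) (a : Bool → Fin m → ℝ) (j : Bool) : 0 ≤ posOut q a j :=
  mul_nonneg (by positivity) (Finset.sum_nonneg fun _ _ => act_nonneg _ _)

theorem negOut_nonneg (q : ℝ) (a : Bool → Fin m → ℝ) (j : Bool) : 0 ≤ negOut q a j :=
  mul_nonneg (by positivity) (Finset.sum_nonneg fun _ _ => act_nonneg _ _)

theorem signalInc_nonneg (hB : 0 ≤ B) (hq : 0 ≤ q) (j : Bool) (r : Fin m) :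
    0 ≤ signalInc B q y p a j r := by
  have h1 := classSlope_nonneg y p j
  have h2 := classSlope_nonneg y p (!j)
  have h3 := act_nonneg (q - 1) (a j r)
  have h4 := act_nonneg (q - 1) (-(a j r))
  unfold signalInc
  positivity

theorem act_le_of_le {q z c : ℝ} (hq : 1 ≤ q) (hc : 0 ≤ c) (hc1 : c ≤ 1) (h : z ≤ c) :
    act q z ≤ c := by
  refine (act_mono (by linarith) h).trans ?_
  rw [act_of_nonneg hc]
  exact Real.rpow_le_self_of_le_one hc hc1 hq

theorem act_sub_one_le {q z : ℝ} (hq : 1 < q) : act (q - 1) z ≤ 1 + act q z := by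
  rcases le_total z 1 with hz | hz
  · have : act (q - 1) z ≤ 1 := by
      refine (act_mono (by linarith) hz).trans ?_
      rw [act_of_nonneg zero_le_one, Real.one_rpow]
    linarith [act_nonneg q z]
  · rw [act_of_nonneg (by linarith), act_of_nonneg (by linarith)]
    have := Real.rpow_le_rpow_of_exponent_le hz (show q - 1 ≤ q by linarith)
    linarith

theorem act_le_mul_posOut [NeZero m] (q : ℝ) (a : Bool → Fin m → ℝ) (j : Bool) (r : Fin m) :
    act q (a j r) ≤ m * posOut q a j := by
  have hm : (m : ℝ) ≠ 0 := by exact_mod_cast NeZero.ne m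
  rw [posOut, ← mul_assoc, mul_one_div_cancel hm, one_mul]
  exact Finset.single_le_sum (f := fun r => act q (a j r)) (fun _ _ => act_nonneg _ _)
    (Finset.mem_univ r)

/-- Conditions under which the margins are governed by the signal alone: the noise patches move
them by at most `1/8`, and no filter is much anti-aligned with its own signal direction. -/
structure SignalDominated (q : ℝ) (y : Fin n → Bool) (p : Fin n → ℝ)
    (a : Bool → Fin m → ℝ) : Prop where
  margin : ∀ i, |p i - (posOut q a (y i) - negOut q a (y i))| ≤ 1 / 8
  lower : ∀ j r, -(1 / 8) ≤ a j r

namespace SignalDominated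

theorem negOut_le (h : SignalDominated q y p a) (hq : 1 ≤ q) (j : Bool) :
    negOut q a j ≤ 1 / 8 :=
  mean_le (by norm_num) fun r =>
    act_le_of_le hq (by norm_num) (by norm_num) (by linarith [h.lower (!j) r])

theorem le_margin (h : SignalDominated q y p a) (hq : 1 ≤ q) (i : Fin n) :
    posOut q a (y i) - 1 / 4 ≤ p i := by
  have h1 := abs_le.1 (h.margin i)
  linarith [h.negOut_le hq (y i)]

theorem margin_le (h : SignalDominated q y p a) (i : Fin n) :
    p i ≤ posOut q a (y i) + 1 / 8 := by
  have h1 := abs_le.1 (h.margin i)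
  linarith [negOut_nonneg q a (y i)]

theorem classSlope_le (h : SignalDominated q y p a) (hq : 1 ≤ q) (j : Bool) :
    classSlope y p j ≤ 2 * Real.exp (-posOut q a j) := by
  refine NoisyGD.classSlope_le (by positivity) fun i hi => ?_
  have h1 := h.le_margin hq i
  have h2 : Real.exp (1 / 4) ≤ 2 := by
    have := Real.exp_bound_div_one_sub_of_interval (x := 1 / 4) (by norm_num) (by norm_num)
    linarith
  calc lossSlope (p i) ≤ Real.exp (-p i) := lossSlope_le_exp_neg _
    _ ≤ Real.exp (1 / 4 + -posOut q a j) := by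
        rw [Real.exp_le_exp, ← hi]; linarith
    _ = Real.exp (1 / 4) * Real.exp (-posOut q a j) := Real.exp_add _ _
    _ ≤ 2 * Real.exp (-posOut q a j) := by gcongr

theorem act_neg_le_one (h : SignalDominated q y p a) (hq : 2 ≤ q) (j : Bool) (r : Fin m) :
    act (q - 1) (-(a j r)) ≤ 1 :=
  (act_le_of_le (c := 1 / 8) (by linarith) (by norm_num) (by norm_num)
    (by linarith [h.lower j r])).trans (by norm_num)

/-- No margin is below `-1/4`, and `log (1 + exp (1/4)) ≤ 1`. -/
theorem meanLoss_le_one (h : SignalDominated q y p a) (hq : 1 ≤ q) : meanLoss p ≤ 1 := by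
  refine mean_le zero_le_one fun i => ?_
  have h1 := h.le_margin hq i
  have h2 := posOut_nonneg q a (y i)
  refine (logisticLoss_anti (show -(1 / 4) ≤ p i by linarith)).trans ?_
  rw [logisticLoss, Real.log_le_iff_le_exp (by positivity)]
  have h3 := Real.exp_bound_div_one_sub_of_interval (x := 1 / 4) (by norm_num) (by norm_num)
  have h4 := Real.exp_one_gt_d9
  norm_num at h3 ⊢
  linarith

/-- The squared gradient is bounded by the loss: where a branch is large, the slope of the loss is
exponentially small in it. -/
theorem sum_signalInc_sq_le [NeZero m] (h : SignalDominated q y p a) (hq : 2 < q) :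
    ∑ j, ∑ r, signalInc B q y p a j r ^ 2 ≤ 10 * (B * q) ^ 2 * meanLoss p := by
  have hm : (1 : ℝ) ≤ m := by exact_mod_cast NeZero.one_le
  have key : ∀ j, ∑ r, signalInc B q y p a j r ^ 2 ≤
      (B * q) ^ 2 * (8 * classSlope y p j + 2 * classSlope y p (!j)) := by
    intro j
    set α := classSlope y p j with hα
    set β := classSlope y p (!j) with hβ
    set F := posOut q a j with hF
    have hα0 : 0 ≤ α := classSlope_nonneg _ _ _
    have hβ0 : 0 ≤ β := classSlope_nonneg _ _ _
    have hβ1 : β ≤ 1 := classSlope_le_one _ _ _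
    have hF0 : 0 ≤ F := posOut_nonneg _ _ _
    have hA : ∑ r, act (q - 1) (a j r) ^ 2 ≤ m ^ 2 * (1 + F ^ 2) := by
      have e1 : ∀ r, act (q - 1) (a j r) ^ 2 ≤ 1 + act q (a j r) ^ 2 := by
        intro r
        rcases le_total (a j r) 1 with hz | hz
        · have : act (q - 1) (a j r) ≤ 1 := by
            refine (act_mono (by linarith) hz).trans ?_
            rw [act_of_nonneg zero_le_one, Real.one_rpow]
          have h0 := act_nonneg (q - 1) (a j r)
          nlinarith [sq_nonneg (act q (a j r))]
        · have : act (q - 1) (a j r) ≤ act q (a j r) := by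
            rw [act_of_nonneg (by linarith), act_of_nonneg (by linarith)]
            exact Real.rpow_le_rpow_of_exponent_le hz (by linarith)
          have := pow_le_pow_left₀ (act_nonneg (q - 1) (a j r)) this 2
          linarith
      have e2 : ∑ r, act q (a j r) ^ 2 ≤ (∑ r, act q (a j r)) ^ 2 :=
        Finset.sum_sq_le_sq_sum_of_nonneg fun r _ => act_nonneg _ _
      have e3 : ∑ r, act q (a j r) = m * F := by
        rw [hF, posOut]; field_simp
      calc ∑ r, act (q - 1) (a j r) ^ 2 ≤ ∑ r, (1 + act q (a j r) ^ 2) :=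
            Finset.sum_le_sum fun r _ => e1 r
        _ = m + ∑ r, act q (a j r) ^ 2 := by simp [Finset.sum_add_distrib]
        _ ≤ m + (m * F) ^ 2 := by rw [← e3]; linarith
        _ ≤ m ^ 2 * (1 + F ^ 2) := by nlinarith
    have hC : ∑ r, act (q - 1) (-(a j r)) ^ 2 ≤ m ^ 2 := by
      have e1 : ∀ r, act (q - 1) (-(a j r)) ^ 2 ≤ 1 := fun r =>
        pow_le_one₀ (act_nonneg _ _) (h.act_neg_le_one hq.le j r)
      calc ∑ r, act (q - 1) (-(a j r)) ^ 2 ≤ ∑ _r : Fin m, (1 : ℝ) :=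
            Finset.sum_le_sum fun r _ => e1 r
        _ = m := by simp
        _ ≤ m ^ 2 := by nlinarith
    have hα2 : α ^ 2 * (1 + F ^ 2) ≤ 4 * α := by
      have e1 : α ≤ 2 * Real.exp (-F) := h.classSlope_le (by linarith) j
      have e2 : Real.exp (-F) * (1 + F ^ 2) ≤ 2 := by
        rw [Real.exp_neg, inv_mul_le_iff₀ (Real.exp_pos _)]
        linarith [Real.quadratic_le_exp_of_nonneg hF0]
      calc α ^ 2 * (1 + F ^ 2) = α * (α * (1 + F ^ 2)) := by ring
        _ ≤ α * (2 * Real.exp (-F) * (1 + F ^ 2)) := by gcongr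
        _ ≤ 4 * α := by nlinarith
    have hstep : ∀ r, signalInc B q y p a j r ^ 2 ≤ (B * q / m) ^ 2 *
        (2 * α ^ 2 * act (q - 1) (a j r) ^ 2 + 2 * β ^ 2 * act (q - 1) (-(a j r)) ^ 2) := by
      intro r
      rw [signalInc, mul_pow]
      gcongr
      nlinarith [sq_nonneg (α * act (q - 1) (a j r) - β * act (q - 1) (-(a j r)))]
    calc ∑ r, signalInc B q y p a j r ^ 2
        ≤ ∑ r, (B * q / m) ^ 2 *
        (2 * α ^ 2 * act (q - 1) (a j r) ^ 2 + 2 * β ^ 2 * act (q - 1) (-(a j r)) ^ 2) :=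
          Finset.sum_le_sum fun r _ => hstep r
      _ = (B * q / m) ^ 2 * (2 * α ^ 2 * ∑ r, act (q - 1) (a j r) ^ 2
            + 2 * β ^ 2 * ∑ r, act (q - 1) (-(a j r)) ^ 2) := by
          rw [← Finset.mul_sum, Finset.sum_add_distrib, ← Finset.mul_sum, ← Finset.mul_sum]
      _ ≤ (B * q / m) ^ 2 * (2 * α ^ 2 * (m ^ 2 * (1 + F ^ 2)) + 2 * β ^ 2 * m ^ 2) := by
          gcongr
      _ = (B * q) ^ 2 * (2 * (α ^ 2 * (1 + F ^ 2)) + 2 * β ^ 2) := by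
          field_simp
      _ ≤ (B * q) ^ 2 * (8 * α + 2 * β) := by
          have : β ^ 2 ≤ β := by nlinarith
          gcongr ?_ * ?_
          linarith
  rw [Fintype.sum_bool]
  have k1 := key true
  have k2 := key false
  have k3 := classSlope_add_le y p
  simp only [Bool.not_true, Bool.not_false] at k1 k2
  nlinarith [sq_nonneg (B * q)]

/-- The negative gradient points towards every reference that is large enough in the signal
direction, with a margin given by the convexity of the loss and the homogeneity of the
network. -/
theorem sum_sub_mul_signalInc_le [NeZero m] (h : SignalDominated q y p a) (hB : 0 ≤ B)
    (hq : 2 < q) {ref : Bool → Fin m → ℝ} {θ : ℝ} (hθ : 0 ≤ θ)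
    (href : ∀ j r, m * (θ + 1 / 4) ≤ ref j r) (hact : ∀ j, ∃ r, 1 ≤ a j r) :
    ∑ j, ∑ r, (a j r - ref j r) * signalInc B q y p a j r
      ≤ B * q * (logisticLoss θ - meanLoss p) := by
  have hm : (0 : ℝ) < m := by exact_mod_cast NeZero.pos m
  have href0 : ∀ j r, 0 ≤ ref j r := fun j r => le_trans (by positivity) (href j r)
  set P : Bool → ℝ := fun j => (1 / (m : ℝ)) * ∑ r, (a j r - ref j r) * act (q - 1) (a j r)
    with hP
  set N : Bool → ℝ := fun j =>
    (1 / (m : ℝ)) * ∑ r, (a (!j) r - ref (!j) r) * act (q - 1) (-(a (!j) r)) with hN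
  have hPle : ∀ j, P j ≤ posOut q a j - (θ + 1 / 4) := by
    intro j
    have e1 : P j = posOut q a j - (1 / (m : ℝ)) * ∑ r, ref j r * act (q - 1) (a j r) := by
      simp only [hP, posOut]
      rw [← mul_sub, ← Finset.sum_sub_distrib]
      congr 1
      refine Finset.sum_congr rfl fun r _ => ?_
      rw [sub_mul, mul_act_sub_one (by linarith)]
    obtain ⟨r, hr⟩ := hact j
    have e2 : m * (θ + 1 / 4) ≤ ∑ r, ref j r * act (q - 1) (a j r) := by
      have e3 : (1 : ℝ) ≤ act (q - 1) (a j r) := by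
        rw [act_of_nonneg (by linarith)]
        exact Real.one_le_rpow hr (by linarith)
      calc m * (θ + 1 / 4) ≤ ref j r * 1 := by rw [mul_one]; exact href j r
        _ ≤ ref j r * act (q - 1) (a j r) := by gcongr; exact href0 j r
        _ ≤ _ := Finset.single_le_sum (f := fun r => ref j r * act (q - 1) (a j r))
            (fun r _ => mul_nonneg (href0 j r) (act_nonneg _ _)) (Finset.mem_univ r)
    have e4 : θ + 1 / 4 ≤ (1 / (m : ℝ)) * ∑ r, ref j r * act (q - 1) (a j r) := by
      rwa [one_div_mul_eq_div, le_div_iff₀' hm]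
    linarith
  have hNle : ∀ j, N j ≤ -negOut q a j := by
    intro j
    simp only [hN, negOut]
    rw [← mul_neg, ← Finset.sum_neg_distrib]
    gcongr with r
    have e1 := mul_act_sub_one (q := q) (z := -(a (!j) r)) (by linarith)
    have e2 := mul_nonneg (href0 (!j) r) (act_nonneg (q - 1) (-(a (!j) r)))
    linarith
  have hrew : ∑ j, ∑ r, (a j r - ref j r) * signalInc B q y p a j r
      = B * q * (classSlope y p true * (P true + N true)
        + classSlope y p false * (P false + N false)) := by
    have e1 : ∀ j, ∑ r, (a j r - ref j r) * signalInc B q y p a j r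
        = B * q * (classSlope y p j * P j + classSlope y p (!j) * N (!j)) := by
      intro j
      simp only [hP, hN, Bool.not_not, Finset.mul_sum, signalInc]
      rw [← Finset.sum_add_distrib, Finset.mul_sum]
      refine Finset.sum_congr rfl fun r _ => ?_
      field_simp
    rw [Fintype.sum_bool, e1, e1]
    simp only [Bool.not_true, Bool.not_false]
    ring
  rw [hrew, classSlope_mul_add y p fun j => P j + N j, meanLoss]
  refine mul_le_mul_of_nonneg_left ?_ (by positivity)
  rcases Nat.eq_zero_or_pos n with rfl | hn
  · simpa using logisticLoss_nonneg θ
  have hn' : (0 : ℝ) < n := by exact_mod_cast hn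
  have e5 : ∀ i, lossSlope (p i) * (P (y i) + N (y i)) ≤ logisticLoss θ - logisticLoss (p i) := by
    intro i
    refine le_trans ?_ (lossSlope_mul_sub_le (p i) θ)
    refine mul_le_mul_of_nonneg_left ?_ (lossSlope_pos _).le
    have := abs_le.1 (h.margin i)
    linarith [hPle (y i), hNle (y i)]
  calc (1 / (n : ℝ)) * ∑ i, lossSlope (p i) * (P (y i) + N (y i))
      ≤ (1 / (n : ℝ)) * ∑ i, (logisticLoss θ - logisticLoss (p i)) := by
        gcongr with i; exact e5 i
    _ = logisticLoss θ - (1 / (n : ℝ)) * ∑ i, logisticLoss (p i) := by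
        rw [Finset.sum_sub_distrib, mul_sub]
        simp
        field_simp

theorem signalInc_le [NeZero m] (h : SignalDominated q y p a) (hB : 0 ≤ B) (hq : 2 < q)
    (j : Bool) (r : Fin m) : signalInc B q y p a j r ≤ 3 * (B * q) := by
  have hm : (1 : ℝ) ≤ m := by exact_mod_cast NeZero.one_le
  set F := posOut q a j
  have hF0 : 0 ≤ F := posOut_nonneg _ _ _
  have e1 : classSlope y p j * act (q - 1) (a j r) ≤ 2 * m := by
    have f1 : act (q - 1) (a j r) ≤ m * (1 + F) := by
      linarith [act_sub_one_le (z := a j r) (show 1 < q by linarith), act_le_mul_posOut q a j r]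
    have f2 : Real.exp (-F) * (1 + F) ≤ 1 := by
      rw [Real.exp_neg, inv_mul_le_iff₀ (Real.exp_pos _)]
      linarith [Real.add_one_le_exp F]
    calc classSlope y p j * act (q - 1) (a j r) ≤ (2 * Real.exp (-F)) * (m * (1 + F)) :=
          mul_le_mul (h.classSlope_le (by linarith) j) f1 (act_nonneg _ _) (by positivity)
      _ = 2 * m * (Real.exp (-F) * (1 + F)) := by ring
      _ ≤ 2 * m := mul_le_of_le_one_right (by positivity) f2
  have e2 : classSlope y p (!j) * act (q - 1) (-(a j r)) ≤ m :=
    (mul_le_one₀ (classSlope_le_one _ _ _) (act_nonneg _ _) (h.act_neg_le_one hq.le j r)).trans hm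
  calc signalInc B q y p a j r ≤ B * q / m * (2 * m + m) := by
        unfold signalInc; gcongr
    _ = 3 * (B * q) := by field_simp; ring

/-- The increment is exponentially small in the output of the branch. -/
theorem signalInc_le_exp [NeZero m] (h : SignalDominated q y p a) (hB : 0 ≤ B) (hq : 2 < q)
    {j : Bool} {r : Fin m} (hr : 0 ≤ a j r) :
    signalInc B q y p a j r ≤ 4 * (B * q) * Real.exp (-(posOut q a j / 2)) := by
  have hm : (1 : ℝ) ≤ m := by exact_mod_cast NeZero.one_le
  set F := posOut q a j with hF
  have hF0 : 0 ≤ F := posOut_nonneg _ _ _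
  have e0 : act (q - 1) (-(a j r)) = 0 := act_of_nonpos (by linarith) (by linarith)
  have f1 : act (q - 1) (a j r) ≤ m * (1 + F) := by
    linarith [act_sub_one_le (z := a j r) (show 1 < q by linarith), act_le_mul_posOut q a j r]
  have f2 : Real.exp (-F) * (1 + F) ≤ 2 * Real.exp (-(F / 2)) := by
    have : Real.exp (-F) = Real.exp (-(F / 2)) * Real.exp (-(F / 2)) := by
      rw [← Real.exp_add]; ring_nf
    have g : Real.exp (-(F / 2)) * (1 + F) ≤ 2 := by
      rw [Real.exp_neg, inv_mul_le_iff₀ (Real.exp_pos _)]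
      linarith [Real.add_one_le_exp (F / 2)]
    rw [this, mul_assoc, mul_comm 2]
    gcongr
  calc signalInc B q y p a j r = B * q / m * (classSlope y p j * act (q - 1) (a j r)) := by
        rw [signalInc, e0]; ring
    _ ≤ B * q / m * ((2 * Real.exp (-F)) * (m * (1 + F))) := by
        refine mul_le_mul_of_nonneg_left ?_ (by positivity)
        exact mul_le_mul (h.classSlope_le (by linarith) j) f1 (act_nonneg _ _) (by positivity)
    _ = 2 * (B * q) * (Real.exp (-F) * (1 + F)) := by field_simp
    _ ≤ 2 * (B * q) * (2 * Real.exp (-(F / 2))) := by gcongr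
    _ = _ := by ring

end SignalDominated

end Step

/-! ### The signal coordinates over time -/

theorem one_add_mul_half_le_rpow {p u : ℝ} (hp : 0 ≤ p) (hu : 0 ≤ u) (hu1 : u ≤ 1) :
    1 + p * u / 2 ≤ (1 + u) ^ p := by
  have h1 : u / 2 ≤ Real.log (1 + u) := by
    refine le_trans ?_ (Real.one_sub_inv_le_log_of_pos (by linarith))
    rw [show 1 - (1 + u)⁻¹ = u / (1 + u) by field_simp; ring]
    exact div_le_div_of_nonneg_left hu (by linarith) (by linarith)
  rw [Real.rpow_def_of_pos (by linarith)]
  have h2 := Real.add_one_le_exp (Real.log (1 + u) * p)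
  nlinarith

/-- Finite-time blow-up of the recursion `h ↦ h + β h ^ (p + 1)`: the potential `h ^ (-p)` drops
by a fixed multiple of `β` in every step, so `h` cannot stay bounded for long. -/
theorem mul_lt_rpow_neg_of_superlinear_growth {p β : ℝ} (hp : 0 < p) (hβ : 0 ≤ β) {h : ℕ → ℝ}
    {N : ℕ} (h0 : 0 < h 0) (hstep : ∀ t < N, h t + β * h t ^ (p + 1) ≤ h (t + 1))
    (hle : ∀ t ≤ N, h t ≤ 3) (hsmall : (p + 2) * (β * 3 ^ p) ≤ 2) :
    N * (p * β / 4) < h 0 ^ (-p) := by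
  have key : ∀ t ≤ N, 0 < h t ∧ h t ^ (-p) ≤ h 0 ^ (-p) - t * (p * β / 4) := by
    intro t
    induction t with
    | zero => intro _; simpa using h0
    | succ t ih =>
      intro ht
      obtain ⟨hpos, hX⟩ := ih (by omega)
      have hs := hstep t (by omega)
      set X := h t ^ (-p) with hXdef
      have hX0 : 0 < X := Real.rpow_pos_of_pos hpos _
      have hXi : h t ^ p * X = 1 := by
        rw [hXdef, ← Real.rpow_add hpos]; simp
      have hbp : h t ^ p ≤ 3 ^ p := Real.rpow_le_rpow hpos.le (hle t (by omega)) hp.le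
      have hhp : 0 < h t ^ p := Real.rpow_pos_of_pos hpos _
      have hu0 : 0 ≤ β * h t ^ p := by positivity
      have hu2 : (p + 2) * (β * h t ^ p) ≤ 2 := by
        refine le_trans ?_ hsmall
        gcongr
      have hu1 : β * h t ^ p ≤ 1 := by nlinarith
      have hpu : p * (β * h t ^ p) ≤ 2 := by nlinarith
      have hfac : h t * (1 + β * h t ^ p) ≤ h (t + 1) := by
        refine le_trans (le_of_eq ?_) hs
        rw [Real.rpow_add hpos, Real.rpow_one]; ring
      have hnew : 0 < h (t + 1) := lt_of_lt_of_le (by positivity) hfac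
      refine ⟨hnew, ?_⟩
      have h1 : h (t + 1) ^ (-p) ≤ X * ((1 + β * h t ^ p) ^ p)⁻¹ := by
        calc h (t + 1) ^ (-p) ≤ (h t * (1 + β * h t ^ p)) ^ (-p) :=
              Real.rpow_le_rpow_of_nonpos (by positivity) hfac (by linarith)
          _ = X * ((1 + β * h t ^ p) ^ p)⁻¹ := by
              rw [Real.mul_rpow hpos.le (by positivity),
                Real.rpow_neg (x := 1 + β * h t ^ p) (by positivity)]
      have h2 := one_add_mul_half_le_rpow hp.le hu0 hu1
      have h3 : X * ((1 + β * h t ^ p) ^ p)⁻¹ ≤ X - p * β / 4 := by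
        rw [← div_eq_mul_inv, div_le_iff₀ (by positivity)]
        have h4 : p * β = p * (β * h t ^ p) * X := by
          linear_combination -(p * β) * hXi
        set w := p * (β * h t ^ p) with hw
        have hw0 : 0 ≤ w := by positivity
        have h5 : 0 ≤ X - p * β / 4 := by rw [h4]; nlinarith
        calc X ≤ (X - p * β / 4) * (1 + w / 2) := by
              rw [h4]
              nlinarith [mul_nonneg hX0.le (mul_nonneg hw0 (show 0 ≤ 2 - w by linarith))]
          _ ≤ _ := by gcongr
      push_cast
      linarith
  obtain ⟨hpos, hX⟩ := key N le_rfl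
  have := Real.rpow_pos_of_pos hpos (-p)
  linarith

/-- The signal coordinates `a t j r = ⟨w_{j,r}^{(t)}, j v⟩` of a trajectory, with signal
coefficients `Γ`, accumulated private noise `Z t` in the direction `v`, margins `p t`, and
`B = η ‖v‖²`, up to time `T`. -/
structure SignalProcess {n m : ℕ} (q B : ℝ) (y : Fin n → Bool) (p : ℕ → Fin n → ℝ)
    (a Γ : ℕ → Bool → Fin m → ℝ) (Z : ℕ → ℝ) (T : ℕ) : Prop where
  rate_nonneg : 0 ≤ B
  coord : ∀ t j r, a t j r = a 0 j r + Γ t j r - sgn j * Z t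
  coeff_zero : ∀ j r, Γ 0 j r = 0
  coeff_succ : ∀ t j r, Γ (t + 1) j r = Γ t j r + signalInc B q y (p t) (a t) j r
  margin : ∀ t ≤ T, ∀ i, |p t i - (posOut q (a t) (y i) - negOut q (a t) (y i))| ≤ 1 / 8
  init : ∀ j r, |a 0 j r| ≤ 1 / 16
  shift : ∀ t ≤ T, |Z t| ≤ 1 / 16

theorem abs_sgn_mul (j : Bool) (x : ℝ) : |sgn j * x| = |x| := by
  cases j <;> simp [sgn]

theorem sgn_mul_self (j : Bool) : sgn j * sgn j = 1 := by cases j <;> simp [sgn]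

theorem sgn_sq (j : Bool) : sgn j ^ 2 = 1 := by cases j <;> simp [sgn]

namespace SignalProcess

variable {n m : ℕ} {q B : ℝ} {y : Fin n → Bool} {p : ℕ → Fin n → ℝ}
  {a Γ : ℕ → Bool → Fin m → ℝ} {Z : ℕ → ℝ} {T : ℕ}

theorem coeff_mono (h : SignalProcess q B y p a Γ Z T) (hq : 0 ≤ q) (j : Bool) (r : Fin m) :
    Monotone fun t => Γ t j r :=
  monotone_nat_of_le_succ fun t => by
    rw [h.coeff_succ]
    linarith [signalInc_nonneg (y := y) (p := p t) (a := a t) h.rate_nonneg hq j r]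

theorem coeff_nonneg (h : SignalProcess q B y p a Γ Z T) (hq : 0 ≤ q) (t : ℕ) (j : Bool)
    (r : Fin m) : 0 ≤ Γ t j r := by
  have := h.coeff_mono hq j r (Nat.zero_le t)
  simpa [h.coeff_zero] using this

theorem coeff_sub_le (h : SignalProcess q B y p a Γ Z T) {t : ℕ} (ht : t ≤ T) (j : Bool)
    (r : Fin m) : Γ t j r - 1 / 8 ≤ a t j r := by
  have h1 := abs_le.1 (h.init j r)
  have h2 := abs_le.1 ((abs_sgn_mul j (Z t)).trans_le (h.shift t ht))
  linarith [h.coord t j r]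

theorem le_coeff_add (h : SignalProcess q B y p a Γ Z T) {t : ℕ} (ht : t ≤ T) (j : Bool)
    (r : Fin m) : a t j r ≤ Γ t j r + 1 / 8 := by
  have h1 := abs_le.1 (h.init j r)
  have h2 := abs_le.1 ((abs_sgn_mul j (Z t)).trans_le (h.shift t ht))
  linarith [h.coord t j r]

theorem signalDominated (h : SignalProcess q B y p a Γ Z T) (hq : 0 ≤ q) {t : ℕ} (ht : t ≤ T) :
    SignalDominated q y (p t) (a t) where
  margin := h.margin t ht
  lower j r := by linarith [h.coeff_sub_le ht j r, h.coeff_nonneg hq t j r]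

/-- Once a signal coefficient exceeds the level `G`, the slope of the loss on its class is so small
that the coefficient gains at most `1 / T` per step. -/
theorem coeff_le [NeZero m] (h : SignalProcess q B y p a Γ Z T) (hq : 2 < q)
    (hBq : 4 * (B * q) ≤ 1) {G : ℝ} (hG : 2 ≤ G)
    (hGT : T * Real.exp (-((G - 1) ^ 2 / (2 * m))) ≤ 1) {t : ℕ} (ht : t ≤ T) (j : Bool)
    (r : Fin m) : Γ t j r ≤ G + 2 := by
  have hm : (0 : ℝ) < m := by exact_mod_cast NeZero.pos m
  have hB := h.rate_nonneg
  have key : ∀ t ≤ T, Γ t j r ≤ G + 1 + t / T := by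
    intro t
    induction t with
    | zero => intro _; rw [h.coeff_zero]; simp; linarith
    | succ t ih =>
      intro ht
      have ih := ih (by omega)
      have hT0 : (0 : ℝ) < T := by exact_mod_cast (by omega : 0 < T)
      have hdom := h.signalDominated (by linarith) (show t ≤ T by omega)
      rw [h.coeff_succ]
      rcases le_or_gt (Γ t j r) G with hle | hgt
      · have h1 := hdom.signalInc_le hB hq j r
        have h2 : (0 : ℝ) ≤ ((t + 1 : ℕ) : ℝ) / T := by positivity
        linarith [mul_nonneg hB (show 0 ≤ q by linarith)]
      · have ha : G - 1 ≤ a t j r := by linarith [h.coeff_sub_le (show t ≤ T by omega) j r]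
        have h1 := hdom.signalInc_le_exp hB hq (j := j) (r := r) (by linarith)
        have h2 : (G - 1) ^ 2 ≤ m * posOut q (a t) j := by
          refine le_trans ?_ (act_le_mul_posOut q (a t) j r)
          rw [act_of_nonneg (by linarith)]
          calc (G - 1) ^ 2 = (G - 1) ^ (2 : ℝ) := by norm_cast
            _ ≤ (G - 1) ^ q := Real.rpow_le_rpow_of_exponent_le (by linarith) hq.le
            _ ≤ _ := Real.rpow_le_rpow (by linarith) ha (by linarith)
        have h3 : (G - 1) ^ 2 / (2 * m) ≤ posOut q (a t) j / 2 := by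
          rw [div_le_div_iff₀ (by positivity) (by norm_num)]
          nlinarith
        have h4 : Real.exp (-(posOut q (a t) j / 2)) ≤ 1 / T := by
          rw [le_div_iff₀ hT0, mul_comm]
          refine le_trans ?_ hGT
          gcongr
        have h5 : 4 * (B * q) * Real.exp (-(posOut q (a t) j / 2)) ≤ 1 * (1 / T) := by
          gcongr
        push_cast
        rw [add_div]
        linarith
  have h1 := key t ht
  have h2 : (t : ℝ) / T ≤ 1 := div_le_one_of_le₀ (by exact_mod_cast ht) (by positivity)
  linarith

/-- **The first stage.** If every filter of class `j` kept `Γ < 2` up to time `T₁`, the loss of the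
points of class `j` would stay bounded away from zero, and the signal coefficient of a well
initialized filter would follow a superlinear recursion for longer than is possible. -/
theorem exists_two_le_coeff [NeZero m] [NeZero n] (h : SignalProcess q B y p a Γ Z T)
    (hq : 2 < q) {s : ℝ} (hs : 0 < s) (hs1 : s ≤ 1) {T₁ : ℕ} (hT₁ : T₁ ≤ T) {j : Bool}
    (hcard : (n : ℝ) / 4 ≤ (Finset.univ.filter fun i => y i = j).card)
    (hinit : ∃ r, s / 2 ≤ a 0 j r) (hshift : ∀ t ≤ T₁, |Z t| ≤ s / 4)
    (hsmall : q * (B * q * lossSlope (3 ^ q + 1) / 4 * 3 ^ (q - 2)) ≤ 2)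
    (hlong : (s / 4) ^ (-(q - 2)) ≤
      T₁ * ((q - 2) * (B * q * lossSlope (3 ^ q + 1) / (4 * m)) / 4)) :
    ∃ r, 2 ≤ Γ T₁ j r := by
  by_contra! hcon
  obtain ⟨r, hr⟩ := hinit
  have hm : (1 : ℝ) ≤ m := by exact_mod_cast NeZero.one_le
  have hn : (0 : ℝ) < n := by exact_mod_cast NeZero.pos n
  have hB := h.rate_nonneg
  have hq0 : 0 ≤ q := by linarith
  set c := lossSlope (3 ^ q + 1) with hc
  have hc0 : 0 < c := lossSlope_pos _
  have hΓ2 : ∀ t ≤ T₁, ∀ r, Γ t j r < 2 := fun t ht r =>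
    (h.coeff_mono hq0 j r ht).trans_lt (hcon r)
  have hslope : ∀ t ≤ T₁, c / 4 ≤ classSlope y (p t) j := by
    intro t ht
    have hdom := h.signalDominated hq0 (ht.trans hT₁)
    have hpos : posOut q (a t) j ≤ 3 ^ q := by
      refine mean_le (by positivity) fun r => ?_
      refine (act_mono (by linarith) (show a t j r ≤ 3 by
        linarith [h.le_coeff_add (ht.trans hT₁) j r, hΓ2 t ht r])).trans ?_
      rw [act_of_nonneg (by norm_num)]
    have h1 : ∀ i, y i = j → c ≤ lossSlope (p t i) := by
      rintro i rfl
      exact lossSlope_anti (by linarith [hdom.margin_le i])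
    calc c / 4 = (1 / (n : ℝ)) * (n / 4 * c) := by field_simp
      _ ≤ (1 / (n : ℝ)) * ((Finset.univ.filter fun i => y i = j).card * c) := by gcongr
      _ = (1 / (n : ℝ)) * ∑ i, if y i = j then c else 0 := by
          rw [← Finset.sum_filter, Finset.sum_const, nsmul_eq_mul]
      _ ≤ classSlope y (p t) j := by
          unfold classSlope
          gcongr with i
          split_ifs with hi
          exacts [h1 i hi, le_rfl]
  -- The loss slope is at least `c / 4`, so `s / 4 + Γ` grows superlinearly with rate `β`; the
  -- initialization `s / 2` is reduced by the private noise to `s / 4` at worst.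
  set β := B * q * c / (4 * m) with hβ
  have hβ0 : 0 ≤ β := by positivity
  have hblow := mul_lt_rpow_neg_of_superlinear_growth (p := q - 2) (β := β)
    (h := fun t => s / 4 + Γ t j r) (N := T₁) (by linarith) hβ0
    (by simp only [h.coeff_zero]; linarith) ?_ ?_ ?_
  · simp only [h.coeff_zero, add_zero] at hblow
    linarith
  · intro t ht
    have ha : s / 4 + Γ t j r ≤ a t j r := by
      have h2 := abs_le.1 ((abs_sgn_mul j (Z t)).trans_le (hshift t ht.le))
      linarith [h.coord t j r]
    have hΓ0 := h.coeff_nonneg hq0 t j r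
    have h3 : (s / 4 + Γ t j r) ^ (q - 2 + 1) ≤ act (q - 1) (a t j r) := by
      rw [act_of_nonneg (by linarith), show q - 2 + 1 = q - 1 by ring]
      exact Real.rpow_le_rpow (by linarith) ha (by linarith)
    have h4 : β * (s / 4 + Γ t j r) ^ (q - 2 + 1) ≤ signalInc B q y (p t) (a t) j r := by
      have h5 := classSlope_nonneg y (p t) (!j)
      have h6 := act_nonneg (q - 1) (-(a t j r))
      calc β * (s / 4 + Γ t j r) ^ (q - 2 + 1)
          = B * q / m * (c / 4 * (s / 4 + Γ t j r) ^ (q - 2 + 1)) := by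
            rw [hβ]; field_simp
        _ ≤ B * q / m * (classSlope y (p t) j * act (q - 1) (a t j r)) := by
            refine mul_le_mul_of_nonneg_left ?_ (by positivity)
            exact mul_le_mul (hslope t ht.le) h3 (by positivity) (classSlope_nonneg _ _ _)
        _ ≤ signalInc B q y (p t) (a t) j r := by
            unfold signalInc
            refine mul_le_mul_of_nonneg_left ?_ (by positivity)
            linarith [mul_nonneg h5 h6]
    simp only [h.coeff_succ]
    linarith
  · intro t ht
    linarith [hΓ2 t ht r]
  · refine le_trans ?_ hsmall
    rw [show q - 2 + 2 = q by ring]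
    gcongr
    rw [hβ]
    refine div_le_div_of_nonneg_left (by positivity) (by norm_num) (by linarith)

/-- The potential argument of the second stage. The squared distance to the reference is measured
in the signal direction only. The private noise is the same for all filters, so that in its inner
product with `W - W*` the two signs `j` cancel the reference, and only the signal coefficients,
which are at most `H`, remain. -/
theorem sum_meanLoss_le [NeZero m] (h : SignalProcess q B y p a Γ Z T) (hq : 2 < q)
    (hBq : 10 * (B * q ^ 2) ≤ 1 / 2) {κ : ℝ} (hκ : 0 < κ) (hκq : κ < 2 * q - 1) {T₁ : ℕ}
    (hgrown : ∀ j, ∃ r, 2 ≤ Γ T₁ j r) {H ζ : ℝ}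
    (hH : ∀ t ≤ T, ∀ j r, Γ t j r ≤ H) (hζ : ∀ t ≤ T, |Z (t + 1) - Z t| ≤ ζ) {t : ℕ}
    (ht₁ : T₁ ≤ t) (ht : t ≤ T) :
    (2 * q - 1) * B * ∑ s ∈ Finset.Icc T₁ t, meanLoss (p s) ≤
      ∑ j, ∑ r, (a T₁ j r - (a 0 j r + 2 * q * m * Real.log (2 * q / κ))) ^ 2
      + ((t : ℝ) - T₁ + 1) * (B * κ + 2 * ζ * (m * (H + 1)) + 4 * m * ζ ^ 2) := by
  have hm : (1 : ℝ) ≤ m := by exact_mod_cast NeZero.one_le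
  have hB := h.rate_nonneg
  set θ := Real.log (2 * q / κ) with hθ
  set ref : Bool → Fin m → ℝ := fun j r => a 0 j r + 2 * q * m * θ with hrefdef
  set D : ℕ → ℝ := fun t => ∑ j, ∑ r, (a t j r - ref j r) ^ 2 with hD
  have hθq : 3 / 4 ≤ (2 * q - 1) * θ := by
    have h1 := Real.one_sub_inv_le_log_of_pos (show 0 < 2 * q / κ by positivity)
    have h2 : (2 * q / κ)⁻¹ ≤ (2 * q - 1) / (2 * q) := by
      rw [inv_div]; gcongr
    have h3 : 1 - (2 * q - 1) / (2 * q) = 1 / (2 * q) := by field_simp; ring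
    have h4 : 1 / (2 * q) ≤ θ := by linarith
    have h5 : (2 * q - 1) * (1 / (2 * q)) ≤ (2 * q - 1) * θ := by
      gcongr; linarith
    refine le_trans ?_ h5
    rw [mul_one_div, div_le_div_iff₀ (by norm_num) (by linarith)]
    linarith
  have hθ0 : 0 ≤ θ := by
    by_contra hneg
    push Not at hneg
    nlinarith
  have hℓθ : 2 * q * logisticLoss θ ≤ κ := by
    have h1 : Real.exp (-θ) = κ / (2 * q) := by
      rw [hθ, Real.exp_neg, Real.exp_log (by positivity), inv_div]
    have h2 := logisticLoss_le_exp_neg θ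
    rw [h1] at h2
    rw [le_div_iff₀ (by positivity)] at h2
    linarith
  have href : ∀ j r, m * (θ + 1 / 4) ≤ ref j r := by
    intro j r
    have := abs_le.1 (h.init j r)
    simp only [hrefdef]
    nlinarith
  have hstep : ∀ s, T₁ ≤ s → s ≤ T → (2 * q - 1) * B * meanLoss (p s) ≤
      D s - D (s + 1) + (B * κ + 2 * ζ * (m * (H + 1)) + 4 * m * ζ ^ 2) := by
    intro s hs₁ hs
    have hdom := h.signalDominated (by linarith) hs
    set inc := signalInc B q y (p s) (a s) with hinc
    set z := Z (s + 1) - Z s with hz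
    have hzle : |z| ≤ ζ := hζ s hs
    have hζ0 : 0 ≤ ζ := (abs_nonneg _).trans hzle
    have hact : ∀ j, ∃ r, 1 ≤ a s j r := by
      intro j
      obtain ⟨r, hr⟩ := hgrown j
      exact ⟨r, by linarith [h.coeff_sub_le hs j r,
        h.coeff_mono (by linarith) j r hs₁]⟩
    have hmain := hdom.sum_sub_mul_signalInc_le hB hq hθ0 href hact
    have hsq := hdom.sum_signalInc_sq_le (B := B) hq
    rw [← hinc] at hmain hsq
    have hmove : ∀ j r, a (s + 1) j r = a s j r + inc j r - sgn j * z := by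
      intro j r
      rw [h.coord (s + 1), h.coord s, h.coeff_succ]
      ring
    have hexp : D (s + 1) ≤ D s + 2 * ∑ j, ∑ r, (a s j r - ref j r) * inc j r
        + 2 * ∑ j, ∑ r, inc j r ^ 2 + 4 * m * z ^ 2
        - 2 * z * ∑ j, ∑ r, sgn j * (a s j r - ref j r) := by
      have e1 : ∀ j r, (a (s + 1) j r - ref j r) ^ 2 ≤ (a s j r - ref j r) ^ 2
          + 2 * ((a s j r - ref j r) * inc j r) + 2 * inc j r ^ 2 + 2 * z ^ 2
          - 2 * z * (sgn j * (a s j r - ref j r)) := by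
        intro j r
        rw [hmove]
        have e2 := sgn_sq j
        nlinarith [sq_nonneg (inc j r + sgn j * z)]
      calc D (s + 1) ≤ ∑ j, ∑ r, ((a s j r - ref j r) ^ 2
          + 2 * ((a s j r - ref j r) * inc j r) + 2 * inc j r ^ 2 + 2 * z ^ 2
          - 2 * z * (sgn j * (a s j r - ref j r))) :=
            Finset.sum_le_sum fun j _ => Finset.sum_le_sum fun r _ => e1 j r
        _ = _ := by
            simp only [hD, Finset.sum_add_distrib, Finset.sum_sub_distrib, Finset.mul_sum,
              Finset.sum_const, Finset.card_univ, Fintype.card_bool, Fintype.card_fin,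
              nsmul_eq_mul]
            push_cast
            ring
    -- The reference drops out of the inner product with the common noise.
    have hcancel : ∑ j, ∑ r, sgn j * (a s j r - ref j r)
        = ∑ r, Γ s true r - ∑ r, Γ s false r - 2 * m * Z s := by
      have e1 : ∀ j r, sgn j * (a s j r - ref j r)
          = sgn j * Γ s j r - Z s - sgn j * (2 * q * m * θ) := by
        intro j r
        rw [h.coord s]
        simp only [hrefdef]
        linear_combination (-Z s) * sgn_mul_self j
      simp only [e1]
      simp [sgn, Finset.sum_sub_distrib]
      ring
    have hcross : |∑ j, ∑ r, sgn j * (a s j r - ref j r)| ≤ m * (H + 1) := by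
      have b0 : ∀ j, 0 ≤ ∑ r, Γ s j r := fun j =>
        Finset.sum_nonneg fun r _ => h.coeff_nonneg (by linarith) s j r
      have b1 : ∀ j, ∑ r, Γ s j r ≤ m * H := fun j => by
        simpa using Finset.sum_le_card_nsmul Finset.univ (fun r => Γ s j r) H
          (fun r _ => hH s hs j r)
      have b2 := abs_le.1 (h.shift s hs)
      rw [hcancel, abs_le]
      constructor <;> nlinarith [b0 true, b0 false, b1 true, b1 false]
    have hnoise : -(2 * z * ∑ j, ∑ r, sgn j * (a s j r - ref j r)) ≤ 2 * ζ * (m * (H + 1)) := by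
      refine (neg_le_abs _).trans ?_
      rw [abs_mul, abs_mul, abs_two]
      gcongr
    have hz2 : z ^ 2 ≤ ζ ^ 2 := by
      rw [← sq_abs]
      exact pow_le_pow_left₀ (abs_nonneg _) hzle 2
    have hL := meanLoss_nonneg (p s)
    have hsq2 : 2 * ∑ j, ∑ r, inc j r ^ 2 ≤ B * meanLoss (p s) := by
      have : 2 * (10 * (B * q) ^ 2 * meanLoss (p s))
          = 2 * (10 * (B * q ^ 2)) * (B * meanLoss (p s)) := by ring
      have h2 : 2 * (10 * (B * q ^ 2)) * (B * meanLoss (p s)) ≤ 1 * (B * meanLoss (p s)) := by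
        gcongr
        linarith
      linarith
    have hmz : 4 * m * z ^ 2 ≤ 4 * m * ζ ^ 2 := by gcongr
    have hBκ : B * (2 * q * logisticLoss θ) ≤ B * κ := by gcongr
    linarith
  clear_value D
  have htel : (2 * q - 1) * B * ∑ s ∈ Finset.Icc T₁ t, meanLoss (p s) ≤ D T₁ - D (t + 1)
      + ((t : ℝ) - T₁ + 1) * (B * κ + 2 * ζ * (m * (H + 1)) + 4 * m * ζ ^ 2) := by
    clear hD
    induction t, ht₁ using Nat.le_induction with
    | base => simpa using hstep T₁ le_rfl ht
    | succ k hk ih =>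
      rw [Finset.sum_Icc_succ_top (by omega), mul_add]
      have h1 := ih (by omega)
      have h2 := hstep (k + 1) (by omega) ht
      push_cast
      linarith
  have hDnn : 0 ≤ D (t + 1) := by
    rw [hD]
    positivity
  rw [hD] at htel hDnn
  linarith

end SignalProcess

/-! ### The signal-noise decomposition of the trajectory -/

section Decomposition

variable {n m d : ℕ}

/-- The labels `y_i`. -/
def labels (ω : Outcome n m d) (i : Fin n) : Bool := (ω.1 i).1

/-- The margins `y_i f(W^{(t)}, x_i)` along the trajectory. -/
def marginAt (q η : ℝ) (v : Vec d) (ω : Outcome n m d) (t : ℕ) (i : Fin n) : ℝ :=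
  margin q (trajectory q η v ω t) (trainingSet v ω i)

/-- The aligned signal coordinates `⟨w_{j,r}^{(t)}, j v⟩`. -/
def signalCoord (q η : ℝ) (v : Vec d) (ω : Outcome n m d) (t : ℕ) (j : Bool) (r : Fin m) : ℝ :=
  sgn j * inner ℝ (trajectory q η v ω t j r) v

/-- The signal coefficients `Γ_{j,r}^{(t)}`, as accumulated increments. -/
def signalCoeff (q η : ℝ) (v : Vec d) (ω : Outcome n m d) (t : ℕ) (j : Bool) (r : Fin m) : ℝ :=
  ∑ s ∈ Finset.range t, signalInc (η * ‖v‖ ^ 2) q (labels ω) (marginAt q η v ω s)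
    (signalCoord q η v ω s) j r

/-- The increment of the noise coefficient `Φ_{j,r,i}` in the gradient step from `t` to `t + 1`. -/
def noiseInc (q η : ℝ) (v : Vec d) (ω : Outcome n m d) (t : ℕ) (j : Bool) (r : Fin m)
    (i : Fin n) : ℝ :=
  η * q / (m * n) * (sgn j * sgn (labels ω i) * lossSlope (marginAt q η v ω t i)
    * act (q - 1) (inner ℝ (trajectory q η v ω t j r) (noisePatches ω i)))
    * ‖noisePatches ω i‖ ^ 2

/-- The noise coefficients `Φ_{j,r,i}^{(t)}`, as accumulated increments. -/
def noiseCoeff (q η : ℝ) (v : Vec d) (ω : Outcome n m d) (t : ℕ) (j : Bool) (r : Fin m)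
    (i : Fin n) : ℝ :=
  ∑ s ∈ Finset.range t, noiseInc q η v ω s j r i

/-- The private noise accumulated up to time `t`. -/
def noiseWalk (ω : Outcome n m d) (t : ℕ) : Vec d := ∑ s ∈ Finset.Icc 1 t, privateNoise ω s

theorem noiseWalk_succ (ω : Outcome n m d) (t : ℕ) :
    noiseWalk ω (t + 1) = noiseWalk ω t + privateNoise ω (t + 1) := by
  rw [noiseWalk, Finset.sum_Icc_succ_top (by omega), noiseWalk]

variable {q η : ℝ} {v : Vec d} {ω : Outcome n m d}

theorem trajectory_succ (hq : 1 < q) (hv : v ≠ 0) (hξ : ∀ i, noisePatches ω i ≠ 0) (t : ℕ)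
    (j : Bool) (r : Fin m) :
    trajectory q η v ω (t + 1) j r = trajectory q η v ω t j r
      + (sgn j * signalInc (η * ‖v‖ ^ 2) q (labels ω) (marginAt q η v ω t)
          (signalCoord q η v ω t) j r * (‖v‖ ^ 2)⁻¹) • v
      + ∑ i, (noiseInc q η v ω t j r i * (‖noisePatches ω i‖ ^ 2)⁻¹) • noisePatches ω i
      - η • privateNoise ω (t + 1) := by
  have hv2 : ‖v‖ ^ 2 ≠ 0 := by simpa using hv
  have h0 : trajectory q η v ω (t + 1) j r = trajectory q η v ω t j r
      - η • (partialGradient q (trainingSet v ω) (trajectory q η v ω t) j r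
        + privateNoise ω (t + 1)) := rfl
  have hpatch : ∀ i, (trainingSet v ω i).patch₁ = sgn (labels ω i) • v := fun _ => rfl
  have hpatch₂ : ∀ i, (trainingSet v ω i).patch₂ = noisePatches ω i := fun _ => rfl
  have hlab : ∀ i, (trainingSet v ω i).label = labels ω i := fun _ => rfl
  have hmar : ∀ i, margin q (trajectory q η v ω t) (trainingSet v ω i)
      = marginAt q η v ω t i := fun _ => rfl
  have hsig : (∑ i, sgn j * sgn (labels ω i) * (q / (m * n) * lossSlope (marginAt q η v ω t i))
        * (act (q - 1) (inner ℝ (trajectory q η v ω t j r) (sgn (labels ω i) • v))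
          * sgn (labels ω i))) * η
      = sgn j * signalInc (η * ‖v‖ ^ 2) q (labels ω) (marginAt q η v ω t)
          (signalCoord q η v ω t) j r * (‖v‖ ^ 2)⁻¹ := by
    have e1 : ∀ i, sgn j * sgn (labels ω i)
        * (q / (m * n) * lossSlope (marginAt q η v ω t i))
        * (act (q - 1) (inner ℝ (trajectory q η v ω t j r) (sgn (labels ω i) • v))
          * sgn (labels ω i))
        = sgn j * (q / m) * (1 / n) * ((if labels ω i = j then
            lossSlope (marginAt q η v ω t i) else 0)
              * act (q - 1) (signalCoord q η v ω t j r)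
          + (if labels ω i = !j then lossSlope (marginAt q η v ω t i) else 0)
              * act (q - 1) (-(signalCoord q η v ω t j r))) := by
      intro i
      rw [inner_smul_right, signalCoord]
      cases labels ω i <;> cases j <;> simp [sgn] <;> field_simp
    simp_rw [e1]
    rw [← Finset.mul_sum, Finset.sum_add_distrib, ← Finset.sum_mul, ← Finset.sum_mul, signalInc,
      classSlope, classSlope]
    field_simp
  rw [h0, partialGradient_eq hq, smul_add, smul_neg]
  simp only [hpatch, hpatch₂, hlab, hmar, smul_add, smul_smul, Finset.sum_add_distrib,
    Finset.smul_sum]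
  rw [← Finset.sum_smul, ← hsig, Finset.sum_mul]
  have hnoise : ∀ i, η * (sgn j * sgn (labels ω i)
        * (q / (m * n) * lossSlope (marginAt q η v ω t i))
        * act (q - 1) (inner ℝ (trajectory q η v ω t j r) (noisePatches ω i)))
      = noiseInc q η v ω t j r i * (‖noisePatches ω i‖ ^ 2)⁻¹ := by
    intro i
    have : ‖noisePatches ω i‖ ^ 2 ≠ 0 := by simpa using hξ i
    rw [noiseInc, mul_inv_cancel_right₀ this]
    ring
  simp only [hnoise]
  have hcomm : ∀ i, η * (sgn j * sgn (labels ω i)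
        * (q / (m * n) * lossSlope (marginAt q η v ω t i))
        * (act (q - 1) (inner ℝ (trajectory q η v ω t j r) (sgn (labels ω i) • v))
          * sgn (labels ω i)))
      = sgn j * sgn (labels ω i) * (q / (m * n) * lossSlope (marginAt q η v ω t i))
        * (act (q - 1) (inner ℝ (trajectory q η v ω t j r) (sgn (labels ω i) • v))
          * sgn (labels ω i)) * η := fun i => mul_comm _ _
  simp only [hcomm]
  abel

theorem signalCoeff_nonneg (hη : 0 ≤ η) (hq : 0 ≤ q) (t : ℕ) (j : Bool) (r : Fin m) :
    0 ≤ signalCoeff q η v ω t j r :=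
  Finset.sum_nonneg fun _ _ => signalInc_nonneg (by positivity) hq _ _

theorem isDecomposition (hη : 0 ≤ η) (hq : 1 < q) (hv : v ≠ 0)
    (hξ : ∀ i, noisePatches ω i ≠ 0) :
    IsDecomposition η v (noisePatches ω) (privateNoise ω) (trajectory q η v ω)
      (signalCoeff q η v ω) (noiseCoeff q η v ω) := by
  intro t j r
  refine ⟨signalCoeff_nonneg hη (by linarith) t j r, ?_⟩
  induction t with
  | zero => simp [signalCoeff, noiseCoeff]
  | succ t ih =>
    rw [trajectory_succ hq hv hξ, ih, Finset.sum_Icc_succ_top (by omega)]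
    simp only [signalCoeff, noiseCoeff, Finset.sum_range_succ, add_mul, add_smul,
      Finset.sum_add_distrib, mul_add, smul_add]
    abel

/-- The coefficients are determined by the trajectory, because `v ⟂ ξ_i` and the `ξ_i` are
linearly independent. -/
theorem isDecomposition_unique (hv : v ≠ 0) (horth : ∀ i, inner ℝ v (noisePatches ω i) = 0)
    (hind : LinearIndependent ℝ (noisePatches ω)) {W : ℕ → Filters m d}
    {Γ Γ' : ℕ → Bool → Fin m → ℝ} {Φ Φ' : ℕ → Bool → Fin m → Fin n → ℝ}
    (h : IsDecomposition η v (noisePatches ω) (privateNoise ω) W Γ Φ)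
    (h' : IsDecomposition η v (noisePatches ω) (privateNoise ω) W Γ' Φ') :
    Γ' = Γ ∧ Φ' = Φ := by
  have hv2 : ‖v‖ ^ 2 ≠ 0 := by simpa using hv
  have hξ2 : ∀ i, ‖noisePatches ω i‖ ^ 2 ≠ 0 := fun i => by simpa using hind.ne_zero i
  have key : ∀ t j r, (sgn j * Γ' t j r * (‖v‖ ^ 2)⁻¹) • v
      + ∑ i, (Φ' t j r i * (‖noisePatches ω i‖ ^ 2)⁻¹) • noisePatches ω i
      = (sgn j * Γ t j r * (‖v‖ ^ 2)⁻¹) • v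
      + ∑ i, (Φ t j r i * (‖noisePatches ω i‖ ^ 2)⁻¹) • noisePatches ω i := by
    intro t j r
    have e := (h' t j r).2.symm.trans (h t j r).2
    have e2 := sub_left_inj.1 e
    rw [add_assoc, add_assoc] at e2
    exact add_left_cancel e2
  have hΓ : Γ' = Γ := by
    funext t j r
    have e := congrArg (fun w => inner ℝ v w) (key t j r)
    simp only [inner_add_right, inner_smul_right, inner_sum, horth, mul_zero,
      Finset.sum_const_zero, add_zero, real_inner_self_eq_norm_sq] at e
    rw [inv_mul_cancel_right₀ hv2, inv_mul_cancel_right₀ hv2] at e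
    refine mul_left_cancel₀ ?_ e
    cases j <;> simp [sgn]
  refine ⟨hΓ, ?_⟩
  funext t j r i
  have e := key t j r
  rw [hΓ] at e
  have e2 := add_left_cancel e
  have e3 : ∑ i, ((Φ' t j r i - Φ t j r i) * (‖noisePatches ω i‖ ^ 2)⁻¹) • noisePatches ω i
      = 0 := by
    simp only [sub_mul, sub_smul, Finset.sum_sub_distrib, e2, sub_self]
  have e4 := Fintype.linearIndependent_iff.1 hind _ e3 i
  have e5 := (mul_eq_zero.1 e4).resolve_right (inv_ne_zero (hξ2 i))
  linarith

theorem signalCoord_eq (hη : 0 ≤ η) (hq : 1 < q) (hv : v ≠ 0)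
    (hξ : ∀ i, noisePatches ω i ≠ 0) (horth : ∀ i, inner ℝ v (noisePatches ω i) = 0) (t : ℕ)
    (j : Bool) (r : Fin m) :
    signalCoord q η v ω t j r = signalCoord q η v ω 0 j r + signalCoeff q η v ω t j r
      - sgn j * (η * inner ℝ (noiseWalk ω t) v) := by
  have hv2 : ‖v‖ ^ 2 ≠ 0 := by simpa using hv
  have horth' : ∀ i, inner ℝ (noisePatches ω i) v = 0 := fun i => by
    rw [real_inner_comm]; exact horth i
  have e := (isDecomposition hη hq hv hξ t j r).2
  rw [signalCoord, e]
  simp only [inner_add_left, inner_sub_left, inner_smul_left, sum_inner, horth', mul_zero,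
    Finset.sum_const_zero, add_zero, real_inner_self_eq_norm_sq, signalCoord, noiseWalk,
    RCLike.conj_to_real]
  rw [inv_mul_cancel_right₀ hv2]
  linear_combination signalCoeff q η v ω t j r * sgn_mul_self j

/-- Cauchy-Schwarz bounds the cross terms `⟨ξ_k, ξ_i⟩`, so near-orthogonality of the noise patches
plays no role. The price is that the noise coefficients have to be controlled in the weighted sum
`∑_k |Φ_{j,r,k}| / ‖ξ_k‖`. -/
theorem abs_inner_noisePatch_le (hη : 0 ≤ η) (hq : 1 < q) (hv : v ≠ 0)
    (hξ : ∀ i, noisePatches ω i ≠ 0) (horth : ∀ i, inner ℝ v (noisePatches ω i) = 0) (t : ℕ)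
    (j : Bool) (r : Fin m) (i : Fin n) :
    |inner ℝ (trajectory q η v ω t j r) (noisePatches ω i)| ≤
      |inner ℝ (initFilters ω j r) (noisePatches ω i)|
      + (∑ k, |noiseCoeff q η v ω t j r k| / ‖noisePatches ω k‖) * ‖noisePatches ω i‖
      + η * |inner ℝ (noiseWalk ω t) (noisePatches ω i)| := by
  have e := (isDecomposition hη hq hv hξ t j r).2
  have h0 : trajectory q η v ω 0 j r = initFilters ω j r := rfl
  rw [e, h0]
  simp only [inner_add_left, inner_sub_left, inner_smul_left, sum_inner, horth, mul_zero,
    add_zero, RCLike.conj_to_real]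
  have h1 : |∑ k, noiseCoeff q η v ω t j r k * (‖noisePatches ω k‖ ^ 2)⁻¹
        * inner ℝ (noisePatches ω k) (noisePatches ω i)|
      ≤ (∑ k, |noiseCoeff q η v ω t j r k| / ‖noisePatches ω k‖) * ‖noisePatches ω i‖ := by
    rw [Finset.sum_mul]
    refine (Finset.abs_sum_le_sum_abs _ _).trans (Finset.sum_le_sum fun k _ => ?_)
    have hk : 0 < ‖noisePatches ω k‖ := norm_pos_iff.2 (hξ k)
    rw [abs_mul, abs_mul, abs_of_nonneg (show 0 ≤ (‖noisePatches ω k‖ ^ 2)⁻¹ by positivity)]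
    calc |noiseCoeff q η v ω t j r k| * (‖noisePatches ω k‖ ^ 2)⁻¹
          * |inner ℝ (noisePatches ω k) (noisePatches ω i)|
        ≤ |noiseCoeff q η v ω t j r k| * (‖noisePatches ω k‖ ^ 2)⁻¹
          * (‖noisePatches ω k‖ * ‖noisePatches ω i‖) := by
          gcongr
          exact abs_real_inner_le_norm _ _
      _ = _ := by field_simp
  have h2 : |η * inner ℝ (noiseWalk ω t) (noisePatches ω i)|
      = η * |inner ℝ (noiseWalk ω t) (noisePatches ω i)| := by
    rw [abs_mul, abs_of_nonneg hη]
  rw [← h2]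
  rw [← sum_inner, ← noiseWalk]
  refine (abs_sub _ _).trans ?_
  gcongr
  exact (abs_add_le _ _).trans (by gcongr)

/-- The noise patch changes the margin by at most the activation it produces. -/
theorem abs_marginAt_sub_le {c : ℝ} (hc : 0 ≤ c) (t : ℕ) (i : Fin n)
    (h : ∀ j r, act q (inner ℝ (trajectory q η v ω t j r) (noisePatches ω i)) ≤ c) :
    |marginAt q η v ω t i - (posOut q (signalCoord q η v ω t) (labels ω i)
      - negOut q (signalCoord q η v ω t) (labels ω i))| ≤ c := by
  set b : Bool → ℝ := fun j =>
    (1 / (m : ℝ)) * ∑ r, act q (inner ℝ (trajectory q η v ω t j r) (noisePatches ω i)) with hb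
  have hb0 : ∀ j, 0 ≤ b j := fun j =>
    mul_nonneg (by positivity) (Finset.sum_nonneg fun _ _ => act_nonneg _ _)
  have hbc : ∀ j, b j ≤ c := fun j => mean_le hc (h j)
  have hbr : ∀ j, branch q (trajectory q η v ω t j) (trainingSet v ω i)
      = (1 / (m : ℝ)) * ∑ r, act q (inner ℝ (trajectory q η v ω t j r) (sgn (labels ω i) • v))
        + b j := by
    intro j
    rw [branch, Finset.sum_add_distrib, mul_add]
    rfl
  have hlab : (trainingSet v ω i).label = labels ω i := rfl
  have h1 := hb0 true
  have h2 := hb0 false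
  have h3 := hbc true
  have h4 := hbc false
  rw [marginAt, margin, network, hbr, hbr, hlab, posOut, negOut]
  simp only [signalCoord, inner_smul_right]
  cases labels ω i <;> simp only [sgn, Bool.not_true, Bool.not_false] <;>
    simp [abs_le] <;> constructor <;> linarith

end Decomposition

/-! ### Typical outcomes -/

/-- The outcomes on which the Gaussian quantities of the analysis exceed their standard deviations
at most by the factor `u`, up to time `T`, each class has at least `n / 4` points, some filter of
each sign is well correlated with its own signal initially, and the noise patches are in general
position. -/
structure TypicalOutcome {n m d : ℕ} (u : ℝ) (T : ℕ) (v : Vec d) (σξ σ₀ σz : ℝ)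
    (ω : Outcome n m d) : Prop where
  orthogonal : ∀ i, inner ℝ v (noisePatches ω i) = 0
  independent : LinearIndependent ℝ (noisePatches ω)
  balanced : ∀ j, (n : ℝ) / 4 ≤ (Finset.univ.filter fun i => labels ω i = j).card
  patch_norm : ∀ i, ‖noisePatches ω i‖ ≤ u * noiseNorm d σξ
  init_signal : ∀ j r, |inner ℝ (initFilters ω j r) v| ≤ u * σ₀ * ‖v‖
  init_noise : ∀ j r i, |inner ℝ (initFilters ω j r) (noisePatches ω i)|
    ≤ u * σ₀ * ‖noisePatches ω i‖
  init_large : ∀ j, ∃ r, σ₀ * ‖v‖ / 2 ≤ sgn j * inner ℝ (initFilters ω j r) v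
  walk_signal : ∀ t ≤ T, |inner ℝ (noiseWalk ω t) v| ≤ u * σz * Real.sqrt t * ‖v‖
  walk_noise : ∀ t ≤ T, ∀ i, |inner ℝ (noiseWalk ω t) (noisePatches ω i)|
    ≤ u * σz * Real.sqrt t * ‖noisePatches ω i‖
  step_signal : ∀ t ≤ T, |inner ℝ (privateNoise ω (t + 1)) v| ≤ u * σz * ‖v‖

namespace TypicalOutcome

variable {n m d : ℕ} {u σξ σ₀ σz q η : ℝ} {T : ℕ} {v : Vec d} {ω : Outcome n m d}

theorem noisePatch_ne_zero (h : TypicalOutcome u T v σξ σ₀ σz ω) (i : Fin n) :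
    noisePatches ω i ≠ 0 := h.independent.ne_zero i

theorem abs_inner_noisePatch_le (h : TypicalOutcome u T v σξ σ₀ σz ω) (hη : 0 ≤ η)
    (hq : 1 < q) (hv : v ≠ 0) (hu : 1 ≤ u) (hσ₀ : 0 ≤ σ₀) {t : ℕ} (ht : t ≤ T)
    (hwalk : η * (u * σz * Real.sqrt t) ≤ u ^ 3 * σ₀) {j : Bool} {r : Fin m}
    (hΦ : ∑ k, |noiseCoeff q η v ω t j r k| / ‖noisePatches ω k‖ ≤ σ₀) (i : Fin n) :
    |inner ℝ (trajectory q η v ω t j r) (noisePatches ω i)|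
      ≤ 3 * u ^ 4 * (σ₀ * noiseNorm d σξ) := by
  have h1 := NoisyGD.abs_inner_noisePatch_le hη hq hv h.noisePatch_ne_zero h.orthogonal t j r i
  have h2 := h.init_noise j r i
  have h3 := h.patch_norm i
  have hX : 0 ≤ ‖noisePatches ω i‖ := norm_nonneg _
  have h4 : η * |inner ℝ (noiseWalk ω t) (noisePatches ω i)|
      ≤ u ^ 3 * σ₀ * ‖noisePatches ω i‖ := by
    calc η * |inner ℝ (noiseWalk ω t) (noisePatches ω i)|
        ≤ η * (u * σz * Real.sqrt t * ‖noisePatches ω i‖) := by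
          gcongr
          exact h.walk_noise t ht i
      _ = η * (u * σz * Real.sqrt t) * ‖noisePatches ω i‖ := by ring
      _ ≤ _ := by gcongr
  have hu3 : 1 ≤ u ^ 3 := one_le_pow₀ hu
  have hu13 : u ≤ u ^ 3 := le_self_pow₀ hu (by norm_num)
  calc |inner ℝ (trajectory q η v ω t j r) (noisePatches ω i)|
      ≤ u * σ₀ * ‖noisePatches ω i‖ + σ₀ * ‖noisePatches ω i‖
        + u ^ 3 * σ₀ * ‖noisePatches ω i‖ := by
        refine h1.trans ?_
        gcongr
    _ ≤ u ^ 3 * σ₀ * ‖noisePatches ω i‖ + u ^ 3 * σ₀ * ‖noisePatches ω i‖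
        + u ^ 3 * σ₀ * ‖noisePatches ω i‖ := by
        gcongr
        exact le_mul_of_one_le_left hσ₀ hu3
    _ = 3 * u ^ 3 * σ₀ * ‖noisePatches ω i‖ := by ring
    _ ≤ 3 * u ^ 3 * σ₀ * (u * noiseNorm d σξ) := by gcongr
    _ = _ := by ring

/-- The noise coefficients stay small for the whole run: their sum grows at most linearly, as long
as the filters have the noise correlations of the initialization. -/
theorem sum_noiseCoeff_le [NeZero n] [NeZero m] (h : TypicalOutcome u T v σξ σ₀ σz ω)
    (hη : 0 ≤ η) (hq : 1 < q) (hv : v ≠ 0) (hu : 1 ≤ u) (hσ₀ : 0 ≤ σ₀) (hσξ : 0 ≤ σξ)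
    (hwalk : ∀ t ≤ T, η * (u * σz * Real.sqrt t) ≤ u ^ 3 * σ₀)
    (hrate : T * (η * q / m * (3 * u ^ 4 * (σ₀ * noiseNorm d σξ)) ^ (q - 1)
      * (u * noiseNorm d σξ)) ≤ σ₀ / (2 * u)) {t : ℕ} (ht : t ≤ T) (j : Bool) (r : Fin m) :
    ∑ k, |noiseCoeff q η v ω t j r k| / ‖noisePatches ω k‖ ≤ σ₀ / (2 * u) := by
  have hm : (0 : ℝ) < m := by exact_mod_cast NeZero.pos m
  have hn : (0 : ℝ) < n := by exact_mod_cast NeZero.pos n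
  have hN : 0 ≤ noiseNorm d σξ := by unfold noiseNorm; positivity
  set c := η * q / m * (3 * u ^ 4 * (σ₀ * noiseNorm d σξ)) ^ (q - 1) * (u * noiseNorm d σξ)
    with hc
  have hc0 : 0 ≤ c := by positivity
  have hstep : ∀ t ≤ T, t * c ≤ σ₀ / (2 * u) := fun t ht =>
    le_trans (by gcongr) hrate
  refine le_trans ?_ (hstep t ht)
  induction t with
  | zero => simp [noiseCoeff]
  | succ t ih =>
    have ih := ih (by omega)
    have hσ : ∑ k, |noiseCoeff q η v ω t j r k| / ‖noisePatches ω k‖ ≤ σ₀ := by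
      refine (ih.trans (hstep t (by omega))).trans ?_
      exact div_le_self hσ₀ (by linarith)
    have hinc : ∀ k, |noiseInc q η v ω t j r k| / ‖noisePatches ω k‖ ≤ c / n := by
      intro k
      have hk : 0 < ‖noisePatches ω k‖ := norm_pos_iff.2 (h.noisePatch_ne_zero k)
      have h1 := h.abs_inner_noisePatch_le hη hq hv hu hσ₀ (show t ≤ T by omega)
        (hwalk t (by omega)) hσ k
      have h2 : act (q - 1) (inner ℝ (trajectory q η v ω t j r) (noisePatches ω k))
          ≤ (3 * u ^ 4 * (σ₀ * noiseNorm d σξ)) ^ (q - 1) := by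
        refine (act_mono (by linarith) ((le_abs_self _).trans h1)).trans ?_
        rw [act_of_nonneg (by positivity)]
      have h3 : |noiseInc q η v ω t j r k| = η * q / (m * n)
          * (lossSlope (marginAt q η v ω t k)
            * act (q - 1) (inner ℝ (trajectory q η v ω t j r) (noisePatches ω k)))
          * ‖noisePatches ω k‖ ^ 2 := by
        have e0 := act_nonneg (q - 1) (inner ℝ (trajectory q η v ω t j r) (noisePatches ω k))
        have e1 := (lossSlope_pos (marginAt q η v ω t k)).le
        rw [noiseInc, abs_mul, abs_mul, abs_of_nonneg (show 0 ≤ η * q / (m * n) by positivity),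
          abs_of_nonneg (sq_nonneg ‖noisePatches ω k‖), mul_assoc (sgn j * _), mul_assoc (sgn j),
          abs_sgn_mul, abs_sgn_mul, abs_of_nonneg (mul_nonneg e1 e0)]
      rw [h3]
      calc η * q / (m * n) * (lossSlope (marginAt q η v ω t k)
            * act (q - 1) (inner ℝ (trajectory q η v ω t j r) (noisePatches ω k)))
            * ‖noisePatches ω k‖ ^ 2 / ‖noisePatches ω k‖
          = η * q / (m * n) * (lossSlope (marginAt q η v ω t k)
            * act (q - 1) (inner ℝ (trajectory q η v ω t j r) (noisePatches ω k)))
            * ‖noisePatches ω k‖ := by field_simp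
        _ ≤ η * q / (m * n) * (1 * (3 * u ^ 4 * (σ₀ * noiseNorm d σξ)) ^ (q - 1))
            * (u * noiseNorm d σξ) := by
            gcongr
            · exact act_nonneg _ _
            · exact lossSlope_le_one _
            · exact h.patch_norm k
        _ = c / n := by rw [hc]; field_simp
    calc ∑ k, |noiseCoeff q η v ω (t + 1) j r k| / ‖noisePatches ω k‖
        ≤ ∑ k, (|noiseCoeff q η v ω t j r k| / ‖noisePatches ω k‖ + c / n) := by
          refine Finset.sum_le_sum fun k _ => ?_
          rw [noiseCoeff, Finset.sum_range_succ, ← noiseCoeff]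
          refine le_trans ?_ (add_le_add_right (hinc k) _)
          rw [← add_div]
          gcongr
          exact abs_add_le _ _
      _ = ∑ k, |noiseCoeff q η v ω t j r k| / ‖noisePatches ω k‖ + c := by
          rw [Finset.sum_add_distrib]
          simp
          field_simp
      _ ≤ t * c + c := by gcongr
      _ = ((t + 1 : ℕ) : ℝ) * c := by push_cast; ring

theorem abs_noiseCoeff_le (h : TypicalOutcome u T v σξ σ₀ σz ω) (hu : 1 ≤ u)
    {t : ℕ} {j : Bool} {r : Fin m}
    (hΦ : ∑ k, |noiseCoeff q η v ω t j r k| / ‖noisePatches ω k‖ ≤ σ₀ / (2 * u))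
    (i : Fin n) : |noiseCoeff q η v ω t j r i| ≤ σ₀ * σξ * Real.sqrt d / 2 := by
  have hi : 0 < ‖noisePatches ω i‖ := norm_pos_iff.2 (h.noisePatch_ne_zero i)
  have h1 : |noiseCoeff q η v ω t j r i| / ‖noisePatches ω i‖ ≤ σ₀ / (2 * u) :=
    (Finset.single_le_sum (f := fun k => |noiseCoeff q η v ω t j r k| / ‖noisePatches ω k‖)
      (fun _ _ => by positivity) (Finset.mem_univ i)).trans hΦ
  have h0 : 0 ≤ σ₀ / (2 * u) := le_trans (by positivity) h1
  rw [div_le_iff₀ hi] at h1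
  refine h1.trans ?_
  calc σ₀ / (2 * u) * ‖noisePatches ω i‖ ≤ σ₀ / (2 * u) * (u * noiseNorm d σξ) := by
        gcongr; exact h.patch_norm i
    _ = _ := by rw [noiseNorm]; field_simp

/-- On a typical outcome the noise patches move the margins by at most `1/8`, so that the signal
coordinates evolve autonomously. -/
theorem signalProcess_trajectory [NeZero n] [NeZero m] (h : TypicalOutcome u T v σξ σ₀ σz ω)
    (hη : 0 ≤ η) (hq : 1 < q) (hv : v ≠ 0) (hu : 1 ≤ u) (hσ₀ : 0 ≤ σ₀)
    (hwalk : ∀ t ≤ T, η * (u * σz * Real.sqrt t) ≤ u ^ 3 * σ₀)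
    (hΦ : ∀ t ≤ T, ∀ j r, ∑ k, |noiseCoeff q η v ω t j r k| / ‖noisePatches ω k‖
      ≤ σ₀ / (2 * u))
    (hnoise : 3 * u ^ 4 * (σ₀ * noiseNorm d σξ) ≤ 1 / 8)
    (hsignal : u ^ 3 * (σ₀ * ‖v‖) ≤ 1 / 16) :
    SignalProcess q (η * ‖v‖ ^ 2) (labels ω) (marginAt q η v ω) (signalCoord q η v ω)
      (signalCoeff q η v ω) (fun t => η * inner ℝ (noiseWalk ω t) v) T where
  rate_nonneg := by positivity
  coord := signalCoord_eq hη hq hv h.noisePatch_ne_zero h.orthogonal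
  coeff_zero j r := by simp [signalCoeff]
  coeff_succ t j r := by rw [signalCoeff, Finset.sum_range_succ, signalCoeff]
  margin t ht i := by
    refine abs_marginAt_sub_le (by norm_num) t i fun j r => ?_
    refine act_le_of_le hq.le (by norm_num) (by norm_num) ?_
    refine (le_abs_self _).trans ((h.abs_inner_noisePatch_le hη hq hv hu hσ₀ ht (hwalk t ht)
      ((hΦ t ht j r).trans (div_le_self hσ₀ (by linarith))) i).trans hnoise)
  init j r := by
    have h1 := h.init_signal j r
    have h2 : u ≤ u ^ 3 := le_self_pow₀ hu (by norm_num)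
    change |sgn j * inner ℝ (initFilters ω j r) v| ≤ 1 / 16
    rw [abs_sgn_mul]
    refine h1.trans (le_trans ?_ hsignal)
    rw [mul_assoc]
    gcongr
  shift t ht := by
    rw [abs_mul, abs_of_nonneg hη]
    refine le_trans ?_ hsignal
    calc η * |inner ℝ (noiseWalk ω t) v| ≤ η * (u * σz * Real.sqrt t * ‖v‖) := by
          gcongr; exact h.walk_signal t ht
      _ = η * (u * σz * Real.sqrt t) * ‖v‖ := by ring
      _ ≤ u ^ 3 * σ₀ * ‖v‖ := mul_le_mul_of_nonneg_right (hwalk t ht) (norm_nonneg _)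
      _ = _ := by ring

end TypicalOutcome

theorem empiricalRisk_trajectory {n m d : ℕ} (q η : ℝ) (v : Vec d) (ω : Outcome n m d) (t : ℕ) :
    empiricalRisk q (trainingSet v ω) (trajectory q η v ω t) = meanLoss (marginAt q η v ω t) :=
  rfl

/-- The squared distance in the signal direction is at most the squared Frobenius distance. -/
theorem sum_sq_signal_le_frobNorm_sq {m d : ℕ} {v : Vec d} (hv : v ≠ 0) (q κ : ℝ)
    (W W₀ : Filters m d) :
    ∑ j, ∑ r, (sgn j * inner ℝ (W j r) v - (sgn j * inner ℝ (W₀ j r) v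
        + 2 * q * m * Real.log (2 * q / κ))) ^ 2
      ≤ ‖v‖ ^ 2 * frobNorm (W - reference q κ v W₀) ^ 2 := by
  have hv2 : ‖v‖ ^ 2 ≠ 0 := by simpa using hv
  have h1 : ∀ j r, (sgn j * inner ℝ (W j r) v - (sgn j * inner ℝ (W₀ j r) v
        + 2 * q * m * Real.log (2 * q / κ))) ^ 2
      ≤ ‖v‖ ^ 2 * ‖(W - reference q κ v W₀) j r‖ ^ 2 := by
    intro j r
    have e1 : sgn j * inner ℝ (W j r) v - (sgn j * inner ℝ (W₀ j r) v
        + 2 * q * m * Real.log (2 * q / κ))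
        = sgn j * inner ℝ ((W - reference q κ v W₀) j r) v := by
      simp only [Pi.sub_apply, reference, inner_sub_left, inner_add_left, inner_smul_left,
        real_inner_self_eq_norm_sq, RCLike.conj_to_real]
      rw [inv_mul_cancel_right₀ hv2]
      linear_combination (2 * q * m * Real.log (2 * q / κ)) * sgn_mul_self j
    rw [e1]
    generalize (W - reference q κ v W₀) j r = x
    have e2 := pow_le_pow_left₀ (abs_nonneg _) (abs_real_inner_le_norm x v) 2
    rw [sq_abs] at e2
    rw [mul_pow, sgn_sq]
    linarith [mul_pow ‖x‖ ‖v‖ 2]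
  rw [frobNorm, Real.sq_sqrt (add_nonneg (Finset.sum_nonneg fun _ _ => sq_nonneg _)
    (Finset.sum_nonneg fun _ _ => sq_nonneg _)), mul_add, Finset.mul_sum, Finset.mul_sum,
    Fintype.sum_bool]
  exact add_le_add (Finset.sum_le_sum fun r _ => h1 true r)
    (Finset.sum_le_sum fun r _ => h1 false r)

/-! ### Scales in the signal-learning regime -/

/-- What it means for the factor `L` of the signal-learning regime to dominate the deviation level
`u`. Each field pays for one estimate of the analysis. -/
structure Dominates (q C₁ u L : ℝ) : Prop where
  one_le_level : 1 ≤ u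
  one_le : 1 ≤ L
  shift : 1024 * 4 ^ (q - 1) / (C₁ * q) * u ^ 5 ≤ L
  rate : C₁ * q ≤ L
  growth : Real.exp (4 * C₁ / ((q - 2) * lossSlope (3 ^ q + 1))) ≤ L
  blowup : q ^ 2 * 3 ^ q ≤ L
  noise : 2 * q * u ^ 3 * (3 * u ^ 4) ^ (q - 1) ≤ L
  margin : 24 * u ^ 4 ≤ L
  step : 20 * q ^ 2 ≤ L

/-- The relations between the scales `V = ‖v‖`, `N = ‖ξ‖`, `σ₀`, `η`, `x = n ε` and `m` that the
analysis of the signal-learning regime with factor `L` uses. -/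
structure Scales (q L V N σ₀ η x m : ℝ) : Prop where
  V_pos : 0 < V
  N_pos : 0 < N
  init_pos : 0 < σ₀
  step_pos : 0 < η
  one_le_m : 1 ≤ m
  one_le_x : 1 ≤ x
  le_signal_pow : L ≤ x * (σ₀ * V) ^ q
  signal : L * (σ₀ * V) ≤ 1
  noise : L * (σ₀ * N) ≤ 1
  noise_pow : L * (x * (σ₀ * N) ^ (q - 1)) ≤ 1
  N_le_V : N ≤ V
  step : L * (η * V ^ 2) ≤ 1

theorem SignalLearning.scales {q L : ℝ} {n m d : ℕ} {v : Vec d} {σξ σ₀ η ε : ℝ}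
    (h : SignalLearning q L n m v σξ σ₀ η ε) (hq : 2 < q) (hL : 1 ≤ L) (hv : v ≠ 0)
    (hN : 0 < noiseNorm d σξ) (hσ₀ : 0 < σ₀) (hη : 0 < η) (hε : 0 < ε) :
    Scales q L ‖v‖ (noiseNorm d σξ) σ₀ η (n * ε) m := by
  have hV : 0 < ‖v‖ := norm_pos_iff.2 hv
  have hL0 : 0 < L := by linarith
  have hn : (1 : ℝ) ≤ n := hL.trans h.samples
  have hm : (1 : ℝ) ≤ m := hL.trans h.width
  have hx : 0 < n * ε := by positivity
  obtain ⟨-, hup⟩ := le_min_iff.1 h.init_upper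
  obtain ⟨hup2, hup3⟩ := le_min_iff.1 hup
  set V := ‖v‖
  set N := noiseNorm d σξ
  set x := n * ε
  have hq0 : 0 < q := by linarith
  have F1 : L * x ^ (-(1 / q)) ≤ σ₀ * V := by
    have := mul_le_mul_of_nonneg_right h.init_lower hV.le
    rwa [← mul_assoc, mul_assoc, inv_mul_cancel₀ hV.ne', mul_one] at this
  have F2 : L * (σ₀ * N) ≤ x ^ ((-q - 1) / q) := by
    have := mul_le_mul_of_nonneg_right hup3 hN.le
    rwa [mul_assoc, mul_assoc, inv_mul_cancel₀ hN.ne', mul_one] at this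
  have F3 : L * (σ₀ * V) ≤ 1 := by
    have := mul_le_mul_of_nonneg_right hup2 hV.le
    rw [mul_assoc, mul_assoc, inv_mul_cancel₀ hV.ne', mul_one] at this
    refine this.trans (Real.rpow_le_one_of_one_le_of_nonpos hn ?_)
    have : 0 < 1 / (2 * q) := by positivity
    linarith
  have hs1 : σ₀ * V ≤ 1 := by nlinarith [mul_pos hσ₀ hV]
  have hx1 : 1 ≤ x := by
    by_contra hlt
    push Not at hlt
    have : 1 < x ^ (-(1 / q)) :=
      Real.one_lt_rpow_of_pos_of_lt_one_of_neg hx hlt (by simpa using hq0)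
    nlinarith
  have hxe : x ^ ((-q - 1) / q) ≤ x ^ (-(1 / q)) := by
    refine Real.rpow_le_rpow_of_exponent_le hx1 ?_
    rw [neg_div', div_le_div_iff_of_pos_right hq0]
    linarith
  have hNpos : 0 < σ₀ * N := mul_pos hσ₀ hN
  refine ⟨hV, hN, hσ₀, hη, hm, hx1, ?_, F3, ?_, ?_, ?_, ?_⟩
  · have h1 : L ^ q * x⁻¹ ≤ (σ₀ * V) ^ q := by
      have := Real.rpow_le_rpow (by positivity) F1 hq0.le
      rw [Real.mul_rpow hL0.le (by positivity), ← Real.rpow_mul hx.le] at this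
      rwa [show -(1 / q) * q = -1 by field_simp, Real.rpow_neg_one] at this
    have h2 : L ≤ L ^ q := Real.self_le_rpow_of_one_le hL (by linarith)
    rw [← div_eq_mul_inv, div_le_iff₀ hx] at h1
    linarith
  · refine F2.trans (Real.rpow_le_one_of_one_le_of_nonpos hx1 ?_)
    exact div_nonpos_of_nonpos_of_nonneg (by linarith) hq0.le
  · have h1 := Real.rpow_le_rpow (by positivity) F2 (show 0 ≤ q - 1 by linarith)
    rw [Real.mul_rpow hL0.le hNpos.le, ← Real.rpow_mul hx.le] at h1
    have h2 : L ≤ L ^ (q - 1) := Real.self_le_rpow_of_one_le hL (by linarith)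
    have h3 : x ^ ((-q - 1) / q * (q - 1)) ≤ x ^ (-1 : ℝ) := by
      refine Real.rpow_le_rpow_of_exponent_le hx1 ?_
      rw [div_mul_eq_mul_div, div_le_iff₀ hq0]
      nlinarith
    rw [Real.rpow_neg_one] at h3
    have h4 : 0 < (σ₀ * N) ^ (q - 1) := Real.rpow_pos_of_pos hNpos _
    calc L * (x * (σ₀ * N) ^ (q - 1)) = x * (L * (σ₀ * N) ^ (q - 1)) := by ring
      _ ≤ x * (L ^ (q - 1) * (σ₀ * N) ^ (q - 1)) := by gcongr
      _ ≤ x * x⁻¹ := by gcongr; exact h1.trans h3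
      _ = 1 := mul_inv_cancel₀ hx.ne'
  · have h1 : σ₀ * N ≤ σ₀ * V := by
      have h2 : σ₀ * N ≤ L * (σ₀ * N) := le_mul_of_one_le_left hNpos.le hL
      have h3 : x ^ (-(1 / q)) ≤ L * x ^ (-(1 / q)) :=
        le_mul_of_one_le_left (by positivity) hL
      linarith
    exact le_of_mul_le_mul_left h1 hσ₀
  · have h1 : L * η ≤ V ^ (-2 : ℝ) := h.step.trans (min_le_left _ _)
    have h2 : V ^ (-2 : ℝ) = (V ^ 2)⁻¹ := by
      rw [Real.rpow_neg hV.le]; norm_cast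
    rw [h2] at h1
    have h3 := mul_le_mul_of_nonneg_right h1 (sq_nonneg V)
    rw [inv_mul_cancel₀ (by positivity)] at h3
    linarith

theorem SignalLearning.mul_sq_le {q L : ℝ} {n m d : ℕ} {v : Vec d} {σξ σ₀ η ε : ℝ}
    (h : SignalLearning q L n m v σξ σ₀ η ε) (hL : 1 ≤ L) :
    L * (m : ℝ) ^ 2 * (n : ℝ) ^ 4 ≤ d := by
  have hn : (1 : ℝ) ≤ n := hL.trans h.samples
  have hm : (1 : ℝ) ≤ m := hL.trans h.width
  refine le_trans ?_ h.dim
  have h1 : (m : ℝ) ^ 2 ≤ (m : ℝ) ^ max 2 (4 / (q - 2)) := by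
    rw [← Real.rpow_natCast]
    exact Real.rpow_le_rpow_of_exponent_le hm (le_max_left _ _)
  have h2 : (n : ℝ) ^ 4 ≤ (n : ℝ) ^ max 4 ((2 * q - 2) / (q - 2)) := by
    rw [← Real.rpow_natCast]
    exact Real.rpow_le_rpow_of_exponent_le hn (le_max_left _ _)
  gcongr

namespace Scales

variable {q C₁ u L V N σ₀ η x m : ℝ}

theorem signal_pos (h : Scales q L V N σ₀ η x m) : 0 < σ₀ * V := mul_pos h.init_pos h.V_pos

/-- The number `T` of private iterations is so limited that the noise coefficients, which grow by at
most a fixed amount per step, stay below the scale of the initialization. -/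
theorem noise_rate (h : Scales q L V N σ₀ η x m) (hD : Dominates q C₁ u L) (hq : 2 < q) {T : ℝ}
    (hT0 : 0 ≤ T) (hT : η * T * (V + N) ≤ u * m * x * σ₀) :
    T * (η * q / m * (3 * u ^ 4 * (σ₀ * N)) ^ (q - 1) * (u * N)) ≤ σ₀ / (2 * u) := by
  obtain ⟨hV, hN, hσ, hη, hm, hx, -, -, -, hpow, -, -⟩ := h
  have hu : 0 < u := by linarith [hD.one_le_level]
  have hb : 0 < σ₀ * N := mul_pos hσ hN
  have h1 : η * T * N ≤ u * m * x * σ₀ := by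
    refine le_trans ?_ hT
    gcongr
    linarith
  have h2 : (3 * u ^ 4 * (σ₀ * N)) ^ (q - 1) = (3 * u ^ 4) ^ (q - 1) * (σ₀ * N) ^ (q - 1) :=
    Real.mul_rpow (by positivity) hb.le
  have hy : 0 < (σ₀ * N) ^ (q - 1) := Real.rpow_pos_of_pos hb _
  rw [h2, le_div_iff₀ (by positivity)]
  set Y := (σ₀ * N) ^ (q - 1)
  set X := (3 * u ^ 4) ^ (q - 1)
  have hX : 0 ≤ X := Real.rpow_nonneg (by positivity) _
  calc T * (η * q / m * (X * Y) * (u * N)) * (2 * u)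
      = η * T * N * (2 * q * u ^ 2 * (X * Y) / m) := by ring
    _ ≤ u * m * x * σ₀ * (2 * q * u ^ 2 * (X * Y) / m) := by gcongr
    _ = 2 * q * u ^ 3 * X * (x * Y) * σ₀ := by field_simp
    _ ≤ L * (x * Y) * σ₀ := by gcongr; exact hD.noise
    _ ≤ 1 * σ₀ := by gcongr
    _ = σ₀ := one_mul _

theorem noise_margin (h : Scales q L V N σ₀ η x m) (hD : Dominates q C₁ u L) :
    3 * u ^ 4 * (σ₀ * N) ≤ 1 / 8 := by
  have hb : 0 < σ₀ * N := mul_pos h.init_pos h.N_pos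
  nlinarith [hD.margin, h.noise]

theorem signal_margin (h : Scales q L V N σ₀ η x m) (hD : Dominates q C₁ u L) :
    u ^ 3 * (σ₀ * V) ≤ 1 / 16 := by
  have h1 : u ^ 3 ≤ u ^ 4 := pow_le_pow_right₀ hD.one_le_level (by norm_num)
  have := hD.one_le_level
  have h2 : 0 ≤ u ^ 4 := by positivity
  nlinarith [hD.margin, h.signal, h.signal_pos]

theorem step_small (h : Scales q L V N σ₀ η x m) (hD : Dominates q C₁ u L) :
    10 * (η * V ^ 2 * q ^ 2) ≤ 1 / 2 := by
  have h1 : 0 ≤ η * V ^ 2 := mul_nonneg h.step_pos.le (sq_nonneg _)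
  nlinarith [hD.step, h.step]

theorem blowup_small (h : Scales q L V N σ₀ η x m) (hD : Dominates q C₁ u L) (hq : 2 < q) :
    q * (η * V ^ 2 * q * lossSlope (3 ^ q + 1) / 4 * 3 ^ (q - 2)) ≤ 2 := by
  have hB : 0 ≤ η * V ^ 2 := mul_nonneg h.step_pos.le (sq_nonneg _)
  have h1 : (3 : ℝ) ^ (q - 2) ≤ 3 ^ q :=
    Real.rpow_le_rpow_of_exponent_le (by norm_num) (by linarith)
  have h2 := lossSlope_le_one (3 ^ q + 1)
  have h3 := (lossSlope_pos (3 ^ q + 1)).le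
  calc q * (η * V ^ 2 * q * lossSlope (3 ^ q + 1) / 4 * 3 ^ (q - 2))
      ≤ q * (η * V ^ 2 * q * 1 / 4 * 3 ^ q) := by gcongr
    _ = (q ^ 2 * 3 ^ q) * (η * V ^ 2) / 4 := by ring
    _ ≤ L * (η * V ^ 2) / 4 := by gcongr; exact hD.blowup
    _ ≤ 2 := by linarith [h.step]

end Scales

/-- The real number whose ceiling is the end `T₁` of the first stage, in terms of `s = σ₀ ‖v‖`. -/
theorem stageOne_arg_eq {q C₁ V σ₀ η m : ℝ} (hV : 0 < V) (hσ : 0 < σ₀) :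
    Real.log (16 / (σ₀ * V)) * (4 : ℝ) ^ (q - 1) * m / (C₁ * η * q * σ₀ ^ (q - 2) * V ^ q)
      = Real.log (16 / (σ₀ * V)) * (4 : ℝ) ^ (q - 1) * m
        / (C₁ * q * (η * V ^ 2) * (σ₀ * V) ^ (q - 2)) := by
  rw [Real.mul_rpow hσ.le hV.le]
  have : V ^ q = V ^ 2 * V ^ (q - 2) := by
    rw [← Real.rpow_natCast V 2, ← Real.rpow_add hV]
    norm_num
  rw [this]
  ring

section StageOne

variable {q C₁ u L σ₀ η x : ℝ} {m d : ℕ} {v : Vec d} {N : ℝ}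

theorem log_le_log_div (h : Scales q L ‖v‖ N σ₀ η x m) (hL : 1 ≤ L) :
    Real.log L ≤ Real.log (16 / (σ₀ * ‖v‖)) := by
  refine Real.log_le_log (by linarith) ?_
  rw [le_div_iff₀ h.signal_pos]
  linarith [h.signal]

/-- The first stage lasts longer than the blow-up time of the signal coefficients. The logarithm in
its length exceeds every constant, so that the value of `C₁` does not matter. -/
theorem stageOneEnd_long (h : Scales q L ‖v‖ N σ₀ η x m) (hD : Dominates q C₁ u L) (hq : 2 < q)
    (hC₁ : 0 < C₁) :
    (σ₀ * ‖v‖ / 4) ^ (-(q - 2)) ≤ stageOneEnd q C₁ m v σ₀ η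
      * ((q - 2) * (η * ‖v‖ ^ 2 * q * lossSlope (3 ^ q + 1) / (4 * m)) / 4) := by
  have hs := h.signal_pos
  have hB : 0 < η * ‖v‖ ^ 2 := mul_pos h.step_pos (pow_pos h.V_pos 2)
  have hm : (0 : ℝ) < m := by linarith [h.one_le_m]
  have hc := lossSlope_pos (3 ^ q + 1)
  have hq2 : 0 < q - 2 := by linarith
  have hT := Nat.le_ceil (Real.log (16 / (σ₀ * ‖v‖)) * (4 : ℝ) ^ (q - 1) * m
    / (C₁ * η * q * σ₀ ^ (q - 2) * ‖v‖ ^ q))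
  rw [← stageOneEnd, stageOne_arg_eq h.V_pos h.init_pos] at hT
  have hlog : 4 * C₁ ≤ Real.log (16 / (σ₀ * ‖v‖)) * ((q - 2) * lossSlope (3 ^ q + 1)) := by
    have h1 := Real.log_le_log (Real.exp_pos _) hD.growth
    rw [Real.log_exp] at h1
    have h2 := h1.trans (log_le_log_div h hD.one_le)
    rwa [div_le_iff₀ (by positivity)] at h2
  have hpow : 0 < (σ₀ * ‖v‖) ^ (q - 2) := Real.rpow_pos_of_pos hs _
  have h4 : (4 : ℝ) ^ (q - 1) = 4 * 4 ^ (q - 2) := by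
    rw [show q - 1 = 1 + (q - 2) by ring, Real.rpow_add (by norm_num), Real.rpow_one]
  calc (σ₀ * ‖v‖ / 4) ^ (-(q - 2)) = 4 ^ (q - 2) / (σ₀ * ‖v‖) ^ (q - 2) := by
        rw [Real.rpow_neg (by positivity), Real.div_rpow hs.le (by norm_num), inv_div]
    _ = 4 * C₁ * (4 ^ (q - 2) / (4 * C₁ * (σ₀ * ‖v‖) ^ (q - 2))) := by field_simp
    _ ≤ Real.log (16 / (σ₀ * ‖v‖)) * ((q - 2) * lossSlope (3 ^ q + 1))
        * (4 ^ (q - 2) / (4 * C₁ * (σ₀ * ‖v‖) ^ (q - 2))) := by gcongr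
    _ = Real.log (16 / (σ₀ * ‖v‖)) * (4 : ℝ) ^ (q - 1) * m
        / (C₁ * q * (η * ‖v‖ ^ 2) * (σ₀ * ‖v‖) ^ (q - 2))
        * ((q - 2) * (η * ‖v‖ ^ 2 * q * lossSlope (3 ^ q + 1) / (4 * m)) / 4) := by
        have := h.V_pos
        have := h.step_pos
        rw [h4]; field_simp
    _ ≤ _ := by gcongr

theorem one_le_log_div (h : Scales q L ‖v‖ N σ₀ η x m) (hL : 1 ≤ L) :
    1 ≤ Real.log (16 / (σ₀ * ‖v‖)) := by
  rw [Real.le_log_iff_exp_le (by have := h.signal_pos; positivity), le_div_iff₀ h.signal_pos]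
  have h1 : σ₀ * ‖v‖ ≤ 1 := by nlinarith [h.signal, h.signal_pos]
  have h2 := Real.exp_one_lt_d9
  have h3 := Real.exp_pos 1
  nlinarith [h.signal_pos]

/-- The first stage is so short that the private noise accumulated in it is small even compared
with the initialization. -/
theorem stageOneEnd_short (h : Scales q L ‖v‖ N σ₀ η x m) (hD : Dominates q C₁ u L) (hq : 2 < q)
    (hC₁ : 0 < C₁) :
    32 * u ^ 5 * (η * stageOneEnd q C₁ m v σ₀ η * ‖v‖) ≤ m * x * σ₀ := by
  have hs := h.signal_pos
  have hV := h.V_pos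
  have hη := h.step_pos
  have hm := h.one_le_m
  have hB : 0 < η * ‖v‖ ^ 2 := mul_pos h.step_pos (pow_pos h.V_pos 2)
  have hu := hD.one_le_level
  have hL := hD.one_le
  have hx := h.one_le_x
  have hs1 : σ₀ * ‖v‖ ≤ 1 := by nlinarith [h.signal]
  have hlog := one_le_log_div h hL
  have hpow : 0 < (σ₀ * ‖v‖) ^ (q - 2) := Real.rpow_pos_of_pos hs _
  have hpow1 : (σ₀ * ‖v‖) ^ (q - 2) ≤ 1 := Real.rpow_le_one hs.le hs1 (by linarith)
  have h4 : (1 : ℝ) ≤ 4 ^ (q - 1) := Real.one_le_rpow (by norm_num) (by linarith)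
  set X := Real.log (16 / (σ₀ * ‖v‖)) * (4 : ℝ) ^ (q - 1) * m
    / (C₁ * q * (η * ‖v‖ ^ 2) * (σ₀ * ‖v‖) ^ (q - 2)) with hX
  have hX1 : 1 ≤ X := by
    rw [hX, le_div_iff₀ (by positivity), one_mul]
    calc C₁ * q * (η * ‖v‖ ^ 2) * (σ₀ * ‖v‖) ^ (q - 2)
        ≤ L * (η * ‖v‖ ^ 2) * 1 := by gcongr; exact hD.rate
      _ ≤ 1 * 1 * 1 := by linarith [h.step]
      _ ≤ Real.log (16 / (σ₀ * ‖v‖)) * (4 : ℝ) ^ (q - 1) * m := by gcongr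
  have hT : (stageOneEnd q C₁ m v σ₀ η : ℝ) ≤ 2 * X := by
    have := Nat.ceil_lt_add_one (show 0 ≤ X by linarith)
    rw [hX, ← stageOne_arg_eq h.V_pos h.init_pos] at this
    rw [hX, ← stageOne_arg_eq h.V_pos h.init_pos] at hX1 ⊢
    rw [stageOneEnd]
    linarith
  have hlog16 : Real.log (16 / (σ₀ * ‖v‖)) ≤ 16 / (σ₀ * ‖v‖) :=
    (Real.log_le_sub_one_of_pos (by positivity)).trans (by linarith)
  have hsq : (σ₀ * ‖v‖) ^ q = (σ₀ * ‖v‖) ^ (q - 2) * (σ₀ * ‖v‖) ^ 2 := by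
    rw [← Real.rpow_natCast _ 2, ← Real.rpow_add hs]
    norm_num
  have hLx := h.le_signal_pow
  rw [hsq] at hLx
  calc 32 * u ^ 5 * (η * stageOneEnd q C₁ m v σ₀ η * ‖v‖)
      ≤ 32 * u ^ 5 * (η * (2 * X) * ‖v‖) := by gcongr
    _ = 64 * u ^ 5 * Real.log (16 / (σ₀ * ‖v‖)) * (4 : ℝ) ^ (q - 1) * m
        / (C₁ * q * ‖v‖ * (σ₀ * ‖v‖) ^ (q - 2)) := by
        rw [hX]; field_simp; norm_num
    _ ≤ 64 * u ^ 5 * (16 / (σ₀ * ‖v‖)) * (4 : ℝ) ^ (q - 1) * m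
        / (C₁ * q * ‖v‖ * (σ₀ * ‖v‖) ^ (q - 2)) := by gcongr
    _ = (1024 * 4 ^ (q - 1) / (C₁ * q) * u ^ 5) * m * σ₀
        / ((σ₀ * ‖v‖) ^ (q - 2) * (σ₀ * ‖v‖) ^ 2) := by
        field_simp; norm_num
    _ ≤ (x * ((σ₀ * ‖v‖) ^ (q - 2) * (σ₀ * ‖v‖) ^ 2)) * m * σ₀
        / ((σ₀ * ‖v‖) ^ (q - 2) * (σ₀ * ‖v‖) ^ 2) := by
        have := h.init_pos
        gcongr ?_ * m * σ₀ / _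
        exact hD.shift.trans hLx
    _ = m * x * σ₀ := by field_simp

end StageOne

section Walk

variable {u V N σ₀ η x m Cz T : ℝ}

/-- The private noise accumulated in `t` steps has size `√t σ_z`, with
`σ_z = C √T (‖v‖ + ‖ξ‖) / (m n ε)`. -/
theorem walk_le (hu : 0 ≤ u) (hVN : 0 ≤ V + N) (hη : 0 ≤ η) (hm : 0 < m) (hx : 0 < x)
    (hCz : Cz ≤ u) (hT0 : 0 ≤ T) (hT : η * T * (V + N) ≤ u * m * x * σ₀)
    {t : ℝ} (ht : t ≤ T) :
    η * (u * (Cz * Real.sqrt T * (V + N) / (m * x)) * Real.sqrt t) ≤ u ^ 3 * σ₀ := by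
  have h1 : Real.sqrt T * Real.sqrt t ≤ T := by
    calc Real.sqrt T * Real.sqrt t ≤ Real.sqrt T * Real.sqrt T := by gcongr
      _ = T := Real.mul_self_sqrt hT0
  calc η * (u * (Cz * Real.sqrt T * (V + N) / (m * x)) * Real.sqrt t)
      = u * Cz * (Real.sqrt T * Real.sqrt t) * (η * (V + N) / (m * x)) := by ring
    _ ≤ u * u * T * (η * (V + N) / (m * x)) := by gcongr
    _ = u * u * (η * T * (V + N)) / (m * x) := by ring
    _ ≤ u * u * (u * m * x * σ₀) / (m * x) := by gcongr
    _ = u ^ 3 * σ₀ := by field_simp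

/-- The private noise accumulated in the first stage: its variance is controlled by the product of
the two horizons `T` and `T₁`. -/
theorem walk_le_quarter (hu : 0 ≤ u) (hVN : 0 ≤ V + N) (hNV : N ≤ V) (hη : 0 ≤ η) (hm : 0 < m)
    (hx : 0 < x) (hσ₀ : 0 ≤ σ₀) (hCz0 : 0 ≤ Cz) (hCz : Cz ≤ u) (hT0 : 0 ≤ T)
    (hT : η * T * (V + N) ≤ u * m * x * σ₀) {T₁ : ℝ} (hT₁0 : 0 ≤ T₁)
    (hT₁ : 32 * u ^ 5 * (η * T₁ * V) ≤ m * x * σ₀) {t : ℝ} (ht : t ≤ T₁) :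
    η * (u * (Cz * Real.sqrt T * (V + N) / (m * x)) * Real.sqrt t) ≤ σ₀ / 4 := by
  refine le_of_sq_le_sq ?_ (by positivity)
  calc (η * (u * (Cz * Real.sqrt T * (V + N) / (m * x)) * Real.sqrt t)) ^ 2
      ≤ (η * (u * (Cz * Real.sqrt T * (V + N) / (m * x)) * Real.sqrt T₁)) ^ 2 := by gcongr
    _ = (u * Cz) ^ 2 * (η * T * (V + N)) * (η * T₁ * (V + N)) / (m * x) ^ 2 := by
        have e1 := Real.sq_sqrt hT0
        have e2 := Real.sq_sqrt hT₁0
        calc _ = (u * Cz) ^ 2 * (η * (V + N)) ^ 2 / (m * x) ^ 2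
              * (Real.sqrt T ^ 2 * Real.sqrt T₁ ^ 2) := by ring
          _ = _ := by rw [e1, e2]; ring
    _ ≤ (u * u) ^ 2 * (u * m * x * σ₀) * (η * T₁ * (V + V)) / (m * x) ^ 2 := by gcongr
    _ = (32 * u ^ 5 * (η * T₁ * V)) * σ₀ / (16 * (m * x)) := by field_simp; ring
    _ ≤ (m * x * σ₀) * σ₀ / (16 * (m * x)) := by gcongr
    _ = (σ₀ / 4) ^ 2 := by field_simp; norm_num

end Walk

/-! ### Gaussian and sub-Gaussian estimates -/

open scoped ENNReal NNReal RealInnerProductSpace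

section Gaussian

variable {d : ℕ}

theorem multivariateGaussian_map_inner {S : Matrix (Fin d) (Fin d) ℝ} (hS : S.PosSemidef)
    (u : Vec d) :
    (multivariateGaussian 0 S).map (fun x => inner ℝ x u)
      = gaussianReal 0 (u ⬝ᵥ S.mulVec u).toNNReal := by
  have h1 : (fun x : Vec d => inner ℝ x u) = innerSL ℝ u := by
    ext x; exact real_inner_comm _ _
  have h2 : Var[innerSL ℝ u; multivariateGaussian 0 S] = u ⬝ᵥ S.mulVec u := by
    rw [← covariance_self (by fun_prop), ← covarianceBilin_multivariateGaussian (μ := 0) hS u u,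
      covarianceBilin_apply_eq_cov IsGaussian.memLp_two_id]
    rfl
  rw [h1, IsGaussian.map_eq_gaussianReal, ContinuousLinearMap.integral_comp_id_comm, h2]
  · simp
  · exact IsGaussian.integrable_id

theorem isotropicGaussian_map_inner (σ : ℝ) (u : Vec d) :
    (isotropicGaussian d σ).map (fun x => inner ℝ x u)
      = gaussianReal 0 (σ ^ 2 * ‖u‖ ^ 2).toNNReal := by
  rw [isotropicGaussian, multivariateGaussian_map_inner
    (Matrix.PosSemidef.one.smul (sq_nonneg σ)), Matrix.smul_mulVec, Matrix.one_mulVec,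
    dotProduct_smul, EuclideanSpace.real_norm_sq_eq]
  simp [dotProduct, sq]

theorem dotProduct_self_eq_norm_sq (v : Vec d) : v.ofLp ⬝ᵥ v.ofLp = ‖v‖ ^ 2 := by
  rw [EuclideanSpace.real_norm_sq_eq]; simp [dotProduct, sq]

theorem dotProduct_eq_inner (v w : Vec d) : v.ofLp ⬝ᵥ w.ofLp = inner ℝ v w := by
  simp [PiLp.inner_apply, dotProduct, mul_comm]

theorem projMatrix_quadratic (v u : Vec d) :
    u ⬝ᵥ (projMatrix v).mulVec u = ‖u‖ ^ 2 - (‖v‖ ^ 2)⁻¹ * (inner ℝ u v) ^ 2 := by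
  rw [projMatrix, Matrix.sub_mulVec, Matrix.one_mulVec, Matrix.smul_mulVec,
    Matrix.vecMulVec_mulVec, dotProduct_sub, dotProduct_smul, dotProduct_self_eq_norm_sq]
  have h1 : u.ofLp ⬝ᵥ (MulOpposite.op (v.ofLp ⬝ᵥ u.ofLp) • v.ofLp)
      = (inner ℝ u v) ^ 2 := by
    rw [op_smul_eq_smul, dotProduct_smul, dotProduct_eq_inner, dotProduct_eq_inner,
      real_inner_comm, smul_eq_mul, sq]
  rw [h1, smul_eq_mul]

theorem dataNoise_map_inner (v : Vec d) (σ : ℝ) (u : Vec d) :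
    (multivariateGaussian 0 ((σ ^ 2) • projMatrix v)).map (fun x => inner ℝ x u)
      = gaussianReal 0 (σ ^ 2 * (‖u‖ ^ 2 - (‖v‖ ^ 2)⁻¹ * (inner ℝ u v) ^ 2)).toNNReal := by
  rw [multivariateGaussian_map_inner ((projMatrix_posSemidef v).smul (sq_nonneg σ)),
    Matrix.smul_mulVec, dotProduct_smul, projMatrix_quadratic, smul_eq_mul]

theorem hasSubgaussianMGF_of_map_eq_gaussianReal {Ω : Type*} [MeasurableSpace Ω] {μ : Measure Ω}
    {X : Ω → ℝ} (hX : Measurable X) {c : ℝ≥0} (h : μ.map X = gaussianReal 0 c) :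
    HasSubgaussianMGF X c μ := by
  have : HasSubgaussianMGF id c (μ.map X) := by
    rw [h]
    exact ⟨fun t => integrable_exp_mul_gaussianReal t, fun t => by
      rw [mgf_id_gaussianReal]; simp⟩
  simpa using this.of_map hX.aemeasurable

/-- The two-sided sub-Gaussian tail bound, in a form that remains true for variance zero. -/
theorem measure_abs_gt_le {Ω : Type*} [MeasurableSpace Ω] {μ : Measure Ω}
    [IsProbabilityMeasure μ] {X : Ω → ℝ} {c : ℝ≥0} (h : HasSubgaussianMGF X c μ) {u : ℝ}
    (hu : 0 ≤ u) :
    μ {ω | ¬ |X ω| ≤ u * Real.sqrt c} ≤ ENNReal.ofReal (2 * Real.exp (-(u ^ 2 / 2))) := by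
  rcases eq_or_ne c 0 with rfl | hc
  · have h0 := h.ae_eq_zero_of_hasSubgaussianMGF_zero
    have : μ {ω | ¬ |X ω| ≤ u * Real.sqrt (0 : ℝ≥0)} = 0 := by
      have h1 : ∀ᵐ ω ∂μ, |X ω| ≤ u * Real.sqrt (0 : ℝ≥0) := by
        filter_upwards [h0] with ω hω
        simp [hω]
      exact h1
    rw [this]
    exact zero_le
  · have hc0 : (0 : ℝ) < c := by exact_mod_cast pos_iff_ne_zero.2 hc
    have hexp : -(u * Real.sqrt c) ^ 2 / (2 * c) = -(u ^ 2 / 2) := by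
      rw [mul_pow, Real.sq_sqrt hc0.le]
      field_simp
    have h1 := h.measure_ge_le (ε := u * Real.sqrt c) (by positivity)
    have h2 := h.neg.measure_ge_le (ε := u * Real.sqrt c) (by positivity)
    rw [hexp] at h1 h2
    have hsub : {ω | ¬ |X ω| ≤ u * Real.sqrt c}
        ⊆ {ω | u * Real.sqrt c ≤ X ω} ∪ {ω | u * Real.sqrt c ≤ (-X) ω} := by
      intro ω hω
      simp only [Set.mem_ofPred_eq, not_le, lt_abs] at hω
      exact hω.imp le_of_lt le_of_lt
    rw [← ofReal_measureReal]
    refine ENNReal.ofReal_le_ofReal ?_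
    calc μ.real {ω | ¬ |X ω| ≤ u * Real.sqrt c} ≤ _ := measureReal_mono hsub
      _ ≤ _ := measureReal_union_le _ _
      _ ≤ 2 * Real.exp (-(u ^ 2 / 2)) := by linarith

theorem hasSubgaussianMGF_isotropicGaussian (σ : ℝ) (u : Vec d) :
    HasSubgaussianMGF (fun x => inner ℝ x u) (σ ^ 2 * ‖u‖ ^ 2).toNNReal
      (isotropicGaussian d σ) :=
  hasSubgaussianMGF_of_map_eq_gaussianReal (by fun_prop) (isotropicGaussian_map_inner σ u)

theorem isotropicGaussian_abs_inner_gt_le {σ : ℝ} (hσ : 0 ≤ σ) (w : Vec d) {u : ℝ}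
    (hu : 0 ≤ u) :
    isotropicGaussian d σ {x | ¬ |inner ℝ x w| ≤ u * σ * ‖w‖}
      ≤ ENNReal.ofReal (2 * Real.exp (-(u ^ 2 / 2))) := by
  have h := measure_abs_gt_le (hasSubgaussianMGF_isotropicGaussian σ w) hu
  rwa [Real.coe_toNNReal _ (by positivity), ← mul_pow, Real.sqrt_sq (by positivity),
    ← mul_assoc] at h

/-- The tail bound for a sum of `t` independent Gaussian vectors in a fixed direction. -/
theorem infinitePi_abs_inner_sum_gt_le {σ : ℝ} (hσ : 0 ≤ σ) (w : Vec d) {u : ℝ} (hu : 0 ≤ u)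
    (t : ℕ) :
    (Measure.infinitePi fun _ : ℕ => isotropicGaussian d σ)
        {z : ℕ → Vec d | ¬ |inner ℝ (∑ s ∈ Finset.Icc 1 t, z s) w| ≤ u * σ * Real.sqrt t * ‖w‖}
      ≤ ENNReal.ofReal (2 * Real.exp (-(u ^ 2 / 2))) := by
  have hind : iIndepFun (fun (s : ℕ) (z : ℕ → Vec d) => inner ℝ (z s) w)
      (Measure.infinitePi fun _ : ℕ => isotropicGaussian d σ) :=
    iIndepFun_infinitePi (X := fun _ x => inner ℝ x w) (fun _ => by fun_prop)
  have hsub : ∀ s ∈ Finset.Icc 1 t, HasSubgaussianMGF (fun z : ℕ → Vec d => inner ℝ (z s) w)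
      (σ ^ 2 * ‖w‖ ^ 2).toNNReal (Measure.infinitePi fun _ : ℕ => isotropicGaussian d σ) := by
    intro s _
    refine HasSubgaussianMGF.of_map (X := fun x : Vec d => inner ℝ x w)
      (Y := fun z : ℕ → Vec d => z s)
      (measurable_pi_apply s).aemeasurable ?_
    rw [Measure.infinitePi_map_eval]
    exact hasSubgaussianMGF_isotropicGaussian σ w
  have h := measure_abs_gt_le (HasSubgaussianMGF.sum_of_iIndepFun hind hsub) hu
  have hc : ((∑ _s ∈ Finset.Icc 1 t, (σ ^ 2 * ‖w‖ ^ 2).toNNReal : ℝ≥0) : ℝ)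
      = t * (σ * ‖w‖) ^ 2 := by
    simp [mul_pow, Real.coe_toNNReal _ (show 0 ≤ σ ^ 2 * ‖w‖ ^ 2 by positivity)]
  rw [hc, Real.sqrt_mul (by positivity), Real.sqrt_sq (by positivity)] at h
  refine le_trans (le_of_eq ?_) h
  congr 1
  ext z
  simp only [Set.mem_ofPred_eq, sum_inner]
  rw [show u * σ * Real.sqrt t * ‖w‖ = u * (Real.sqrt t * (σ * ‖w‖)) by ring]

/-- A standard Gaussian falls into `[1/2, 1]` with probability at least `1/10`, because its density
is at least `1/5` there. -/
theorem gaussianReal_Iio_half_le :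
    gaussianReal 0 1 (Set.Iio (1 / 2)) ≤ ENNReal.ofReal (9 / 10) := by
  have hlow : ENNReal.ofReal (1 / 10) ≤ gaussianReal 0 1 (Set.Icc (1 / 2) 1) := by
    rw [gaussianReal_apply 0 one_ne_zero]
    have hpt : ∀ x ∈ Set.Icc (1 / 2 : ℝ) 1, ENNReal.ofReal (1 / 5) ≤ gaussianPDF 0 1 x := by
      intro x hx
      rw [gaussianPDF]
      refine ENNReal.ofReal_le_ofReal ?_
      rw [gaussianPDFReal]
      have h1 : Real.sqrt (2 * Real.pi * (1 : ℝ≥0)) ≤ 2.6 := by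
        rw [Real.sqrt_le_left (by norm_num)]
        have := Real.pi_lt_d2
        norm_num
        linarith
      have h2 : (6 : ℝ) / 10 ≤ Real.exp (-(x - 0) ^ 2 / (2 * (1 : ℝ≥0))) := by
        have h3 : Real.exp (-(1 / 2)) ≤ Real.exp (-(x - 0) ^ 2 / (2 * (1 : ℝ≥0))) := by
          rw [Real.exp_le_exp]
          simp only [sub_zero, NNReal.coe_one, mul_one]
          nlinarith [hx.1, hx.2]
        refine le_trans ?_ h3
        rw [Real.exp_neg, le_inv_comm₀ (by norm_num) (Real.exp_pos _)]
        have h4 : Real.exp (1 / 2) ^ 2 ≤ (5 / 3) ^ 2 := by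
          rw [← Real.exp_nat_mul]
          norm_num
          linarith [Real.exp_one_lt_d9]
        have := le_of_sq_le_sq h4 (by norm_num)
        linarith
      have h5 : (2.6 : ℝ)⁻¹ ≤ (Real.sqrt (2 * Real.pi * (1 : ℝ≥0)))⁻¹ :=
        inv_anti₀ (Real.sqrt_pos.2 (by have := Real.pi_pos; simp; linarith)) h1
      calc (1 : ℝ) / 5 ≤ (2.6 : ℝ)⁻¹ * (6 / 10) := by norm_num
        _ ≤ _ := by gcongr
    calc ENNReal.ofReal (1 / 10) = ENNReal.ofReal (1 / 5) * volume (Set.Icc (1 / 2 : ℝ) 1) := by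
          rw [Real.volume_Icc, ← ENNReal.ofReal_mul (by norm_num)]
          norm_num
      _ = ∫⁻ _ in Set.Icc (1 / 2 : ℝ) 1, ENNReal.ofReal (1 / 5) := by
          rw [setLIntegral_const]
      _ ≤ _ := setLIntegral_mono (by fun_prop) hpt
  have hdisj : Disjoint (Set.Iio (1 / 2 : ℝ)) (Set.Icc (1 / 2) 1) := by
    rw [Set.disjoint_left]
    intro x h1 h2
    exact absurd h2.1 (not_le.2 h1)
  have hun := measure_union (μ := gaussianReal 0 1) hdisj measurableSet_Icc
  have h1 : gaussianReal 0 1 (Set.Iio (1 / 2)) + ENNReal.ofReal (1 / 10) ≤ 1 := by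
    calc _ ≤ gaussianReal 0 1 (Set.Iio (1 / 2)) + gaussianReal 0 1 (Set.Icc (1 / 2) 1) := by
          gcongr
      _ = _ := hun.symm
      _ ≤ 1 := prob_le_one
  have h2 := ENNReal.le_sub_of_add_le_right ENNReal.ofReal_ne_top h1
  refine h2.trans (le_of_eq ?_)
  rw [← ENNReal.ofReal_one, ← ENNReal.ofReal_sub _ (by norm_num)]
  norm_num

/-- A Gaussian filter exceeds half a standard deviation in a given direction with probability
bounded below. -/
theorem isotropicGaussian_inner_lt_le {σ : ℝ} (hσ : 0 < σ) {w : Vec d} (hw : w ≠ 0) (j : Bool) :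
    isotropicGaussian d σ {x | sgn j * inner ℝ x w < σ * ‖w‖ / 2}
      ≤ ENNReal.ofReal (9 / 10) := by
  have hw' : 0 < ‖w‖ := norm_pos_iff.2 hw
  set w' : Vec d := (sgn j / (σ * ‖w‖)) • w with hw'def
  have hnorm : σ ^ 2 * ‖w'‖ ^ 2 = 1 := by
    rw [hw'def, norm_smul, mul_pow, Real.norm_eq_abs, sq_abs, div_pow, sgn_sq]
    field_simp
  have hmap := isotropicGaussian_map_inner σ w'
  rw [hnorm, Real.toNNReal_one] at hmap
  refine le_trans (le_of_eq ?_) gaussianReal_Iio_half_le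
  rw [← hmap, Measure.map_apply (by fun_prop) measurableSet_Iio]
  congr 1
  ext x
  simp only [Set.mem_ofPred_eq, Set.mem_preimage, Set.mem_Iio, hw'def, inner_smul_right]
  rw [div_mul_eq_mul_div, div_lt_iff₀ (by positivity)]
  constructor <;> intro h <;> linarith

end Gaussian

/-! ### Almost sure properties of the data -/

section Data

variable {n d : ℕ}

instance (v : Vec d) (σξ : ℝ) : IsProbabilityMeasure (labelNoiseLaw v σξ) := by
  unfold labelNoiseLaw; infer_instance

theorem labelNoiseLaw_map_inner (v : Vec d) (σξ : ℝ) (u : Vec d) :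
    (labelNoiseLaw v σξ).map (fun x => inner ℝ x.2 u)
      = gaussianReal 0 (σξ ^ 2 * (‖u‖ ^ 2 - (‖v‖ ^ 2)⁻¹ * (inner ℝ u v) ^ 2)).toNNReal := by
  rw [← dataNoise_map_inner, labelNoiseLaw,
    show (fun x : Bool × Vec d => inner ℝ x.2 u) = (fun x => inner ℝ x u) ∘ Prod.snd from rfl,
    ← Measure.map_map (by fun_prop) measurable_snd, Measure.map_snd_prod, measure_univ, one_smul]

/-- In the direction `v` the noise patch has variance zero. -/
theorem labelNoiseLaw_orthogonal {v : Vec d} (hv : v ≠ 0) (σξ : ℝ) :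
    ∀ᵐ x ∂labelNoiseLaw v σξ, inner ℝ v x.2 = 0 := by
  have h := labelNoiseLaw_map_inner v σξ v
  have hv2 : ‖v‖ ^ 2 ≠ 0 := by simpa using hv
  rw [real_inner_self_eq_norm_sq, sq (‖v‖ ^ 2), inv_mul_cancel_left₀ hv2, sub_self, mul_zero,
    Real.toNNReal_zero] at h
  have h0 := (hasSubgaussianMGF_of_map_eq_gaussianReal
    (by fun_prop) h).ae_eq_zero_of_hasSubgaussianMGF_zero
  filter_upwards [h0] with x hx
  rw [real_inner_comm]
  exact hx

/-- The law of a noise patch does not charge a hyperplane whose normal vector lies in `v^⊥`. -/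
theorem labelNoiseLaw_inner_eq_zero {v : Vec d} {σξ : ℝ} (hσξ : 0 < σξ) {u : Vec d}
    (hu : u ≠ 0) (huv : inner ℝ u v = 0) :
    labelNoiseLaw v σξ {x | inner ℝ x.2 u = 0} = 0 := by
  have h := labelNoiseLaw_map_inner v σξ u
  have hu' : 0 < ‖u‖ := norm_pos_iff.2 hu
  rw [huv] at h
  have hvar : (σξ ^ 2 * (‖u‖ ^ 2 - (‖v‖ ^ 2)⁻¹ * 0 ^ 2)).toNNReal ≠ 0 := by
    rw [ne_eq, Real.toNNReal_eq_zero, not_le]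
    simp only [ne_eq, OfNat.ofNat_ne_zero, not_false_eq_true, zero_pow, mul_zero, sub_zero]
    positivity
  have hna := nullSingletonClass_gaussianReal (μ := 0) hvar
  have : labelNoiseLaw v σξ {x | inner ℝ x.2 u = 0}
      = (labelNoiseLaw v σξ).map (fun x => inner ℝ x.2 u) {0} := by
    rw [Measure.map_apply (by fun_prop) (measurableSet_singleton 0)]
    rfl
  rw [this, h]
  exact measure_singleton 0

/-- Fewer than `d` independent Gaussian vectors in `v^⊥` are almost surely linearly independent:
given all the others, a vector avoids every hyperplane other than `v^⊥`. -/
theorem ae_linearIndependent {v : Vec d} {σξ : ℝ} (hσξ : 0 < σξ) :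
    ∀ k : ℕ, k < d → ∀ᵐ x ∂(Measure.pi fun _ : Fin k => labelNoiseLaw v σξ),
      LinearIndependent ℝ (fun i => (x i).2)
  | 0, _ => Filter.Eventually.of_forall fun _ => linearIndependent_empty_type
  | k + 1, hk => by
    have ih := ae_linearIndependent (v := v) hσξ k (by omega)
    have hopen : MeasurableSet {f : Fin (k + 1) → Vec d | LinearIndependent ℝ f} :=
      isOpen_setOfPred_linearIndependent.measurableSet
    have hmeas : MeasurableSet
        {x : Fin (k + 1) → Bool × Vec d | ¬ LinearIndependent ℝ (fun i => (x i).2)} :=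
      (hopen.preimage (f := fun (x : Fin (k + 1) → Bool × Vec d) i => (x i).2)
        (by fun_prop)).compl
    have hmp := (measurePreserving_piFinSuccAbove
      (fun _ : Fin (k + 1) => labelNoiseLaw v σξ) 0).symm
    rw [ae_iff, ← hmp.measure_preimage hmeas.nullMeasurableSet,
      Measure.prod_apply_symm (hmp.measurable hmeas)]
    refine (lintegral_congr_ae ?_).trans lintegral_zero
    filter_upwards [ih] with t ht
    -- `v` and the other patches do not span, so some `u ≠ 0` is orthogonal to all of them; if the
    -- new patch is not orthogonal to `u`, it is outside the span of the others.
    have hspan : Submodule.span ℝ (Set.range (Fin.cons v fun i => (t i).2 : Fin (k + 1) → Vec d))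
        ≠ ⊤ := by
      intro htop
      have h1 := finrank_range_le_card (R := ℝ)
        (Fin.cons v fun i => (t i).2 : Fin (k + 1) → Vec d)
      rw [Set.finrank, htop, finrank_top] at h1
      simp at h1
      omega
    obtain ⟨u, hu, hu0⟩ := Submodule.exists_mem_ne_zero_of_ne_bot
      (fun h => hspan ((Submodule.orthogonal_eq_bot_iff).1 h))
    have huperp : ∀ i, inner ℝ ((Fin.cons v fun i => (t i).2 : Fin (k + 1) → Vec d) i) u = 0 :=
      fun i => (Submodule.mem_orthogonal _ u).1 hu _ (Submodule.subset_span ⟨i, rfl⟩)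
    refine measure_mono_null ?_ (labelNoiseLaw_inner_eq_zero hσξ hu0
      (by rw [real_inner_comm]; exact huperp 0))
    intro x hx
    by_contra hne
    apply hx
    have hcons : (fun i => (((MeasurableEquiv.piFinSuccAbove
        (fun _ : Fin (k + 1) => Bool × Vec d) 0).symm (x, t)) i).2)
        = (Fin.cons x.2 fun i => (t i).2 : Fin (k + 1) → Vec d) := by
      funext i
      refine Fin.cases ?_ (fun i => ?_) i <;>
        simp [MeasurableEquiv.piFinSuccAbove_symm_apply, Fin.insertNthEquiv]
    rw [hcons, linearIndependent_finCons]
    refine ⟨ht, fun hmem => hne ?_⟩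
    have hle : Submodule.span ℝ (Set.range fun i => (t i).2) ≤ (Submodule.span ℝ {u})ᗮ := by
      rw [Submodule.span_le]
      rintro _ ⟨i, rfl⟩
      rw [SetLike.mem_coe, Submodule.mem_orthogonal_singleton_iff_inner_left]
      exact huperp i.succ
    exact Submodule.mem_orthogonal_singleton_iff_inner_left.1 (hle hmem)

theorem hasSubgaussianMGF_sgn_label (v : Vec d) (σξ : ℝ) :
    HasSubgaussianMGF (fun x : Bool × Vec d => sgn x.1) 1 (labelNoiseLaw v σξ) := by
  have hmeas : Measurable (fun x : Bool × Vec d => sgn x.1) :=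
    (measurable_from_top (f := sgn)).comp measurable_fst
  have hint : ∫ x, sgn x.1 ∂(labelNoiseLaw v σξ) = 0 := by
    rw [labelNoiseLaw, integral_fun_fst, PMF.integral_eq_sum]
    simp [sgn]
  have h := hasSubgaussianMGF_of_mem_Icc_of_integral_eq_zero (a := -1) (b := 1)
    hmeas.aemeasurable (Filter.Eventually.of_forall fun x => by
      cases x.1 <;> simp [sgn]) hint
  convert h using 1
  ext
  norm_num

theorem balanced_of_abs_sum_le {y : Fin n → Bool} (h : |∑ i, sgn (y i)| ≤ (n : ℝ) / 2)
    (j : Bool) : (n : ℝ) / 4 ≤ (Finset.univ.filter fun i => y i = j).card := by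
  have h1 : ∑ i, sgn (y i) = (Finset.univ.filter fun i => y i = true).card
      - (Finset.univ.filter fun i => y i = false).card := by
    rw [Finset.card_filter, Finset.card_filter]
    push_cast
    rw [← Finset.sum_sub_distrib]
    refine Finset.sum_congr rfl fun i _ => ?_
    cases y i <;> simp [sgn]
  have h2 : ((Finset.univ.filter fun i => y i = true).card : ℝ)
      + (Finset.univ.filter fun i => y i = false).card = n := by
    rw [Finset.card_filter, Finset.card_filter]
    push_cast
    rw [← Finset.sum_add_distrib]
    rw [Finset.sum_congr rfl (g := fun _ => (1 : ℝ)) fun i _ => by cases y i <;> simp]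
    simp
  rw [h1, abs_le] at h
  cases j <;> linarith

theorem measure_not_balanced_le (v : Vec d) (σξ : ℝ) :
    (Measure.pi fun _ : Fin n => labelNoiseLaw v σξ)
        {x : Fin n → Bool × Vec d |
          ¬ ∀ j, (n : ℝ) / 4 ≤ (Finset.univ.filter fun i => (x i).1 = j).card}
      ≤ ENNReal.ofReal (2 * Real.exp (-(n / 8))) := by
  have hmeas : Measurable (fun x : Bool × Vec d => sgn x.1) :=
    (measurable_from_top (f := sgn)).comp measurable_fst
  have hind : iIndepFun (fun (i : Fin n) (x : Fin n → Bool × Vec d) => sgn (x i).1)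
      (Measure.pi fun _ : Fin n => labelNoiseLaw v σξ) :=
    iIndepFun_pi (X := fun _ (x : Bool × Vec d) => sgn x.1) fun _ => hmeas.aemeasurable
  have hsub : ∀ i ∈ (Finset.univ : Finset (Fin n)),
      HasSubgaussianMGF (fun x : Fin n → Bool × Vec d => sgn (x i).1) 1
        (Measure.pi fun _ : Fin n => labelNoiseLaw v σξ) := by
    intro i _
    refine HasSubgaussianMGF.of_map (X := fun x : Bool × Vec d => sgn x.1)
      (Y := fun x : Fin n → Bool × Vec d => x i)
      (measurable_pi_apply i).aemeasurable ?_
    rw [(measurePreserving_eval (fun _ : Fin n => labelNoiseLaw v σξ) i).map_eq]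
    exact hasSubgaussianMGF_sgn_label v σξ
  have h := measure_abs_gt_le (HasSubgaussianMGF.sum_of_iIndepFun hind hsub)
    (u := Real.sqrt n / 2) (by positivity)
  have hc : ((∑ _i : Fin n, 1 : ℝ≥0) : ℝ) = n := by simp
  have hn : Real.sqrt n / 2 * Real.sqrt n = n / 2 := by
    rw [div_mul_eq_mul_div, Real.mul_self_sqrt (Nat.cast_nonneg n)]
  have hn2 : (Real.sqrt n / 2) ^ 2 / 2 = n / 8 := by
    rw [div_pow, Real.sq_sqrt (Nat.cast_nonneg n)]; ring
  rw [hc, hn, hn2] at h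
  refine (measure_mono ?_).trans h
  intro x hx hle
  exact hx fun j => balanced_of_abs_sum_le (y := fun i => (x i).1) hle j

end Data

open scoped ENNReal NNReal

/-! ### The probability of a typical outcome -/

section Probability

theorem measure_exists_le {Ω ι : Type*} [MeasurableSpace Ω] [Fintype ι] (μ : Measure Ω)
    {P : ι → Ω → Prop} {c : ℝ≥0∞} (h : ∀ i, μ {ω | P i ω} ≤ c) :
    μ {ω | ∃ i, P i ω} ≤ Fintype.card ι * c := by
  have : {ω | ∃ i, P i ω} = ⋃ i, {ω | P i ω} := by ext; simp
  rw [this]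
  refine (measure_iUnion_fintype_le μ _).trans ?_
  refine (Finset.sum_le_sum fun i _ => h i).trans ?_
  simp

theorem measurableSet_not_le {α : Type*} [MeasurableSpace α] {f g : α → ℝ} (hf : Measurable f)
    (hg : Measurable g) : MeasurableSet {a | ¬ f a ≤ g a} :=
  (measurableSet_le hf hg).compl

theorem measure_prod_le_of_forall {α β : Type*} [MeasurableSpace α] [MeasurableSpace β]
    (μ : Measure α) [IsProbabilityMeasure μ] (ν : Measure β) [SFinite ν] {s : Set (α × β)}
    (hs : MeasurableSet s) {c : ℝ≥0∞} (h : ∀ a, ν {b | (a, b) ∈ s} ≤ c) : μ.prod ν s ≤ c := by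
  rw [Measure.prod_apply hs]
  calc ∫⁻ a, ν (Prod.mk a ⁻¹' s) ∂μ ≤ ∫⁻ _, c ∂μ := lintegral_mono h
    _ = c := by simp

variable {n m d : ℕ} {v : Vec d} {σξ σ₀ σz : ℝ}

theorem outcomeLaw_data (S : Set (Fin n → Bool × Vec d)) :
    outcomeLaw n m v σξ σ₀ σz {ω | ω.1 ∈ S} = (Measure.pi fun _ => labelNoiseLaw v σξ) S := by
  have : {ω : Outcome n m d | ω.1 ∈ S} = S ×ˢ Set.univ := by ext; simp
  rw [outcomeLaw, this, Measure.prod_prod, measure_univ, mul_one]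

theorem outcomeLaw_init (S : Set (Filters m d)) :
    outcomeLaw n m v σξ σ₀ σz {ω | ω.2.1 ∈ S}
      = (Measure.pi fun _ : Bool => Measure.pi fun _ : Fin m => isotropicGaussian d σ₀) S := by
  have : {ω : Outcome n m d | ω.2.1 ∈ S} = Set.univ ×ˢ (S ×ˢ Set.univ) := by ext; simp
  rw [outcomeLaw, this, Measure.prod_prod, Measure.prod_prod, measure_univ, measure_univ, mul_one,
    one_mul]

theorem outcomeLaw_noise (S : Set (ℕ → Vec d)) :
    outcomeLaw n m v σξ σ₀ σz {ω | ω.2.2 ∈ S}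
      = (Measure.infinitePi fun _ : ℕ => isotropicGaussian d σz) S := by
  have : {ω : Outcome n m d | ω.2.2 ∈ S} = Set.univ ×ˢ (Set.univ ×ˢ S) := by ext; simp
  rw [outcomeLaw, this, Measure.prod_prod, Measure.prod_prod, measure_univ, measure_univ, one_mul,
    one_mul]

theorem measure_pi_eval {α : Type*} [MeasurableSpace α] {ι : Type*} [Fintype ι] (ρ : Measure α)
    [IsProbabilityMeasure ρ] {S : Set α} (hS : MeasurableSet S) (i : ι) :
    (Measure.pi fun _ : ι => ρ) {x | x i ∈ S} = ρ S :=
  (measurePreserving_eval (fun _ : ι => ρ) i).measure_preimage hS.nullMeasurableSet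

theorem measure_init_eval {S : Set (Vec d)} (hS : MeasurableSet S) (j : Bool) (r : Fin m) :
    (Measure.pi fun _ : Bool => Measure.pi fun _ : Fin m => isotropicGaussian d σ₀)
      {W | W j r ∈ S} = isotropicGaussian d σ₀ S := by
  have h1 := measure_pi_eval (Measure.pi fun _ : Fin m => isotropicGaussian d σ₀)
    (S := {w | w r ∈ S}) (hS.preimage (measurable_pi_apply r)) j
  have h2 := measure_pi_eval (isotropicGaussian d σ₀) hS r
  exact h1.trans h2

theorem measure_not_orthogonal (hv : v ≠ 0) :
    outcomeLaw n m v σξ σ₀ σz {ω | ¬ ∀ i, inner ℝ v (noisePatches ω i) = 0} = 0 := by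
  have hmeas : MeasurableSet {x : Bool × Vec d | ¬ inner ℝ v x.2 = 0} :=
    ((measurableSet_singleton (0 : ℝ)).preimage
      (show Measurable fun x : Bool × Vec d => inner ℝ v x.2 by fun_prop)).compl
  have h1 : ∀ i : Fin n, (Measure.pi fun _ : Fin n => labelNoiseLaw v σξ)
      {x | ¬ inner ℝ v (x i).2 = 0} ≤ 0 := by
    intro i
    have h2 := measure_pi_eval (labelNoiseLaw v σξ) hmeas i
    refine le_of_eq (h2.trans ?_)
    exact labelNoiseLaw_orthogonal hv σξ
  have h3 := measure_exists_le _ h1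
  rw [mul_zero, nonpos_iff_eq_zero] at h3
  have h4 := outcomeLaw_data (m := m) (v := v) (σξ := σξ) (σ₀ := σ₀) (σz := σz)
    {x : Fin n → Bool × Vec d | ∃ i, ¬ inner ℝ v (x i).2 = 0}
  rw [h3] at h4
  refine Eq.trans (congrArg _ ?_) h4
  ext ω
  simp [noisePatches]

theorem measure_not_independent (hσξ : 0 < σξ) (hnd : n < d) :
    outcomeLaw n m v σξ σ₀ σz {ω | ¬ LinearIndependent ℝ (noisePatches ω)} = 0 :=
  (outcomeLaw_data {x : Fin n → Bool × Vec d | ¬ LinearIndependent ℝ (fun i => (x i).2)}).trans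
    (ae_linearIndependent hσξ n hnd)

theorem norm_le_of_abs_apply_le {x : Vec d} {c : ℝ} (hc : 0 ≤ c) (h : ∀ k, |x k| ≤ c) :
    ‖x‖ ≤ c * Real.sqrt d := by
  rw [EuclideanSpace.norm_eq]
  have h1 : ∑ k, ‖x k‖ ^ 2 ≤ c ^ 2 * d := by
    calc ∑ k, ‖x k‖ ^ 2 ≤ ∑ _k : Fin d, c ^ 2 := by
          gcongr with k
          exact h k
      _ = c ^ 2 * d := by simp [mul_comm]
  calc Real.sqrt (∑ k, ‖x k‖ ^ 2) ≤ Real.sqrt (c ^ 2 * d) := Real.sqrt_le_sqrt h1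
    _ = c * Real.sqrt d := by rw [Real.sqrt_mul (by positivity), Real.sqrt_sq hc]

theorem labelNoiseLaw_abs_apply_gt_le (hσξ : 0 ≤ σξ) {u : ℝ} (hu : 0 ≤ u) (k : Fin d) :
    labelNoiseLaw v σξ {x | ¬ |x.2 k| ≤ u * σξ}
      ≤ ENNReal.ofReal (2 * Real.exp (-(u ^ 2 / 2))) := by
  have h := measure_abs_gt_le (hasSubgaussianMGF_of_map_eq_gaussianReal (by fun_prop)
    (labelNoiseLaw_map_inner v σξ (EuclideanSpace.single k 1))) hu
  refine (measure_mono ?_).trans h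
  intro x hx hle
  apply hx
  have h1 : inner ℝ x.2 (EuclideanSpace.single k (1 : ℝ)) = x.2 k := by
    rw [EuclideanSpace.inner_single_right]; simp
  rw [h1] at hle
  refine hle.trans ?_
  gcongr
  rw [Real.sqrt_le_left hσξ, Real.coe_toNNReal']
  refine max_le ?_ (sq_nonneg _)
  have h2 : ‖(EuclideanSpace.single k (1 : ℝ) : Vec d)‖ = 1 := by simp
  rw [h2]
  refine mul_le_of_le_one_right (sq_nonneg _) ?_
  have : 0 ≤ (‖v‖ ^ 2)⁻¹ * (inner ℝ (EuclideanSpace.single k (1 : ℝ) : Vec d) v) ^ 2 := by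
    positivity
  linarith

/-- Each coordinate of a noise patch is sub-Gaussian; the union bound over the `d` coordinates loses
only the deviation factor. -/
theorem measure_patch_norm_le (hσξ : 0 ≤ σξ) {u : ℝ} (hu : 0 ≤ u) :
    outcomeLaw n m v σξ σ₀ σz {ω | ¬ ∀ i, ‖noisePatches ω i‖ ≤ u * noiseNorm d σξ}
      ≤ n * (d * ENNReal.ofReal (2 * Real.exp (-(u ^ 2 / 2)))) := by
  have h1 : ∀ (i : Fin n), (Measure.pi fun _ : Fin n => labelNoiseLaw v σξ)
      {x | ∃ k, ¬ |(x i).2 k| ≤ u * σξ}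
        ≤ d * ENNReal.ofReal (2 * Real.exp (-(u ^ 2 / 2))) := by
    intro i
    have hk : ∀ k, (Measure.pi fun _ : Fin n => labelNoiseLaw v σξ)
        {x | ¬ |(x i).2 k| ≤ u * σξ} ≤ ENNReal.ofReal (2 * Real.exp (-(u ^ 2 / 2))) := by
      intro k
      have hmeas : MeasurableSet {x : Bool × Vec d | ¬ |x.2 k| ≤ u * σξ} :=
        measurableSet_not_le (by fun_prop) (by fun_prop)
      exact (measure_pi_eval (labelNoiseLaw v σξ) hmeas i).trans_le
        (labelNoiseLaw_abs_apply_gt_le hσξ hu k)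
    simpa using measure_exists_le _ hk
  have h2 := measure_exists_le _ h1
  rw [Fintype.card_fin, ← outcomeLaw_data (m := m) (σ₀ := σ₀) (σz := σz)] at h2
  refine (measure_mono ?_).trans h2
  intro ω hω
  by_contra hcon
  apply hω
  intro i
  have hcon' : ¬ ∃ i k, ¬ |(ω.1 i).2 k| ≤ u * σξ := hcon
  push Not at hcon'
  have := norm_le_of_abs_apply_le (x := (ω.1 i).2) (by positivity) (hcon' i)
  rw [noiseNorm, ← mul_assoc]
  exact this

theorem measure_init_signal_le (hσ₀ : 0 ≤ σ₀) {u : ℝ} (hu : 0 ≤ u) :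
    outcomeLaw n m v σξ σ₀ σz
        {ω | ¬ ∀ j r, |inner ℝ (initFilters ω j r) v| ≤ u * σ₀ * ‖v‖}
      ≤ 2 * (m * ENNReal.ofReal (2 * Real.exp (-(u ^ 2 / 2)))) := by
  have h1 : ∀ (j : Bool), (Measure.pi fun _ : Bool => Measure.pi fun _ : Fin m =>
      isotropicGaussian d σ₀) {W | ∃ r, ¬ |inner ℝ (W j r) v| ≤ u * σ₀ * ‖v‖}
        ≤ m * ENNReal.ofReal (2 * Real.exp (-(u ^ 2 / 2))) := by
    intro j
    have hr : ∀ r, (Measure.pi fun _ : Bool => Measure.pi fun _ : Fin m =>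
        isotropicGaussian d σ₀) {W | ¬ |inner ℝ (W j r) v| ≤ u * σ₀ * ‖v‖}
        ≤ ENNReal.ofReal (2 * Real.exp (-(u ^ 2 / 2))) := by
      intro r
      have hmeas : MeasurableSet {x : Vec d | ¬ |inner ℝ x v| ≤ u * σ₀ * ‖v‖} :=
        measurableSet_not_le (by fun_prop) (by fun_prop)
      exact (measure_init_eval hmeas j r).trans_le (isotropicGaussian_abs_inner_gt_le hσ₀ v hu)
    simpa using measure_exists_le _ hr
  have h2 := measure_exists_le _ h1
  rw [Fintype.card_bool, ← outcomeLaw_init (n := n) (v := v) (σξ := σξ) (σz := σz)] at h2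
  refine (measure_mono ?_).trans h2
  intro ω hω
  have hω' : ¬ ∀ j r, |inner ℝ (ω.2.1 j r) v| ≤ u * σ₀ * ‖v‖ := hω
  push Not at hω'
  obtain ⟨j, r, h⟩ := hω'
  exact ⟨j, r, not_le.2 h⟩

/-- The initialization is independent of the data, so the Gaussian tail bound applies conditionally
on the noise patches. -/
theorem measure_init_noise_le (hσ₀ : 0 ≤ σ₀) {u : ℝ} (hu : 0 ≤ u) :
    outcomeLaw n m v σξ σ₀ σz
        {ω | ¬ ∀ j r i, |inner ℝ (initFilters ω j r) (noisePatches ω i)|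
          ≤ u * σ₀ * ‖noisePatches ω i‖}
      ≤ 2 * (m * (n * ENNReal.ofReal (2 * Real.exp (-(u ^ 2 / 2))))) := by
  have h0 : ∀ j r i, outcomeLaw n m v σξ σ₀ σz
      {ω | ¬ |inner ℝ (ω.2.1 j r) (ω.1 i).2| ≤ u * σ₀ * ‖(ω.1 i).2‖}
        ≤ ENNReal.ofReal (2 * Real.exp (-(u ^ 2 / 2))) := by
    intro j r i
    have hS : MeasurableSet {ω : Outcome n m d |
        ¬ |inner ℝ (ω.2.1 j r) (ω.1 i).2| ≤ u * σ₀ * ‖(ω.1 i).2‖} :=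
      measurableSet_not_le (by fun_prop) (by fun_prop)
    refine measure_prod_le_of_forall _ _ hS fun x => ?_
    have hmeas : MeasurableSet {w : Vec d | ¬ |inner ℝ w (x i).2| ≤ u * σ₀ * ‖(x i).2‖} :=
      measurableSet_not_le (by fun_prop) (by fun_prop)
    have h1 := (measure_init_eval hmeas j r).trans_le
      (isotropicGaussian_abs_inner_gt_le hσ₀ (x i).2 hu)
    refine le_trans (le_of_eq ?_) h1
    have : {b : Filters m d × (ℕ → Vec d) | (x, b) ∈
        {ω : Outcome n m d | ¬ |inner ℝ (ω.2.1 j r) (ω.1 i).2| ≤ u * σ₀ * ‖(ω.1 i).2‖}}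
        = {W : Filters m d | W j r ∈ {w : Vec d | ¬ |inner ℝ w (x i).2| ≤ u * σ₀ * ‖(x i).2‖}}
          ×ˢ Set.univ := by
      ext; simp
    erw [this]
    rw [Measure.prod_prod, measure_univ, mul_one]
  have h1 : ∀ j r, outcomeLaw n m v σξ σ₀ σz
      {ω | ∃ i, ¬ |inner ℝ (ω.2.1 j r) (ω.1 i).2| ≤ u * σ₀ * ‖(ω.1 i).2‖}
        ≤ n * ENNReal.ofReal (2 * Real.exp (-(u ^ 2 / 2))) := fun j r => by
    simpa using measure_exists_le _ (h0 j r)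
  have h2 : ∀ j, outcomeLaw n m v σξ σ₀ σz
      {ω | ∃ r i, ¬ |inner ℝ (ω.2.1 j r) (ω.1 i).2| ≤ u * σ₀ * ‖(ω.1 i).2‖}
        ≤ m * (n * ENNReal.ofReal (2 * Real.exp (-(u ^ 2 / 2)))) := fun j => by
    simpa only [Fintype.card_fin] using measure_exists_le _ (h1 j)
  have h3 := measure_exists_le _ h2
  simp only [← not_forall] at h3
  exact h3

theorem measure_init_large_le (hσ₀ : 0 < σ₀) (hv : v ≠ 0) :
    outcomeLaw n m v σξ σ₀ σz
        {ω | ¬ ∀ j, ∃ r, σ₀ * ‖v‖ / 2 ≤ sgn j * inner ℝ (initFilters ω j r) v}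
      ≤ 2 * ENNReal.ofReal (9 / 10) ^ m := by
  have h1 : ∀ (j : Bool), (Measure.pi fun _ : Bool => Measure.pi fun _ : Fin m =>
      isotropicGaussian d σ₀) {W | ∀ r, sgn j * inner ℝ (W j r) v < σ₀ * ‖v‖ / 2}
        ≤ ENNReal.ofReal (9 / 10) ^ m := by
    intro j
    have hset : {w : Fin m → Vec d | ∀ r, sgn j * inner ℝ (w r) v < σ₀ * ‖v‖ / 2}
        = Set.univ.pi fun _ => {x : Vec d | sgn j * inner ℝ x v < σ₀ * ‖v‖ / 2} := by
      ext; simp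
    have hmeas : MeasurableSet {x : Vec d | sgn j * inner ℝ x v < σ₀ * ‖v‖ / 2} :=
      measurableSet_lt (by fun_prop) (by fun_prop)
    have h2 := measure_pi_eval (Measure.pi fun _ : Fin m => isotropicGaussian d σ₀)
      (S := {w : Fin m → Vec d | ∀ r, sgn j * inner ℝ (w r) v < σ₀ * ‖v‖ / 2})
      (by rw [hset]; exact MeasurableSet.univ_pi fun _ => hmeas) j
    refine h2.trans_le ?_
    rw [hset, Measure.pi_pi, Finset.prod_const, Finset.card_univ, Fintype.card_fin]
    exact pow_le_pow_left₀ zero_le (isotropicGaussian_inner_lt_le hσ₀ hv j) m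
  have h2 := measure_exists_le _ h1
  rw [Fintype.card_bool, ← outcomeLaw_init (n := n) (v := v) (σξ := σξ) (σz := σz)] at h2
  refine (measure_mono ?_).trans h2
  intro ω hω
  have hω' : ¬ ∀ j, ∃ r, σ₀ * ‖v‖ / 2 ≤ sgn j * inner ℝ (ω.2.1 j r) v := hω
  push Not at hω'
  exact hω'

theorem measure_walk_signal_le (hσz : 0 ≤ σz) {u : ℝ} (hu : 0 ≤ u) (T : ℕ) :
    outcomeLaw n m v σξ σ₀ σz
        {ω | ¬ ∀ t ≤ T, |inner ℝ (noiseWalk ω t) v| ≤ u * σz * Real.sqrt t * ‖v‖}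
      ≤ (T + 1 : ℕ) * ENNReal.ofReal (2 * Real.exp (-(u ^ 2 / 2))) := by
  have h1 : ∀ t : Fin (T + 1), outcomeLaw n m v σξ σ₀ σz
      {ω | ¬ |inner ℝ (noiseWalk ω t) v| ≤ u * σz * Real.sqrt (t : ℕ) * ‖v‖}
        ≤ ENNReal.ofReal (2 * Real.exp (-(u ^ 2 / 2))) := fun t =>
    (outcomeLaw_noise _).trans_le (infinitePi_abs_inner_sum_gt_le hσz v hu t)
  have h2 := measure_exists_le _ h1
  rw [Fintype.card_fin] at h2
  refine (measure_mono ?_).trans h2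
  intro ω hω
  by_contra hcon
  have hcon' : ¬ ∃ t : Fin (T + 1),
    ¬ |inner ℝ (noiseWalk ω t) v| ≤ u * σz * Real.sqrt (t : ℕ) * ‖v‖ := hcon
  push Not at hcon'
  exact hω fun t ht => hcon' ⟨t, by omega⟩

theorem measure_walk_noise_le (hσz : 0 ≤ σz) {u : ℝ} (hu : 0 ≤ u) (T : ℕ) :
    outcomeLaw n m v σξ σ₀ σz
        {ω | ¬ ∀ t ≤ T, ∀ i, |inner ℝ (noiseWalk ω t) (noisePatches ω i)|
          ≤ u * σz * Real.sqrt t * ‖noisePatches ω i‖}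
      ≤ (T + 1 : ℕ) * (n * ENNReal.ofReal (2 * Real.exp (-(u ^ 2 / 2)))) := by
  have h0 : ∀ (t : ℕ) i, outcomeLaw n m v σξ σ₀ σz
      {ω | ¬ |inner ℝ (∑ s ∈ Finset.Icc 1 t, ω.2.2 s) (ω.1 i).2|
        ≤ u * σz * Real.sqrt t * ‖(ω.1 i).2‖} ≤ ENNReal.ofReal (2 * Real.exp (-(u ^ 2 / 2))) := by
    intro t i
    have hS : MeasurableSet {ω : Outcome n m d |
        ¬ |inner ℝ (∑ s ∈ Finset.Icc 1 t, ω.2.2 s) (ω.1 i).2|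
          ≤ u * σz * Real.sqrt t * ‖(ω.1 i).2‖} :=
      measurableSet_not_le (by fun_prop) (by fun_prop)
    refine measure_prod_le_of_forall _ _ hS fun x => ?_
    refine le_trans (le_of_eq ?_) (infinitePi_abs_inner_sum_gt_le hσz (x i).2 hu t)
    have : {b : Filters m d × (ℕ → Vec d) | (x, b) ∈
        {ω : Outcome n m d | ¬ |inner ℝ (∑ s ∈ Finset.Icc 1 t, ω.2.2 s) (ω.1 i).2|
          ≤ u * σz * Real.sqrt t * ‖(ω.1 i).2‖}}
        = Set.univ ×ˢ {z : ℕ → Vec d | ¬ |inner ℝ (∑ s ∈ Finset.Icc 1 t, z s) (x i).2|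
          ≤ u * σz * Real.sqrt t * ‖(x i).2‖} := by
      ext; simp
    erw [this]
    rw [Measure.prod_prod, measure_univ, one_mul]
  have h1 : ∀ t : Fin (T + 1), outcomeLaw n m v σξ σ₀ σz
      {ω | ∃ i, ¬ |inner ℝ (∑ s ∈ Finset.Icc 1 (t : ℕ), ω.2.2 s) (ω.1 i).2|
        ≤ u * σz * Real.sqrt (t : ℕ) * ‖(ω.1 i).2‖}
        ≤ n * ENNReal.ofReal (2 * Real.exp (-(u ^ 2 / 2))) := fun t => by
    simpa only [Fintype.card_fin] using measure_exists_le _ (h0 t)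
  have h2 := measure_exists_le _ h1
  rw [Fintype.card_fin] at h2
  refine (measure_mono ?_).trans h2
  intro ω hω
  by_contra hcon
  have hcon' : ¬ ∃ t : Fin (T + 1), ∃ i, ¬ |inner ℝ (∑ s ∈ Finset.Icc 1 (t : ℕ), ω.2.2 s)
    (ω.1 i).2| ≤ u * σz * Real.sqrt (t : ℕ) * ‖(ω.1 i).2‖ := hcon
  push Not at hcon'
  exact hω fun t ht => hcon' ⟨t, by omega⟩

theorem measure_step_signal_le (hσz : 0 ≤ σz) {u : ℝ} (hu : 0 ≤ u) (T : ℕ) :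
    outcomeLaw n m v σξ σ₀ σz
        {ω | ¬ ∀ t ≤ T, |inner ℝ (privateNoise ω (t + 1)) v| ≤ u * σz * ‖v‖}
      ≤ (T + 1 : ℕ) * ENNReal.ofReal (2 * Real.exp (-(u ^ 2 / 2))) := by
  have hmeas : MeasurableSet {x : Vec d | ¬ |inner ℝ x v| ≤ u * σz * ‖v‖} :=
    measurableSet_not_le (by fun_prop) (by fun_prop)
  have h1 : ∀ t : Fin (T + 1), outcomeLaw n m v σξ σ₀ σz
      {ω | ¬ |inner ℝ (ω.2.2 (t + 1)) v| ≤ u * σz * ‖v‖}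
        ≤ ENNReal.ofReal (2 * Real.exp (-(u ^ 2 / 2))) := fun t => by
    refine (outcomeLaw_noise {z | ¬ |inner ℝ (z (t + 1)) v| ≤ u * σz * ‖v‖}).trans_le ?_
    have := (measurePreserving_eval_infinitePi (fun _ : ℕ => isotropicGaussian d σz)
      ((t : ℕ) + 1)).measure_preimage hmeas.nullMeasurableSet
    exact this.trans_le (isotropicGaussian_abs_inner_gt_le hσz v hu)
  have h2 := measure_exists_le _ h1
  rw [Fintype.card_fin] at h2
  refine (measure_mono ?_).trans h2
  intro ω hω
  by_contra hcon
  have hcon' : ¬ ∃ t : Fin (T + 1), ¬ |inner ℝ (ω.2.2 (t + 1)) v| ≤ u * σz * ‖v‖ := hcon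
  push Not at hcon'
  exact hω fun t ht => hcon' ⟨t, by omega⟩

/-- The union bound over the failure of the individual conditions. -/
theorem measure_not_typicalOutcome_le (hv : v ≠ 0) (hσξ : 0 < σξ) (hσ₀ : 0 < σ₀) (hσz : 0 ≤ σz)
    (hnd : n < d) {u : ℝ} (hu : 0 ≤ u) (T : ℕ) :
    (outcomeLaw n m v σξ σ₀ σz).real {ω | ¬ TypicalOutcome u T v σξ σ₀ σz ω}
      ≤ 2 * Real.exp (-(n / 8)) + 2 * (9 / 10) ^ m
        + (n * d + 2 * m + 2 * m * n + (T + 1) * (n + 2)) * (2 * Real.exp (-(u ^ 2 / 2))) := by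
  set e := 2 * Real.exp (-(u ^ 2 / 2)) with he
  have he0 : 0 ≤ e := by positivity
  set μ := outcomeLaw n m v σξ σ₀ σz with hμ
  have hprob : IsProbabilityMeasure μ := by rw [hμ, outcomeLaw]; infer_instance
  have key : μ {ω | ¬ TypicalOutcome u T v σξ σ₀ σz ω} ≤
      0 + (0 + (ENNReal.ofReal (2 * Real.exp (-(n / 8)))
      + (n * (d * ENNReal.ofReal e)
      + (2 * (m * ENNReal.ofReal e)
      + (2 * (m * (n * ENNReal.ofReal e))
      + (2 * ENNReal.ofReal (9 / 10) ^ m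
      + ((T + 1 : ℕ) * ENNReal.ofReal e
      + ((T + 1 : ℕ) * (n * ENNReal.ofReal e)
      + (T + 1 : ℕ) * ENNReal.ofReal e)))))))) := by
    have hbal : μ {ω | ¬ ∀ j, (n : ℝ) / 4 ≤ (Finset.univ.filter fun i => labels ω i = j).card}
        ≤ ENNReal.ofReal (2 * Real.exp (-(n / 8))) :=
      (outcomeLaw_data {x : Fin n → Bool × Vec d |
        ¬ ∀ j, (n : ℝ) / 4 ≤ (Finset.univ.filter fun i => (x i).1 = j).card}).trans_le
        (measure_not_balanced_le v σξ)
    refine le_trans (measure_mono (t := _ ∪ (_ ∪ (_ ∪ (_ ∪ (_ ∪ (_ ∪ (_ ∪ (_ ∪ (_ ∪ _)))))))))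
      ?_) ((measure_union_le _ _).trans (add_le_add (measure_not_orthogonal hv).le
      ((measure_union_le _ _).trans (add_le_add (measure_not_independent hσξ hnd).le
      ((measure_union_le _ _).trans (add_le_add hbal
      ((measure_union_le _ _).trans (add_le_add (measure_patch_norm_le hσξ.le hu)
      ((measure_union_le _ _).trans (add_le_add (measure_init_signal_le hσ₀.le hu)
      ((measure_union_le _ _).trans (add_le_add (measure_init_noise_le hσ₀.le hu)
      ((measure_union_le _ _).trans (add_le_add (measure_init_large_le hσ₀ hv)
      ((measure_union_le _ _).trans (add_le_add (measure_walk_signal_le hσz hu T)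
      ((measure_union_le _ _).trans (add_le_add (measure_walk_noise_le hσz hu T)
        (measure_step_signal_le hσz hu T)))))))))))))))))))
    intro ω hω
    by_contra hcon
    simp only [Set.mem_union, Set.mem_ofPred_eq, not_or, not_not] at hcon
    obtain ⟨h1, h2, h3, h4, h5, h6, h7, h8, h9, h10⟩ := hcon
    exact hω ⟨h1, h2, h3, h4, h5, h6, h7, h8, h9, h10⟩
  have key2 := ENNReal.toReal_mono (by finiteness) key
  refine key2.trans (le_of_eq ?_)
  have hrhs : 0 + (0 + (ENNReal.ofReal (2 * Real.exp (-(n / 8)))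
      + (n * (d * ENNReal.ofReal e)
      + (2 * (m * ENNReal.ofReal e)
      + (2 * (m * (n * ENNReal.ofReal e))
      + (2 * ENNReal.ofReal (9 / 10) ^ m
      + ((T + 1 : ℕ) * ENNReal.ofReal e
      + ((T + 1 : ℕ) * (n * ENNReal.ofReal e)
      + (T + 1 : ℕ) * ENNReal.ofReal e))))))))
      = ((Real.toNNReal (2 * Real.exp (-(n / 8))) + (n * (d * e.toNNReal)
      + (2 * (m * e.toNNReal) + (2 * (m * (n * e.toNNReal))
      + (2 * (9 / 10 : ℝ).toNNReal ^ m + ((T + 1 : ℕ) * e.toNNReal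
      + ((T + 1 : ℕ) * (n * e.toNNReal) + (T + 1 : ℕ) * e.toNNReal)))))) : ℝ≥0) : ℝ≥0∞) := by
    rw [zero_add, zero_add]
    push_cast
    rfl
  rw [hrhs, ENNReal.coe_toReal]
  push_cast
  rw [Real.coe_toNNReal _ he0, Real.coe_toNNReal _ (by positivity),
    Real.coe_toNNReal _ (by positivity)]
  ring

end Probability

/-! ### Choice of the polylogarithmic factor -/

theorem one_le_one_add_log (d : ℕ) : 1 ≤ 1 + Real.log d := by
  linarith [Real.log_natCast_nonneg d]

theorem polylog_mono {k l : ℕ} (h : k ≤ l) (d : ℕ) : polylog k d ≤ polylog l d := by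
  have h1 := one_le_one_add_log d
  unfold polylog
  gcongr

theorem mul_polylog_pow_le {C : ℝ} {b c K : ℕ} (h1 : C * (b : ℝ) ^ c ≤ K)
    (h2 : b * c ≤ K) (d : ℕ) : C * polylog b d ^ c ≤ polylog K d := by
  have h := one_le_one_add_log d
  calc C * polylog b d ^ c = C * (b : ℝ) ^ c * (1 + Real.log d) ^ (b * c) := by
        rw [polylog, mul_pow, ← pow_mul]; ring
    _ ≤ K * (1 + Real.log d) ^ K := by gcongr
    _ = polylog K d := rfl

/-- Every polylogarithmic level is dominated by a polylogarithmic factor. -/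
theorem exists_dominates {q C₁ : ℝ} (hq : 2 < q) (hC₁ : 0 < C₁) {b : ℕ} (hb : 1 ≤ b) :
    ∃ K : ℕ, ∀ d : ℕ, Dominates q C₁ (polylog b d) (polylog K d) := by
  set c := 4 * ⌈q⌉₊ + 5 with hc
  set c₁ := 1024 * 4 ^ (q - 1) / (C₁ * q) with hc₁
  set c₂ := Real.exp (4 * C₁ / ((q - 2) * lossSlope (3 ^ q + 1))) with hc₂
  set c₃ := 2 * q * 3 ^ ⌈q⌉₊ with hc₃
  have hc₁0 : 0 ≤ c₁ := by positivity
  have hc₂0 : 0 ≤ c₂ := (Real.exp_pos _).le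
  have hc₃0 : 0 ≤ c₃ := by positivity
  have hc₄0 : 0 ≤ q ^ 2 * (3 : ℝ) ^ q := by positivity
  set C := c₁ + C₁ * q + c₂ + q ^ 2 * 3 ^ q + c₃ + 24 + 20 * q ^ 2 with hC
  have hCq : 0 ≤ C₁ * q := by positivity
  have hq2 : 0 ≤ q ^ 2 := sq_nonneg q
  have hC0 : 0 ≤ C := by positivity
  obtain ⟨K, hK⟩ := exists_nat_ge (max (C * (b : ℝ) ^ c) ((b * c : ℕ) : ℝ))
  refine ⟨K, fun d => ?_⟩
  have hmain := mul_polylog_pow_le ((le_max_left _ _).trans hK)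
    (by exact_mod_cast (le_max_right _ _).trans hK) d
  set L := polylog K d
  have hu : 1 ≤ polylog b d := by
    refine one_le_mul_of_one_le_of_one_le (by exact_mod_cast hb) ?_
    exact one_le_pow₀ (one_le_one_add_log d)
  set u := polylog b d
  have key : ∀ a : ℝ, 0 ≤ a → a ≤ C → ∀ k ≤ c, a * u ^ k ≤ L := by
    intro a ha haC k hk
    refine le_trans ?_ hmain
    gcongr
  have key0 : ∀ a : ℝ, 0 ≤ a → a ≤ C → a ≤ L := by
    intro a ha haC
    simpa using key a ha haC 0 (Nat.zero_le _)
  refine ⟨hu, key0 1 (by norm_num) (by linarith), key _ hc₁0 (by linarith) 5 (by omega),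
    key0 _ hCq (by linarith), key0 _ hc₂0 (by linarith), key0 _ hc₄0 (by linarith), ?_,
    key _ (by norm_num) (by linarith) 4 (by omega), key0 _ (by positivity) (by linarith)⟩
  have h1 : (3 * u ^ 4) ^ (q - 1) ≤ (3 * u ^ 4) ^ ⌈q⌉₊ := by
    rw [← Real.rpow_natCast (3 * u ^ 4)]
    refine Real.rpow_le_rpow_of_exponent_le ?_ (by linarith [Nat.le_ceil q])
    linarith [one_le_pow₀ hu (n := 4)]
  calc 2 * q * u ^ 3 * (3 * u ^ 4) ^ (q - 1) ≤ 2 * q * u ^ 3 * (3 * u ^ 4) ^ ⌈q⌉₊ := by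
        gcongr
    _ = c₃ * u ^ (4 * ⌈q⌉₊ + 3) := by rw [hc₃]; ring
    _ ≤ L := key _ hc₃0 (by linarith) _ (by omega)

/-! ### The number of iterations and the probability of failure -/

section Iterations

variable {n m d T : ℕ} {u σξ σ₀ η ε Tstar : ℝ} {v : Vec d}

theorem le_exp_of_le_maxPrivateIterations (hTstar : 4 * Real.log Tstar ≤ u)
    (hT : (T : ℝ) ≤ maxPrivateIterations n m v σξ σ₀ η ε Tstar) : (T : ℝ) ≤ Real.exp (u / 4) := by
  have h1 : (T : ℝ) ≤ Tstar := hT.trans (min_le_left _ _)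
  rcases Nat.eq_zero_or_pos T with rfl | hpos
  · simpa using (Real.exp_pos _).le
  · have h2 : (1 : ℝ) ≤ T := by exact_mod_cast hpos
    refine h1.trans ?_
    rw [← Real.log_le_iff_le_exp (by linarith)]
    linarith

theorem mul_le_of_le_maxPrivateIterations (hv : v ≠ 0) (hσξ : 0 < σξ) (hσ₀ : 0 < σ₀)
    (hη : 0 < η) (hε : 0 < ε) (hu : 0 ≤ u) (hTstar : 4 * Real.log Tstar ≤ u)
    (hT : (T : ℝ) ≤ maxPrivateIterations n m v σξ σ₀ η ε Tstar) :
    η * T * (‖v‖ + noiseNorm d σξ) ≤ u * m * (n * ε) * σ₀ := by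
  have hV : 0 < ‖v‖ := norm_pos_iff.2 hv
  have hN : 0 ≤ noiseNorm d σξ := by unfold noiseNorm; positivity
  have hμ : (muMax v σξ)⁻¹ ≤ 1 := inv_le_one_of_one_le₀ (le_max_left _ _)
  have hμ0 : 0 ≤ (muMax v σξ)⁻¹ := inv_nonneg.2 (zero_le_one.trans (le_max_left _ _))
  have h1 := hT.trans (min_le_right _ _)
  calc η * T * (‖v‖ + noiseNorm d σξ)
      ≤ η * (η⁻¹ * (4 * Real.log Tstar * m * n * ε * σ₀ * (muMax v σξ)⁻¹
        * (‖v‖ + noiseNorm d σξ)⁻¹)) * (‖v‖ + noiseNorm d σξ) := by gcongr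
    _ = 4 * Real.log Tstar * (m * n * ε * σ₀) * (muMax v σξ)⁻¹ := by field_simp
    _ ≤ u * (m * n * ε * σ₀) * 1 := by gcongr
    _ = u * m * (n * ε) * σ₀ := by ring

theorem exp_neg_le_one_div {c x : ℝ} (hd : 0 < d) (hc : 1 ≤ c)
    (hx : c * (1 + Real.log d) ≤ x) : Real.exp (-x) ≤ 1 / (c + 1) * (1 / d) := by
  have hd' : (0 : ℝ) < d := by exact_mod_cast hd
  have hlog := Real.log_natCast_nonneg d
  have h1 : -x ≤ -c - Real.log d := by nlinarith
  calc Real.exp (-x) ≤ Real.exp (-c - Real.log d) := Real.exp_le_exp.2 h1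
    _ = (Real.exp c)⁻¹ * (1 / d) := by
        rw [Real.exp_sub, Real.exp_neg, Real.exp_log hd', div_eq_mul_one_div]
    _ ≤ 1 / (c + 1) * (1 / d) := by
        rw [one_div (c + 1)]
        gcongr
        exact Real.add_one_le_exp c

/-- The failure probability of the union bound over all typicality conditions is at most `1 / d`
once the deviation level is a large multiple of `log d`. -/
theorem failure_le (hd : 0 < d) (hu : 40 * (1 + Real.log d) ≤ u) (hn : 24 * u ^ 4 ≤ n)
    (hm : 24 * u ^ 4 ≤ m) (hnd : n ≤ d) (hmd : m ≤ d) (hT : (T : ℝ) ≤ Real.exp (u / 4)) :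
    2 * Real.exp (-(n / 8)) + 2 * (9 / 10 : ℝ) ^ m
      + (n * d + 2 * m + 2 * m * n + (T + 1) * (n + 2)) * (2 * Real.exp (-(u ^ 2 / 2)))
      ≤ 1 / d := by
  have hl := one_le_one_add_log d
  have hu1 : 40 ≤ u := by linarith
  have hu4 : u ≤ u ^ 4 := le_self_pow₀ (by linarith) (by norm_num)
  have hd1 : (1 : ℝ) ≤ d := by exact_mod_cast hd
  have hd' : (0 : ℝ) < d := by linarith
  have hnd' : (n : ℝ) ≤ d := by exact_mod_cast hnd
  have hmd' : (m : ℝ) ≤ d := by exact_mod_cast hmd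
  have h1 : Real.exp (-(n / 8)) ≤ 1 / (24 + 1) * (1 / d) :=
    exp_neg_le_one_div hd (by norm_num) (by linarith)
  have h2 : (9 / 10 : ℝ) ^ m ≤ 1 / (24 + 1) * (1 / d) := by
    refine le_trans ?_ (exp_neg_le_one_div (x := m / 10) hd (by norm_num) (by linarith))
    have e1 : (9 / 10 : ℝ) ≤ Real.exp (-(1 / 10)) := by
      linarith [Real.add_one_le_exp (-(1 / 10 : ℝ))]
    calc (9 / 10 : ℝ) ^ m ≤ Real.exp (-(1 / 10)) ^ m := by gcongr
      _ = Real.exp (-(m / 10)) := by rw [← Real.exp_nat_mul]; congr 1; ring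
  have h3 : (n * d + 2 * m + 2 * m * n + (T + 1) * (n + 2) : ℝ)
      ≤ 11 * (d ^ 2 * Real.exp (u / 4)) := by
    have hE : 1 ≤ Real.exp (u / 4) := Real.one_le_exp (by linarith)
    set e := Real.exp (u / 4)
    calc (n * d + 2 * m + 2 * m * n + (T + 1) * (n + 2) : ℝ)
        ≤ d * d + 2 * (d * d) + 2 * d * d + (e + e) * (d + 2 * d) := by
          gcongr
          · nlinarith
          · linarith
      _ = 5 * (d * d * 1) + 6 * (1 * d * e) := by ring
      _ ≤ 5 * (d * d * e) + 6 * (d * d * e) := by gcongr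
      _ = 11 * (d ^ 2 * e) := by ring
  have h4 : d ^ 2 * Real.exp (u / 4) * Real.exp (-(u ^ 2 / 2)) ≤ 1 / (99 + 1) * (1 / d) := by
    have e1 : (d : ℝ) ^ 2 = Real.exp (2 * Real.log d) := by
      rw [mul_comm, Real.exp_mul, Real.exp_log hd']
      norm_cast
    rw [e1, ← Real.exp_add, ← Real.exp_add]
    refine le_trans (le_of_eq ?_) (exp_neg_le_one_div
      (x := -(2 * Real.log d + u / 4 + -(u ^ 2 / 2))) hd (by norm_num) ?_)
    · rw [neg_neg]
    · nlinarith
  calc _ ≤ 2 * (1 / (24 + 1) * (1 / d)) + 2 * (1 / (24 + 1) * (1 / d))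
        + 11 * (d ^ 2 * Real.exp (u / 4)) * (2 * Real.exp (-(u ^ 2 / 2))) := by gcongr
    _ = 4 / 25 * (1 / d) + 22 * (d ^ 2 * Real.exp (u / 4) * Real.exp (-(u ^ 2 / 2))) := by ring
    _ ≤ 4 / 25 * (1 / d) + 22 * (1 / (99 + 1) * (1 / d)) := by gcongr
    _ ≤ 1 / d := by
        have : (0 : ℝ) < 1 / d := by positivity
        linarith

end Iterations

/-- A property that fails with outer measure at most `δ` holds on a measurable event of probability
at least `1 - δ`: the complement of a measurable hull. -/
theorem exists_measurableSet_of_real_not_le {α : Type*} [MeasurableSpace α] (μ : Measure α)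
    [IsProbabilityMeasure μ] {p : α → Prop} {δ : ℝ} (h : μ.real {ω | ¬ p ω} ≤ δ) :
    ∃ E, MeasurableSet E ∧ 1 - δ ≤ μ.real E ∧ ∀ ω ∈ E, p ω := by
  refine ⟨(toMeasurable μ {ω | ¬ p ω})ᶜ, (measurableSet_toMeasurable _ _).compl, ?_, ?_⟩
  · rw [measureReal_compl (measurableSet_toMeasurable _ _), probReal_univ, Measure.real,
      measure_toMeasurable]
    linarith [show (μ {ω | ¬ p ω}).toReal ≤ δ from h]
  · intro ω hω
    by_contra hp
    exact hω (subset_toMeasurable μ _ hp)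

/-! ### Training dynamics of a typical outcome -/

theorem privateNoiseStd_eq {n m T d : ℕ} (C : ℝ) (v : Vec d) (σξ ε : ℝ) :
    privateNoiseStd C n m T v σξ ε
      = C * Real.sqrt T * (‖v‖ + noiseNorm d σξ) / (m * (n * ε)) := by
  rw [privateNoiseStd, mul_assoc (m : ℝ)]

/-- From the potential inequality in the signal direction to the bound on the risk. -/
theorem le_of_potential_le {q η V κ u σz L F S τ H m d : ℝ} (hq : 2 < q) (hη : 0 < η)
    (hV : 0 < V) (hm : 0 ≤ m) (hτ : 0 ≤ τ) (hσz : 0 ≤ σz) (hu : 0 ≤ u)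
    (hH : H + 1 ≤ 7 * u * Real.sqrt m) (hd : 4 * m * u ^ 2 ≤ d) (hL : 14 * u ^ 2 ≤ L)
    (h : (2 * q - 1) * (η * V ^ 2) * S ≤ V ^ 2 * F
      + τ * (η * V ^ 2 * κ + 2 * (η * (u * σz * V)) * (m * (H + 1))
        + 4 * m * (η * (u * σz * V)) ^ 2)) :
    S ≤ (F / ((2 * q - 1) * η) + τ * κ / (2 * q - 1))
      + τ * ((η * d * σz ^ 2 + L * (σz * m ^ (3 / 2 : ℝ) * V⁻¹)) / (2 * q - 1)) := by
  have hq1 : 0 < 2 * q - 1 := by linarith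
  have hpow : m ^ (3 / 2 : ℝ) = m * Real.sqrt m := by
    rw [Real.sqrt_eq_rpow, show (3 / 2 : ℝ) = 1 + 1 / 2 by norm_num,
      Real.rpow_add' hm (by norm_num), Real.rpow_one]
  have h1 : 2 * (η * (u * σz * V)) * (m * (H + 1))
      ≤ η * V ^ 2 * (L * (σz * (m * Real.sqrt m) * V⁻¹)) := by
    calc 2 * (η * (u * σz * V)) * (m * (H + 1))
        ≤ 2 * (η * (u * σz * V)) * (m * (7 * u * Real.sqrt m)) := by gcongr
      _ = 14 * u ^ 2 * (η * σz * V * m * Real.sqrt m) := by ring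
      _ ≤ L * (η * σz * V * m * Real.sqrt m) := by gcongr
      _ = _ := by field_simp
  have h2 : 4 * m * (η * (u * σz * V)) ^ 2 ≤ η * V ^ 2 * (η * d * σz ^ 2) := by
    calc 4 * m * (η * (u * σz * V)) ^ 2 = 4 * m * u ^ 2 * (η * V * σz) ^ 2 := by ring
      _ ≤ d * (η * V * σz) ^ 2 := by gcongr
      _ = _ := by ring
  rw [hpow]
  have h3 : (2 * q - 1) * (η * V ^ 2) * S ≤ (2 * q - 1) * (η * V ^ 2)
      * ((F / ((2 * q - 1) * η) + τ * κ / (2 * q - 1))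
        + τ * ((η * d * σz ^ 2 + L * (σz * (m * Real.sqrt m) * V⁻¹)) / (2 * q - 1))) := by
    calc (2 * q - 1) * (η * V ^ 2) * S ≤ V ^ 2 * F + τ * (η * V ^ 2 * κ
          + η * V ^ 2 * (L * (σz * (m * Real.sqrt m) * V⁻¹))
          + η * V ^ 2 * (η * d * σz ^ 2)) := h.trans (by gcongr)
      _ = _ := by field_simp; ring
  exact le_of_mul_le_mul_left h3 (by positivity)

namespace TypicalOutcome

variable {n m d : ℕ} {u L q C₁ κ σξ σ₀ η ε Cz : ℝ} {T : ℕ} {v : Vec d} {ω : Outcome n m d}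

theorem exists_two_le_signalCoeff [NeZero n] [NeZero m]
    (h : TypicalOutcome u T v σξ σ₀ (privateNoiseStd Cz n m T v σξ ε) ω)
    (hS : Scales q L ‖v‖ (noiseNorm d σξ) σ₀ η (n * ε) m) (hD : Dominates q C₁ u L) (hq : 2 < q)
    (hC₁ : 0 < C₁) (hCz0 : 0 ≤ Cz) (hCz : Cz ≤ u)
    (hT : η * T * (‖v‖ + noiseNorm d σξ) ≤ u * m * (n * ε) * σ₀)
    (hT₁ : stageOneEnd q C₁ m v σ₀ η ≤ T)
    (hP : SignalProcess q (η * ‖v‖ ^ 2) (labels ω) (marginAt q η v ω) (signalCoord q η v ω)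
      (signalCoeff q η v ω) (fun t => η * inner ℝ (noiseWalk ω t) v) T) (j : Bool) :
    ∃ r, 2 ≤ signalCoeff q η v ω (stageOneEnd q C₁ m v σ₀ η) j r := by
  have hu := hD.one_le_level
  have hx : 0 < n * ε := by linarith [hS.one_le_x]
  have hm : (0 : ℝ) < m := by linarith [hS.one_le_m]
  refine hP.exists_two_le_coeff hq hS.signal_pos ?_ hT₁ (h.balanced j) (h.init_large j) ?_
    (hS.blowup_small hD hq) (stageOneEnd_long hS hD hq hC₁)
  · nlinarith [hS.signal, hD.one_le, hS.signal_pos]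
  · intro t ht
    have h1 := walk_le_quarter (t := t) (by linarith) (by linarith [hS.V_pos, hS.N_pos]) hS.N_le_V
      hS.step_pos.le hm hx hS.init_pos.le hCz0 hCz (Nat.cast_nonneg T) hT (Nat.cast_nonneg _)
      (stageOneEnd_short hS hD hq hC₁) (by exact_mod_cast ht)
    have h2 := h.walk_signal t (ht.trans hT₁)
    rw [privateNoiseStd_eq] at h2
    rw [abs_mul, abs_of_nonneg hS.step_pos.le]
    calc η * |inner ℝ (noiseWalk ω t) v| ≤ η * (u * (Cz * Real.sqrt T
          * (‖v‖ + noiseNorm d σξ) / (m * (n * ε))) * Real.sqrt t * ‖v‖) :=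
          mul_le_mul_of_nonneg_left h2 hS.step_pos.le
      _ = η * (u * (Cz * Real.sqrt T
          * (‖v‖ + noiseNorm d σξ) / (m * (n * ε))) * Real.sqrt t) * ‖v‖ := by ring
      _ ≤ σ₀ / 4 * ‖v‖ := by gcongr
      _ = σ₀ * ‖v‖ / 4 := by ring

/-- The risk bound, for a process of signal coefficients that has passed the first stage. -/
theorem sum_empiricalRisk_le [NeZero n] [NeZero m] {σz : ℝ} (h : TypicalOutcome u T v σξ σ₀ σz ω)
    (hS : Scales q L ‖v‖ (noiseNorm d σξ) σ₀ η (n * ε) m) (hD : Dominates q C₁ u L) (hq : 2 < q)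
    (hκ : 0 < κ) (hσz : 0 ≤ σz) (hdim : 4 * m * u ^ 2 ≤ d) (hTu : (T : ℝ) ≤ Real.exp u)
    (hP : SignalProcess q (η * ‖v‖ ^ 2) (labels ω) (marginAt q η v ω) (signalCoord q η v ω)
      (signalCoeff q η v ω) (fun t => η * inner ℝ (noiseWalk ω t) v) T) {T₁ : ℕ}
    (hgrown : ∀ j, ∃ r, 2 ≤ signalCoeff q η v ω T₁ j r) {t : ℕ} (ht₁ : T₁ ≤ t) (ht : t ≤ T) :
    ∑ s ∈ Finset.Icc T₁ t, empiricalRisk q (trainingSet v ω) (trajectory q η v ω s) ≤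
      (frobNorm (trajectory q η v ω T₁ - reference q κ v (trajectory q η v ω 0)) ^ 2
          / ((2 * q - 1) * η)
        + ((t : ℝ) - T₁ + 1) * κ / (2 * q - 1))
      + ((t : ℝ) - T₁ + 1) *
        ((η * d * σz ^ 2 + L * (σz * (m : ℝ) ^ (3 / 2 : ℝ) * ‖v‖⁻¹)) / (2 * q - 1)) := by
  have hV := hS.V_pos
  have hη := hS.step_pos
  have hu := hD.one_le_level
  have hL := hD.one_le
  have hq1 : 0 < 2 * q - 1 := by linarith
  have hτ : 0 ≤ (t : ℝ) - T₁ + 1 := by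
    have : (T₁ : ℝ) ≤ t := by exact_mod_cast ht₁
    linarith
  simp only [empiricalRisk_trajectory]
  rcases le_or_gt (2 * q - 1) κ with hκq | hκq
  · -- The bound is trivial here, because the risk never exceeds one.
    have h1 : ∑ s ∈ Finset.Icc T₁ t, meanLoss (marginAt q η v ω s) ≤ (t : ℝ) - T₁ + 1 := by
      have h2 := Finset.sum_le_card_nsmul (Finset.Icc T₁ t)
        (fun s => meanLoss (marginAt q η v ω s)) 1 fun s hs =>
          (hP.signalDominated (by linarith)
            ((Finset.mem_Icc.1 hs).2.trans ht)).meanLoss_le_one (by linarith)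
      refine h2.trans (le_of_eq ?_)
      rw [Nat.card_Icc, nsmul_eq_mul, mul_one, Nat.cast_sub (by omega)]
      push_cast
      ring
    have h2 : (t : ℝ) - T₁ + 1 ≤ ((t : ℝ) - T₁ + 1) * κ / (2 * q - 1) := by
      rw [le_div_iff₀ hq1]
      gcongr
    have h3 : 0 ≤ frobNorm (trajectory q η v ω T₁ - reference q κ v (trajectory q η v ω 0)) ^ 2
        / ((2 * q - 1) * η) := by positivity
    have h4 : 0 ≤ ((t : ℝ) - T₁ + 1) *
        ((η * d * σz ^ 2 + L * (σz * (m : ℝ) ^ (3 / 2 : ℝ) * ‖v‖⁻¹)) / (2 * q - 1)) := by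
      positivity
    linarith
  · have hm1 := hS.one_le_m
    have hm : (0 : ℝ) < m := by linarith
    have hsqrt : 0 ≤ Real.sqrt (2 * m * u) := Real.sqrt_nonneg _
    have hBq := hS.step_small hD
    have hB : 0 ≤ η * ‖v‖ ^ 2 := by positivity
    -- Beyond `G = 2 + √(2 m u)` the increments are at most `exp (-u) ≤ 1 / T`.
    have hH := fun t (ht : t ≤ T) j r => hP.coeff_le (t := t) (G := 2 + Real.sqrt (2 * m * u)) hq
      (by nlinarith) (by linarith) (by
        have e1 : u ≤ (2 + Real.sqrt (2 * m * u) - 1) ^ 2 / (2 * m) := by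
          rw [le_div_iff₀ (by positivity)]
          nlinarith [Real.sq_sqrt (show 0 ≤ 2 * m * u by positivity)]
        calc (T : ℝ) * Real.exp (-((2 + Real.sqrt (2 * m * u) - 1) ^ 2 / (2 * m)))
            ≤ Real.exp u * Real.exp (-u) := by gcongr
          _ = 1 := by rw [← Real.exp_add, add_neg_cancel, Real.exp_zero]) ht j r
    have hζ : ∀ t ≤ T, |η * inner ℝ (noiseWalk ω (t + 1)) v - η * inner ℝ (noiseWalk ω t) v|
        ≤ η * (u * σz * ‖v‖) := by
      intro t ht
      rw [← mul_sub, noiseWalk_succ, inner_add_left, add_sub_cancel_left, abs_mul,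
        abs_of_pos hη]
      exact mul_le_mul_of_nonneg_left (h.step_signal t ht) hη.le
    have hmain := hP.sum_meanLoss_le hq hBq hκ hκq hgrown hH hζ ht₁ ht
    refine le_of_potential_le (H := 2 + Real.sqrt (2 * m * u) + 2) hq hη hV hm.le hτ hσz
      (by linarith) ?_ hdim ?_ (hmain.trans (add_le_add_left
        (sum_sq_signal_le_frobNorm_sq (norm_pos_iff.1 hV) q κ _ _) _))
    · have e1 : Real.sqrt (2 * m * u) ≤ 2 * u * Real.sqrt m := by
        rw [Real.sqrt_le_left (by positivity), mul_pow, Real.sq_sqrt hm.le]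
        nlinarith [mul_nonneg hm.le (show 0 ≤ u by linarith)]
      have e2 : 1 ≤ Real.sqrt m := Real.one_le_sqrt.2 hm1
      nlinarith
    · have e1 : u ^ 2 ≤ u ^ 4 := pow_le_pow_right₀ hu (by norm_num)
      have e2 := sq_nonneg u
      linarith [hD.margin]

end TypicalOutcome

end NoisyGD

end

open NoisyGD in
theorem corollary4p7 (q κ C₁ : ℝ) (hq : 2 < q) (hκ : 0 < κ) (hC₁ : 0 < C₁) (A : ℕ) :
    ∃ K : ℕ, ∀ (d n m T : ℕ) (v : Vec d) (σξ σ₀ η ε Tstar Cz : ℝ),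
      v ≠ 0 → 0 < σξ → 0 < σ₀ → 0 < η → 0 < ε →
      SignalLearning q (polylog K d) n m v σξ σ₀ η ε →
      4 * Real.log Tstar ≤ polylog A d →
      (T : ℝ) ≤ maxPrivateIterations n m v σξ σ₀ η ε Tstar →
      0 ≤ Cz → Cz ≤ polylog A d →
      stageOneEnd q C₁ m v σ₀ η ≤ T →
      let σz := privateNoiseStd Cz n m T v σξ ε
      let T₁ := stageOneEnd q C₁ m v σ₀ η
      ∃ E : Set (Outcome n m d),
        MeasurableSet E ∧
        1 - 1 / (d : ℝ) ≤ (outcomeLaw n m v σξ σ₀ σz).real E ∧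
        ∀ ω ∈ E,
          let W := trajectory q η v ω
          ∃ (Γ : ℕ → Bool → Fin m → ℝ) (Φ : ℕ → Bool → Fin m → Fin n → ℝ),
            -- the decomposition exists and is unique
            (∀ Γ' Φ', IsDecomposition η v (noisePatches ω) (privateNoise ω) W Γ' Φ' ↔
              Γ' = Γ ∧ Φ' = Φ) ∧
            -- `T₁` ends the first stage
            (∀ j, ∃ r, 2 ≤ Γ T₁ j r) ∧
            (∀ t ≤ T₁, ∀ j r i, |Φ t j r i| ≤ σ₀ * σξ * Real.sqrt d / 2) ∧
            -- the noise coefficients stay small after the first stage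
            ((m : ℝ) ≤ (n * ε) ^ (q + 1) →
              ∀ t, T₁ ≤ t → t ≤ T → ∀ j r i, |Φ t j r i| ≤ σ₀ * σξ * Real.sqrt d) ∧
            -- the bound on the empirical risk
            ∀ t, T₁ ≤ t → t ≤ T →
              ∑ s ∈ Finset.Icc T₁ t, empiricalRisk q (trainingSet v ω) (W s) ≤
                (frobNorm (W T₁ - reference q κ v (W 0)) ^ 2 / ((2 * q - 1) * η)
                  + ((t : ℝ) - T₁ + 1) * κ / (2 * q - 1))
                + ((t : ℝ) - T₁ + 1) *
                  ((η * d * σz ^ 2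
                      + polylog K d * (σz * (m : ℝ) ^ (3 / 2 : ℝ) * ‖v‖⁻¹)) / (2 * q - 1)) := by
  -- The deviation level `u` is `polylog (A + 40) d`. It exceeds `polylog A d`, which bounds
  -- `4 log T*` and `C_z`, and also `40 (1 + log d)`, which the union bound requires.
  obtain ⟨K, hK⟩ := exists_dominates hq hC₁ (show 1 ≤ A + 40 by omega)
  refine ⟨K, fun d n m T v σξ σ₀ η ε Tstar Cz hv hσξ hσ₀ hη hε hSL hTstar hT hCz0 hCz hT₁ => ?_⟩
  intro σz T₁
  have hD := hK d
  have hAu : polylog A d ≤ polylog (A + 40) d := polylog_mono (by omega) d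
  have hu40 : 40 * (1 + Real.log d) ≤ polylog (A + 40) d := by
    have e1 := one_le_one_add_log d
    refine le_trans ?_ (polylog_mono (show 40 ≤ A + 40 by omega) d)
    rw [polylog, Nat.cast_ofNat]
    gcongr
    exact le_self_pow₀ e1 (by norm_num)
  generalize polylog (A + 40) d = u at hD hAu hu40
  generalize polylog K d = L at hD hSL ⊢
  have hu := hD.one_le_level
  have hu0 : 0 ≤ u := by linarith
  have hu24 : u ^ 2 ≤ u ^ 4 := pow_le_pow_right₀ hu (by norm_num)
  have hu1 : 1 ≤ u ^ 2 := one_le_pow₀ hu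
  have hL := hD.one_le
  have hLu := hD.margin
  have hn1 : (1 : ℝ) ≤ n := hL.trans hSL.samples
  have hm1 : (1 : ℝ) ≤ m := hL.trans hSL.width
  have : NeZero n := ⟨by rintro rfl; norm_num at hn1⟩
  have : NeZero m := ⟨by rintro rfl; norm_num at hm1⟩
  have hdim := hSL.mul_sq_le hL
  have hLm : L * m ≤ d := by
    refine le_trans ?_ hdim
    have e1 : (1 : ℝ) ≤ n ^ 4 := one_le_pow₀ hn1
    calc L * m = L * m * 1 := (mul_one _).symm
      _ ≤ L * (m : ℝ) ^ 2 * (n : ℝ) ^ 4 := by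
        gcongr
        exact le_self_pow₀ hm1 (by norm_num)
  have hLn : L * n ≤ d := by
    refine le_trans ?_ hdim
    have e1 : (1 : ℝ) ≤ m ^ 2 := one_le_pow₀ hm1
    calc L * n = L * 1 * n := by ring
      _ ≤ L * (m : ℝ) ^ 2 * (n : ℝ) ^ 4 := by
        gcongr
        exact le_self_pow₀ hn1 (by norm_num)
  have hnd : n < d := by
    have : (n : ℝ) < d := by nlinarith
    exact_mod_cast this
  have hmd : m ≤ d := by
    have : (m : ℝ) ≤ d := by nlinarith
    exact_mod_cast this
  have hd0 : 0 < d := by omega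
  have hN : 0 < noiseNorm d σξ := by
    unfold noiseNorm
    positivity
  have hS := hSL.scales hq hL hv hN hσ₀ hη hε
  have hTu := le_exp_of_le_maxPrivateIterations (hTstar.trans hAu) hT
  have hTη := mul_le_of_le_maxPrivateIterations hv hσξ hσ₀ hη hε hu0 (hTstar.trans hAu) hT
  have hσz : 0 ≤ σz := by
    simp only [σz, privateNoiseStd]
    positivity
  have : IsProbabilityMeasure (outcomeLaw n m v σξ σ₀ σz) := by
    rw [outcomeLaw]; infer_instance
  obtain ⟨E, hE, hprob, htyp⟩ := exists_measurableSet_of_real_not_le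
    (outcomeLaw n m v σξ σ₀ σz)
    ((measure_not_typicalOutcome_le (m := m) hv hσξ hσ₀ hσz hnd hu0 T).trans
      (failure_le hd0 hu40 (hLu.trans hSL.samples) (hLu.trans hSL.width) hnd.le hmd hTu))
  refine ⟨E, hE, hprob, fun ω hω => ?_⟩
  have h := htyp ω hω
  intro W
  have hwalk : ∀ t ≤ T, η * (u * σz * Real.sqrt t) ≤ u ^ 3 * σ₀ := by
    intro t ht
    simp only [σz, privateNoiseStd_eq]
    exact walk_le hu0 (by positivity) hη.le (by linarith) (by positivity) (hCz.trans hAu)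
      (Nat.cast_nonneg T) hTη (by exact_mod_cast ht)
  have hrate := hS.noise_rate hD hq (Nat.cast_nonneg T) hTη
  have hΦ : ∀ t ≤ T, ∀ j r, ∑ k, |noiseCoeff q η v ω t j r k| / ‖noisePatches ω k‖
      ≤ σ₀ / (2 * u) := fun t ht j r =>
    h.sum_noiseCoeff_le hη.le (by linarith) hv hu hσ₀.le hσξ.le hwalk hrate ht j r
  have hP := h.signalProcess_trajectory hη.le (by linarith) hv hu hσ₀.le hwalk hΦ
    (hS.noise_margin hD) (hS.signal_margin hD)
  have hdec := isDecomposition hη.le (by linarith : 1 < q) hv h.noisePatch_ne_zero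
  have hgrown : ∀ j, ∃ r, 2 ≤ signalCoeff q η v ω T₁ j r :=
    h.exists_two_le_signalCoeff hS hD hq hC₁ hCz0 (hCz.trans hAu) hTη hT₁ hP
  refine ⟨signalCoeff q η v ω, noiseCoeff q η v ω, fun Γ' Φ' => ⟨fun h' => ?_, ?_⟩, hgrown,
    fun t ht j r i => h.abs_noiseCoeff_le hu (hΦ t (ht.trans hT₁) j r) i,
    fun _ t _ ht j r i => (h.abs_noiseCoeff_le hu (hΦ t ht j r) i).trans ?_,
    fun t ht₁ ht => h.sum_empiricalRisk_le hS hD hq hκ hσz ?_ ?_ hP hgrown ht₁ ht⟩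
  · exact isDecomposition_unique hv h.orthogonal h.independent hdec h'
  · rintro ⟨rfl, rfl⟩
    exact hdec
  · have : 0 ≤ σ₀ * σξ * Real.sqrt d := by positivity
    linarith
  · nlinarith
  · exact hTu.trans (Real.exp_le_exp.2 (by linarith))
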